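/- Let $d\ge 1$, $\mathcal S_d=\{x\in[0,1]^d:\sum_i|x_i|\le 1\}$, $[d]=\{1,\dots,d\}$. Let $f$ be a probability density on $\mathbb R^d$ vanishing outside $\mathcal S_d$, and suppose that there are an open set $U\supseteq\mathcal S_d$ and $f_{\mathrm{ext}}\in C^2(U)$ with $f_{\mathrm{ext}}=f$ on $\mathcal S_d$; partial derivatives of $f$ on $\mathcal S_d$ mean those of $f_{\mathrm{ext}}$. Let $X_1,X_2,\dots$ be i.i.d. with density $f$. For $n,m\ge 1$ put $$\widetilde f_{n,m}(x)=\sum_{k\in\mathbb N_0^d,\ \|k\|_1\le m-1} m^d\Big\{\frac1n\sum_{i=1}^n \mathbf 1_{(k/m,(k+1)/m]}(X_i)\Big\}P_{k,m-1}(x),\qquad P_{k,N}(x)=\frac{N!}{(N-\|k\|_1)!\prod_i k_i!}(1-\|x\|_1)^{N-\|k\|_1}\prod_i x_i^{k_i},$$ where $(k/m,(k+1)/m]=\prod_i(k_i/m,(k_i+1)/m]$, and $\mathrm{MSE}(\widetilde f_{n,m}(x))=\mathbb E[(\widetilde f_{n,m}(x)-f(x))^2]$. For every $x\in\mathcal S_d$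 and $n,m\ge1$, $\widetilde f_{n,m}(x)$ is square integrable and $$\mathrm{MSE}(\widetilde f_{n,m}(x))=\mathrm{Var}(\widetilde f_{n,m}(x))+\big(\mathbb E[\widetilde f_{n,m}(x)]-f(x)\big)^2 .$$ Fix $\mathcal J\subseteq[d]$ and $\lambda_i\ge 0$ for $i\in\mathcal J$. Let $x_i\in(0,1)$ for $i\in[d]\setminus\mathcal J$ with $\sum_{i\notin\mathcal J}x_i<1$, let $x^{(m)}$ be the point with $x^{(m)}_i=\lambda_i/m$ for $i\in\mathcal J$ and $x^{(m)}_i=x_i$ for $i\notin\mathcal J$ (it lies in $\mathcal S_d$ for all large $m$), and let $x^0$ be the point with $x^0_i=0$ for $i\in\mathcal J$ and $x^0_i=x_i$ for $i\notin\mathcal J$. Put $q=d+|\mathcal J|$, $I_0(z)=\sum_{k\ge0}(z/2)^{2k}/(k!)^2$, $$V=f(x^0)\Big[(4\pi)^{d-|\mathcal J|}\Big(1-\sum_{i\notin\mathcal J}x_i\Big)\prod_{i\notin\mathcal J}x_i\Big]^{-1/2}\prod_{i\in\mathcal J}e^{-2\lambda_i}I_0(2\lambda_i),$$ $$B=\sum_{i\in[d]}\big(\tfrac12-x_i\mathbf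 1_{\{i\notin\mathcal J\}}\big)\,\partial_i f(x^0)+\sum_{i,j\notin\mathcal J}\tfrac12\big(x_i\mathbf 1_{\{i=j\}}-x_ix_j\big)\,\partial_i\partial_j f(x^0).$$ (1) For all $n,m\ge 1$ such that $x^{(m)}\in\mathcal S_d$, $$\mathrm{MSE}(\widetilde f_{n,m}(x^{(m)}))=n^{-1}m^{q/2}V+m^{-2}B^2+n^{-1}m^{q/2}\big[O(m^{-1})+o(1)\mathbf 1_{\{\mathcal J\ne[d]\}}\big]+O(m^{-3})+o(m^{-2})\mathbf 1_{\{\mathcal J\ne[d]\}}\qquad(m\to\infty),$$ where the four remainder functions do not depend on $n$ (so the expansion holds as $n\to\infty$ along any $m=m(n)\to\infty$). Here $f$, $d$, $\mathcal J$ and $\lambda$ are fixed; the $O(m^{-1})$ is uniform in $(x_i)_{i\notin\mathcal J}$, the $o(1)$ is for each fixed $(x_i)_{i\notin\mathcal J}$, and the $O(m^{-3})$ and $o(m^{-2})$ are, for each $\delta>0$, uniform in $(x_i)_{i\notin\mathcal J}$ with $\sum_{i\notin\mathcal J}x_i\le 1-\delta$. (2) Suppose that $B\neq0$ and $f(x^0)>0$,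 and let $$m_{\mathrm{opt}}(n)=n^{\frac{2}{q+4}}\,\frac{|B|^{\frac{4}{q+4}}}{\{\frac q4V\}^{\frac{2}{q+4}}}.$$ This is the asymptotically optimal choice of $m$ with respect to the MSE: for a sequence of non-negative integers $m(n)$, the relation $m(n)/m_{\mathrm{opt}}(n)\to1$ holds if and only if $m(n)\to\infty$ and, for every integer sequence $m'(n)\to\infty$ and every $\varepsilon>0$, $\mathrm{MSE}(\widetilde f_{n,m(n)}(x^{(m(n))}))\le(1+\varepsilon)\,\mathrm{MSE}(\widetilde f_{n,m'(n)}(x^{(m'(n))}))$ for all large $n$. Moreover, for every integer sequence with $m(n)=m_{\mathrm{opt}}(n)+O(1)$ (for example, $m_{\mathrm{opt}}(n)$ rounded to an integer), as $n\to\infty$, $$\mathrm{MSE}(\widetilde f_{n,m(n)}(x^{(m(n))}))=n^{-\frac4{q+4}}\,\frac{|B|^{\frac{2q}{q+4}}}{\Big[\frac{(4/q)^{4/(q+4)}}{4/q+1}\Big]V^{-\frac4{q+4}}}+O\big(n^{-\frac6{q+4}}+\mathbf 1_{\{\mathcal J\ne[d]\}}n^{-\frac5{q+4}}\big)+o\big(n^{-\frac4{q+4}}\big)\mathbf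 1_{\{\mathcal J\ne[d]\}},$$ where the $O$ and the $o$ are for fixed $\lambda$ and $(x_i)_{i\notin\mathcal J}$. -/

import Mathlib

open MeasureTheory ProbabilityTheory Filter Topology Asymptotics

noncomputable section

namespace BernsteinSimplex

/-- The `d`-dimensional unit simplex `{x ∈ [0,1]^d : ‖x‖₁ ≤ 1}`. -/
def simplex (d : ℕ) : Set (Fin d → ℝ) :=
  {x | (∀ i, x i ∈ Set.Icc (0 : ℝ) 1) ∧ ∑ i, |x i| ≤ 1}

/-- The lattice points `ℕ₀^d ∩ N·S_d`. -/
def latticePoints (d N : ℕ) : Finset (Fin d → ℕ) :=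
  (Fintype.piFinset fun _ : Fin d => Finset.range (N + 1)).filter fun k => ∑ i, k i ≤ N

/-- The probability `P_{k,N}(x)` of the multinomial distribution with parameters `N` and `x`
(for `k ∈ latticePoints d N`). -/
def multinomialProb {d : ℕ} (N : ℕ) (k : Fin d → ℕ) (x : Fin d → ℝ) : ℝ :=
  (N.factorial : ℝ) / (((N - ∑ i, k i).factorial : ℝ) * ∏ i, ((k i).factorial : ℝ))
    * (1 - ∑ i, |x i|) ^ (N - ∑ i, k i) * ∏ i, x i ^ k i

/-- The half-open hypercube `(k/m, (k+1)/m]`. -/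
def cell {d : ℕ} (m : ℕ) (k : Fin d → ℕ) : Set (Fin d → ℝ) :=
  {y | ∀ i, (k i : ℝ) / m < y i ∧ y i ≤ ((k i : ℝ) + 1) / m}

/-- The Bernstein density estimator `f̃_{n,m}(x)` built from the first `n` points of `X`. -/
def densityEstimator {d : ℕ} (n m : ℕ) (X : ℕ → Fin d → ℝ) (x : Fin d → ℝ) : ℝ :=
  ∑ k ∈ latticePoints d (m - 1),
    (m : ℝ) ^ d * ((n : ℝ)⁻¹ * ∑ i ∈ Finset.range n, (cell m k).indicator (fun _ => (1 : ℝ)) (X i))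
      * multinomialProb (m - 1) k x

/-- The estimator as a random variable, for random observations `X 0, X 1, …`. -/
def estimatorRV {d : ℕ} {Ω : Type*} (X : ℕ → Ω → Fin d → ℝ) (n m : ℕ) (x : Fin d → ℝ) : Ω → ℝ :=
  fun ω => densityEstimator n m (fun i => X i ω) x

/-- The bias `E[f̃_{n,m}(x)] - f(x)`. -/
def bias {d : ℕ} {Ω : Type*} [MeasurableSpace Ω] (μ : Measure Ω) (X : ℕ → Ω → Fin d → ℝ)
    (f : (Fin d → ℝ) → ℝ) (n m : ℕ) (x : Fin d → ℝ) : ℝ :=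
  (∫ ω, estimatorRV X n m x ω ∂μ) - f x

/-- The mean squared error `E[(f̃_{n,m}(x) - f(x))²]`. -/
def mse {d : ℕ} {Ω : Type*} [MeasurableSpace Ω] (μ : Measure Ω) (X : ℕ → Ω → Fin d → ℝ)
    (f : (Fin d → ℝ) → ℝ) (n m : ℕ) (x : Fin d → ℝ) : ℝ :=
  ∫ ω, (estimatorRV X n m x ω - f x) ^ 2 ∂μ

/-- `f` is a probability density supported on the simplex. -/
structure IsSimplexDensity {d : ℕ} (f : (Fin d → ℝ) → ℝ) : Prop where
  nonneg : ∀ x, 0 ≤ f x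
  eq_zero : ∀ x, x ∉ simplex d → f x = 0
  integral_eq_one : ∫ x, f x = 1

/-- The first partial derivative `∂g/∂x_i`. -/
def pderiv {d : ℕ} (i : Fin d) (g : (Fin d → ℝ) → ℝ) (x : Fin d → ℝ) : ℝ :=
  fderiv ℝ g x (Pi.single i 1)

/-- The modified Bessel function of the first kind of order `ν ∈ ℕ`. -/
def besselI (ν : ℕ) (z : ℝ) : ℝ :=
  ∑' k : ℕ, (z / 2) ^ (2 * k + ν) / ((k.factorial : ℝ) * ((k + ν).factorial : ℝ))

/-- `ψ_A(x) = [(4π)^{|A|} (1 - ∑_{i ∈ A} x_i) ∏_{i ∈ A} x_i]^{-1/2}`. -/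
def psi {d : ℕ} (A : Finset (Fin d)) (x : Fin d → ℝ) : ℝ :=
  ((4 * Real.pi) ^ A.card * (1 - ∑ i ∈ A, x i) * ∏ i ∈ A, x i) ^ (-(1 / 2) : ℝ)

/-- The fixed components `x_i`, `i ∉ J`: they lie in `(0,1)` and their sum is less than one.
(The components in `J` are ignored.) -/
def admissible {d : ℕ} (J : Finset (Fin d)) : Set (Fin d → ℝ) :=
  {x | (∀ i, i ∉ J → x i ∈ Set.Ioo (0 : ℝ) 1) ∧ ∑ i ∈ Jᶜ, x i < 1}

/-- The evaluation point: component `lam i / m` for `i ∈ J`, and `x i` for `i ∉ J`. -/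
def nearPoint {d : ℕ} (J : Finset (Fin d)) (lam x : Fin d → ℝ) (m : ℕ) : Fin d → ℝ :=
  fun i => if i ∈ J then lam i / m else x i

/-- The point `x` with the components in `J` replaced by zero. -/
def facePoint {d : ℕ} (J : Finset (Fin d)) (x : Fin d → ℝ) : Fin d → ℝ :=
  fun i => if i ∈ J then 0 else x i

/-- The constant of the leading variance term,
`f(x)|_{x_J = 0} ψ_{Jᶜ}(x) ∏_{i ∈ J} e^{-2 λ_i} I_0(2 λ_i)`. -/
def varConst {d : ℕ} (f : (Fin d → ℝ) → ℝ) (J : Finset (Fin d)) (lam x : Fin d → ℝ) : ℝ :=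
  f (facePoint J x) * psi Jᶜ x * ∏ i ∈ J, (Real.exp (-2 * lam i) * besselI 0 (2 * lam i))

/-- The constant of the leading bias term (`g` is the smooth extension of the density). -/
def biasConst {d : ℕ} (g : (Fin d → ℝ) → ℝ) (J : Finset (Fin d)) (x : Fin d → ℝ) : ℝ :=
  (∑ i, (1 / 2 - (if i ∈ J then 0 else x i)) * pderiv i g (facePoint J x))
    + ∑ i ∈ Jᶜ, ∑ j ∈ Jᶜ,
        (1 / 2) * ((if i = j then x i else 0) - x i * x j)
          * pderiv i (pderiv j g) (facePoint J x)

/-- `1_{J ≠ [d]}`. -/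
def notFull {d : ℕ} (J : Finset (Fin d)) : ℝ := if J = Finset.univ then 0 else 1

/-- The optimal (real) bandwidth
`n^{2/(q+4)} |B|^{4/(q+4)} / ((q/4) V)^{2/(q+4)}`, where `q = d + |J|`. -/
def mOpt (q B V : ℝ) (n : ℕ) : ℝ :=
  (n : ℝ) ^ (2 / (q + 4)) * |B| ^ (4 / (q + 4)) / (q / 4 * V) ^ (2 / (q + 4))

/-- The leading term of the optimal mean squared error. -/
def optMSE (q B V : ℝ) (n : ℕ) : ℝ :=
  (n : ℝ) ^ (-(4 / (q + 4))) * |B| ^ (2 * q / (q + 4))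
    / ((4 / q) ^ (4 / (q + 4)) / (4 / q + 1) * V ^ (-(4 / (q + 4))))

/-- The bandwidth sequence `m = m(n) → ∞` is asymptotically optimal for the risk `M n m`: no other
bandwidth sequence tending to infinity has an asymptotically smaller risk. -/
def AsymptoticallyOptimal (M : ℕ → ℕ → ℝ) (m : ℕ → ℕ) : Prop :=
  Tendsto m atTop atTop ∧
    ∀ m' : ℕ → ℕ, Tendsto m' atTop atTop →
      ∀ ε : ℝ, 0 < ε → ∀ᶠ n in atTop, M n (m n) ≤ (1 + ε) * M n (m' n)

end BernsteinSimplex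

end

/-! Put `m = N + 1`. The estimator at `y` is the empirical mean of `n` independent copies of
`kernelFn N y (X i)`, a step function on the cells. Its mean is the multinomial average of the cell
averages of `f`; since the cells are disjoint, its square has no cross terms, so the variance is
`n⁻¹ * scaledVar`, with `scaledVar` built from the sum of `P_k²` weighted by cell averages. Hence
the MSE equals `n⁻¹ * scaledVar + bias²` exactly (`mse_eq`). The remainders are defined as
differences of these `n`-free quantities from their leading terms, and the work lies in bounding
them.

Variance: Parseval turns the sum of `P_k²` into an integral of `|charFn|^(2N)` over a torus.
Frequencies outside `J` are rescaled by `√m`, those in `J` are not. Dominated convergence yields a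
limit that is Gaussian outside `J` and a product of `exp (-2λ(1 - cos))` over `J`; the latter
integrates to `e^{-2λ} I_0(2λ)`. The Gaussian form is diagonal minus a rank-one square; an auxiliary
variable `u` splits it into a product, so no determinant is needed. Replacing cell averages by
`f(x⁰)` costs the maximal probability times a mean deviation that tends to zero
(`tendsto_sum_multinomialProb_sq`, `exists_multinomialProb_le`, `abs_sum_sq_mul_sub_le`).

Bias: inside the simplex, `f` is Taylor expanded at `y` and the multinomial moments are inserted.
For a merely `C²` function the remainder is `ε r² + K r⁴`, and second and fourth moments turn this
into `O(ε/m) + O(m⁻²)`. Cells sticking out of the simplex, where `f` may jump to zero, have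
exponentially small weight as long as the coordinate sum of `y` stays below one
(`multinomialMean_le_of_inner`).

Vertex, `J = [d]`: here `y = λ/m`, the lattice points are at mean square distance `O(m⁻²)`, a
first-order expansion suffices, and no modulus of continuity enters. Nor are frequencies rescaled,
and comparing `(1 - a/m + O(m⁻²))^N` with `e^{-a}` gives the rate `1/m`.

Optimality: with `t = m / mOpt`, the risk is `B²/mOpt²` times `(4/q) t^{q/2} + t⁻²`, up to relative
errors depending on `m` only. This profile has its unique, well-separated minimum at `t = 1`, which
gives both directions of the equivalence; its differentiability at `1` gives the rate of the optimal
MSE. -/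

namespace BernsteinSimplex

/-! ### Sums against the multinomial probabilities -/

/-- The mean of `g` under the multinomial distribution with parameters `N` and `x`. -/
noncomputable def multinomialMean {d : ℕ} {E : Type*} [AddCommGroup E] [Module ℝ E] (N : ℕ)
    (x : Fin d → ℝ) (g : (Fin d → ℕ) → E) : E :=
  ∑ k ∈ latticePoints d N, multinomialProb N k x • g k

section Multinomial

variable {d : ℕ} {E : Type*} [AddCommGroup E] [Module ℝ E]

theorem mem_latticePoints {N : ℕ} {k : Fin d → ℕ} : k ∈ latticePoints d N ↔ ∑ i, k i ≤ N := by
  simp only [latticePoints, Finset.mem_filter, Fintype.mem_piFinset, Finset.mem_range,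
    and_iff_right_iff_imp]
  intro h i
  have := Finset.single_le_sum (f := k) (fun _ _ => Nat.zero_le _) (Finset.mem_univ i)
  omega

theorem sum_add_single (k : Fin d → ℕ) (i : Fin d) :
    ∑ j, (k + Pi.single i 1 : Fin d → ℕ) j = ∑ j, k j + 1 := by
  simp [Finset.sum_add_distrib]

theorem prod_factorial_add_single (k : Fin d → ℕ) (i : Fin d) :
    ∏ j, (((k + Pi.single i 1 : Fin d → ℕ) j).factorial : ℝ)
      = (k i + 1) * ∏ j, ((k j).factorial : ℝ) := by
  rw [← Finset.mul_prod_erase _ _ (Finset.mem_univ i),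
    ← Finset.mul_prod_erase (a := i) _ (fun j => ((k j).factorial : ℝ)) (Finset.mem_univ i)]
  have h : ∏ j ∈ Finset.univ.erase i, (((k + Pi.single i 1 : Fin d → ℕ) j).factorial : ℝ)
      = ∏ j ∈ Finset.univ.erase i, ((k j).factorial : ℝ) := by
    refine Finset.prod_congr rfl fun j hj => ?_
    simp [Pi.single_eq_of_ne (Finset.ne_of_mem_erase hj)]
  rw [h]
  simp [Nat.factorial_succ]
  ring

theorem prod_pow_add_single {A : Type*} [CommMonoid A] (x : Fin d → A) (k : Fin d → ℕ)
    (i : Fin d) :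
    ∏ j, x j ^ (k + Pi.single i 1 : Fin d → ℕ) j = x i * ∏ j, x j ^ k j := by
  simp only [Pi.add_apply, pow_add, Finset.prod_mul_distrib]
  rw [mul_comm]
  congr 1
  rw [Finset.prod_eq_single i]
  · simp
  · intro j _ hj
    simp [Pi.single_eq_of_ne hj]
  · simp

/-- Absorption identity: the factor `k i + 1` cancels against the factorial in the larger
probability. All moment formulas come from this identity and its companion for the unlisted
category. -/
theorem multinomialProb_add_single {N : ℕ} (x : Fin d → ℝ) {k : Fin d → ℕ} (i : Fin d) :
    ((N : ℝ) + 1) * (x i * multinomialProb N k x)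
      = ((k i : ℝ) + 1) * multinomialProb (N + 1) (k + Pi.single i 1) x := by
  have h1 : (∏ j, ((k j).factorial : ℝ)) ≠ 0 :=
    Finset.prod_ne_zero_iff.2 fun j _ => by positivity
  have h2 : ((N - ∑ j, k j).factorial : ℝ) ≠ 0 := by positivity
  have h3 : ((k i : ℝ) + 1) ≠ 0 := by positivity
  unfold multinomialProb
  rw [sum_add_single, prod_factorial_add_single, prod_pow_add_single, Nat.add_sub_add_right,
    Nat.factorial_succ]
  push_cast
  field_simp

theorem multinomialProb_succ {N : ℕ} (x : Fin d → ℝ) {k : Fin d → ℕ} (hk : ∑ i, k i ≤ N) :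
    ((N : ℝ) + 1) * ((1 - ∑ i, |x i|) * multinomialProb N k x)
      = ((N : ℝ) + 1 - ∑ i, (k i : ℝ)) * multinomialProb (N + 1) k x := by
  have h1 : (∏ j, ((k j).factorial : ℝ)) ≠ 0 :=
    Finset.prod_ne_zero_iff.2 fun j _ => by positivity
  have h2 : ((N - ∑ j, k j).factorial : ℝ) ≠ 0 := by positivity
  have h4 : N + 1 - ∑ j, k j = (N - ∑ j, k j) + 1 := by omega
  have h5 : ((N : ℝ) + 1 - ∑ i, (k i : ℝ)) = ((N - ∑ j, k j : ℕ) : ℝ) + 1 := by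
    push_cast [Nat.cast_sub hk]; ring
  have h3 : (((N - ∑ j, k j : ℕ) : ℝ) + 1) ≠ 0 := by positivity
  rw [h5]
  unfold multinomialProb
  rw [h4, Nat.factorial_succ, Nat.factorial_succ, pow_succ]
  push_cast
  field_simp

/-- The weight `k i` kills the lattice points with `k i = 0`, and the remaining ones are exactly the
shifts by `Pi.single i 1` of the points of total at most `N`. -/
theorem multinomialMean_shift (N : ℕ) (x : Fin d → ℝ) (i : Fin d) (g : (Fin d → ℕ) → E) :
    multinomialMean (N + 1) x (fun k => (k i : ℝ) • g k)
      = (((N : ℝ) + 1) * x i) • multinomialMean N x (fun k => g (k + Pi.single i 1)) := by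
  unfold multinomialMean
  have hinj : Set.InjOn (fun k : Fin d → ℕ => k + Pi.single i 1) (latticePoints d N) :=
    fun a _ b _ h => add_right_cancel h
  rw [← Finset.sum_subset (s₁ := (latticePoints d N).image fun k => k + Pi.single i 1)]
  · rw [Finset.sum_image hinj, Finset.smul_sum]
    refine Finset.sum_congr rfl fun k _ => ?_
    rw [smul_smul, smul_smul, mul_assoc, multinomialProb_add_single]
    simp [mul_comm]
  · intro k hk
    obtain ⟨l, hl, rfl⟩ := Finset.mem_image.1 hk
    rw [mem_latticePoints] at hl ⊢
    rw [sum_add_single]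
    omega
  · intro k hk hk'
    have hki : k i = 0 := by
      by_contra h
      refine hk' (Finset.mem_image.2 ⟨k - Pi.single i 1, ?_, ?_⟩)
      · have : k - Pi.single i 1 + Pi.single i 1 = k := by
          ext j
          by_cases hj : j = i
          · subst hj; simp; omega
          · simp [Pi.single_eq_of_ne hj]
        have h2 := sum_add_single (k - Pi.single i 1) i
        rw [this] at h2
        rw [mem_latticePoints] at hk ⊢
        omega
      · ext j
        by_cases hj : j = i
        · subst hj; simp; omega
        · simp [Pi.single_eq_of_ne hj]
    simp [hki]

/-- Same mechanism for the category counted by `N + 1 - ∑ k i`: its weight vanishes on the top layer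
`∑ k i = N + 1`. -/
theorem multinomialMean_complement (N : ℕ) (x : Fin d → ℝ) (g : (Fin d → ℕ) → E) :
    multinomialMean (N + 1) x (fun k => ((N : ℝ) + 1 - ∑ i, (k i : ℝ)) • g k)
      = (((N : ℝ) + 1) * (1 - ∑ i, |x i|)) • multinomialMean N x g := by
  unfold multinomialMean
  rw [← Finset.sum_subset (s₁ := latticePoints d N), Finset.smul_sum]
  · refine Finset.sum_congr rfl fun k hk => ?_
    rw [smul_smul, smul_smul, mul_assoc, multinomialProb_succ x (mem_latticePoints.1 hk),
      mul_comm]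
  · intro k hk
    rw [mem_latticePoints] at hk ⊢
    omega
  · intro k hk hk'
    rw [mem_latticePoints] at hk hk'
    have : ∑ i, k i = N + 1 := by omega
    have h : ∑ i, (k i : ℝ) = N + 1 := by exact_mod_cast this
    simp [h]

theorem multinomialMean_add (N : ℕ) (x : Fin d → ℝ) (g h : (Fin d → ℕ) → E) :
    multinomialMean N x (fun k => g k + h k)
      = multinomialMean N x g + multinomialMean N x h := by
  simp [multinomialMean, Finset.sum_add_distrib]

theorem multinomialMean_sub (N : ℕ) (x : Fin d → ℝ) (g h : (Fin d → ℕ) → E) :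
    multinomialMean N x (fun k => g k - h k)
      = multinomialMean N x g - multinomialMean N x h := by
  simp [multinomialMean, smul_sub, Finset.sum_sub_distrib]

theorem multinomialMean_smul (N : ℕ) (x : Fin d → ℝ) (c : ℝ) (g : (Fin d → ℕ) → E) :
    multinomialMean N x (fun k => c • g k) = c • multinomialMean N x g := by
  simp only [multinomialMean, Finset.smul_sum, smul_smul, mul_comm c]

theorem multinomialMean_mul (N : ℕ) (x : Fin d → ℝ) (c : ℝ) (g : (Fin d → ℕ) → ℝ) :
    multinomialMean N x (fun k => c * g k) = c * multinomialMean N x g :=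
  multinomialMean_smul N x c g

theorem multinomialMean_sum {ι : Type*} (s : Finset ι) (N : ℕ) (x : Fin d → ℝ)
    (g : ι → (Fin d → ℕ) → E) :
    multinomialMean N x (fun k => ∑ i ∈ s, g i k) = ∑ i ∈ s, multinomialMean N x (g i) := by
  simp only [multinomialMean, Finset.smul_sum]
  rw [Finset.sum_comm]

/-- Conditioning on the last trial. After multiplication by `N + 1 = (N + 1 - ∑ k i) + ∑ k i`, each
summand is one of the two shift identities. This recursion drives the inductions below. -/
theorem multinomialMean_succ (N : ℕ) (x : Fin d → ℝ) (g : (Fin d → ℕ) → E) :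
    multinomialMean (N + 1) x g = (1 - ∑ i, |x i|) • multinomialMean N x g
      + ∑ i, x i • multinomialMean N x (fun k => g (k + Pi.single i 1)) := by
  have hN : ((N : ℝ) + 1) ≠ 0 := by positivity
  have h : ((N : ℝ) + 1) • multinomialMean (N + 1) x g
      = ((N : ℝ) + 1) • ((1 - ∑ i, |x i|) • multinomialMean N x g
      + ∑ i, x i • multinomialMean N x (fun k => g (k + Pi.single i 1))) := by
    rw [smul_add, Finset.smul_sum, smul_smul, ← multinomialMean_complement]
    simp only [smul_smul]
    simp only [← multinomialMean_shift]
    rw [← multinomialMean_sum, ← multinomialMean_add, ← multinomialMean_smul]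
    congr 1
    ext k
    rw [← Finset.sum_smul, ← add_smul]
    congr 1
    ring
  exact smul_right_injective E hN h

theorem multinomialMean_zero (x : Fin d → ℝ) (g : (Fin d → ℕ) → E) :
    multinomialMean 0 x g = g 0 := by
  have : latticePoints d 0 = {0} := by
    ext k
    simp [mem_latticePoints, funext_iff]
  simp [multinomialMean, this, multinomialProb]

/-- The generating function of the multinomial distribution. -/
theorem multinomialMean_prod_pow {A : Type*} [CommRing A] [Algebra ℝ A] (N : ℕ) (x : Fin d → ℝ)
    (z : Fin d → A) :
    multinomialMean N x (fun k => ∏ i, z i ^ k i)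
      = (algebraMap ℝ A (1 - ∑ i, |x i|) + ∑ i, x i • z i) ^ N := by
  induction N with
  | zero => simp [multinomialMean_zero]
  | succ N ih =>
    rw [multinomialMean_succ, ih, pow_succ', add_mul, Finset.sum_mul, Algebra.smul_def]
    congr 1
    refine Finset.sum_congr rfl fun i _ => ?_
    simp only [prod_pow_add_single]
    rw [smul_mul_assoc, ← ih]
    congr 1
    simp only [multinomialMean, Finset.mul_sum, mul_smul_comm]

/-! ### Points of the simplex and moments of the multinomial distribution -/

theorem simplex_nonneg {x : Fin d → ℝ} (hx : x ∈ simplex d) (i : Fin d) : 0 ≤ x i :=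
  (hx.1 i).1

theorem simplex_le_one {x : Fin d → ℝ} (hx : x ∈ simplex d) (i : Fin d) : x i ≤ 1 :=
  (hx.1 i).2

theorem simplex_sum_abs {x : Fin d → ℝ} (hx : x ∈ simplex d) : ∑ i, |x i| = ∑ i, x i :=
  Finset.sum_congr rfl fun i _ => abs_of_nonneg (simplex_nonneg hx i)

theorem simplex_sum_le {x : Fin d → ℝ} (hx : x ∈ simplex d) : ∑ i, x i ≤ 1 :=
  simplex_sum_abs hx ▸ hx.2

theorem mem_simplex_iff {x : Fin d → ℝ} : x ∈ simplex d ↔ (∀ i, 0 ≤ x i) ∧ ∑ i, x i ≤ 1 := by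
  refine ⟨fun h => ⟨simplex_nonneg h, simplex_sum_le h⟩, fun h => ⟨fun i => ⟨h.1 i, ?_⟩, ?_⟩⟩
  · exact (Finset.single_le_sum (fun j _ => h.1 j) (Finset.mem_univ i)).trans h.2
  · rw [Finset.sum_congr rfl fun i _ => abs_of_nonneg (h.1 i)]
    exact h.2

theorem multinomialProb_nonneg {x : Fin d → ℝ} (hx : x ∈ simplex d) (N : ℕ) (k : Fin d → ℕ) :
    0 ≤ multinomialProb N k x := by
  have h1 : 0 ≤ 1 - ∑ i, |x i| := sub_nonneg.2 hx.2
  have h2 : 0 ≤ ∏ i, x i ^ k i := Finset.prod_nonneg fun i _ => pow_nonneg (simplex_nonneg hx i) _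
  unfold multinomialProb
  positivity

theorem multinomialMean_const {x : Fin d → ℝ} (hx : x ∈ simplex d) (N : ℕ) (c : E) :
    multinomialMean N x (fun _ => c) = c := by
  have h := multinomialMean_prod_pow (A := ℝ) N x (fun _ => 1)
  have h1 : ∑ k ∈ latticePoints d N, multinomialProb N k x = 1 := by
    simpa [multinomialMean, simplex_sum_abs hx] using h
  rw [multinomialMean, ← Finset.sum_smul, h1, one_smul]

theorem multinomialMean_mono {x : Fin d → ℝ} (hx : x ∈ simplex d) (N : ℕ)
    {g h : (Fin d → ℕ) → ℝ} (hgh : ∀ k ∈ latticePoints d N, g k ≤ h k) :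
    multinomialMean N x g ≤ multinomialMean N x h :=
  Finset.sum_le_sum fun k hk => mul_le_mul_of_nonneg_left (hgh k hk) (multinomialProb_nonneg hx N k)

theorem abs_multinomialMean_le {x : Fin d → ℝ} (hx : x ∈ simplex d) (N : ℕ)
    (g : (Fin d → ℕ) → ℝ) :
    |multinomialMean N x g| ≤ multinomialMean N x (fun k => |g k|) := by
  refine (Finset.abs_sum_le_sum_abs _ _).trans_eq (Finset.sum_congr rfl fun k _ => ?_)
  simp [abs_mul, abs_of_nonneg (multinomialProb_nonneg hx N k)]

theorem multinomialMean_coord {x : Fin d → ℝ} (hx : x ∈ simplex d) (N : ℕ) (i : Fin d) :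
    multinomialMean N x (fun k => (k i : ℝ)) = N * x i := by
  cases N with
  | zero => simp [multinomialMean_zero]
  | succ N =>
    have h := multinomialMean_shift N x i (fun _ => (1 : ℝ))
    rw [multinomialMean_const hx] at h
    simpa using h

theorem multinomialMean_coord_mul_coord {x : Fin d → ℝ} (hx : x ∈ simplex d) (N : ℕ)
    (i j : Fin d) :
    multinomialMean N x (fun k => (k i : ℝ) * k j)
      = N * (N - 1) * x i * x j + if i = j then N * x i else 0 := by
  cases N with
  | zero => simp [multinomialMean_zero]
  | succ N =>
    have h := multinomialMean_shift N x i (fun k => (k j : ℝ))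
    have h1 : ∀ k : Fin d → ℕ, (((k + Pi.single i 1 : Fin d → ℕ) j : ℕ) : ℝ)
        = k j + if i = j then 1 else 0 := by
      intro k
      by_cases hij : i = j
      · subst hij; simp
      · simp [hij]
    simp only [smul_eq_mul, h1] at h
    rw [h, multinomialMean_add, multinomialMean_coord hx, multinomialMean_const hx]
    push_cast
    split_ifs <;> ring

theorem multinomialMean_centered_mul {x : Fin d → ℝ} (hx : x ∈ simplex d) (N : ℕ)
    (i j : Fin d) :
    multinomialMean N x (fun k => ((k i : ℝ) - N * x i) * (k j - N * x j))
      = N * ((if i = j then x i else 0) - x i * x j) := by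
  have h : ∀ k : Fin d → ℕ, ((k i : ℝ) - N * x i) * (k j - N * x j)
      = (k i : ℝ) * k j + (-(N * x j) * k i + (-(N * x i) * k j + N * x i * (N * x j))) := by
    intro k; ring
  simp only [h]
  rw [multinomialMean_add, multinomialMean_add, multinomialMean_add, multinomialMean_mul,
    multinomialMean_mul, multinomialMean_const hx, multinomialMean_coord hx,
    multinomialMean_coord hx, multinomialMean_coord_mul_coord hx]
  split_ifs <;> ring

theorem multinomialMean_centered {x : Fin d → ℝ} (hx : x ∈ simplex d) (N : ℕ) (i : Fin d) :
    multinomialMean N x (fun k => (k i : ℝ) - N * x i) = 0 := by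
  rw [multinomialMean_sub, multinomialMean_coord hx, multinomialMean_const hx, sub_self]

/-- Each coordinate of a multinomial vector is binomially distributed. -/
theorem multinomialMean_succ_coord {x : Fin d → ℝ} (hx : x ∈ simplex d) (N : ℕ) (i : Fin d)
    (h : ℝ → ℝ) :
    multinomialMean (N + 1) x (fun k => h (k i))
      = multinomialMean N x (fun k => (1 - x i) * h (k i) + x i * h (k i + 1)) := by
  obtain ⟨F, hF⟩ : ∃ F : Fin d → ℝ, F = fun j => multinomialMean N x
    (fun k => h (((k + Pi.single j 1 : Fin d → ℕ) i : ℕ) : ℝ)) := ⟨_, rfl⟩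
  have hFi : F i = multinomialMean N x (fun k => h (k i + 1)) := by simp [hF]
  have h2 : ∑ j ∈ Finset.univ.erase i, x j * F j
      = (∑ j, x j - x i) * multinomialMean N x (fun k => h (k i)) := by
    rw [← Finset.sum_erase_eq_sub (Finset.mem_univ i), Finset.sum_mul]
    refine Finset.sum_congr rfl fun j hj => ?_
    simp [hF, Pi.single_eq_of_ne (Finset.ne_of_mem_erase hj).symm]
  have h3 : multinomialMean (N + 1) x (fun k => h (k i))
      = (1 - ∑ j, |x j|) * multinomialMean N x (fun k => h (k i)) + ∑ j, x j * F j := by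
    rw [hF]
    exact multinomialMean_succ N x _
  rw [h3, simplex_sum_abs hx, ← Finset.add_sum_erase _ (fun j => x j * F j) (Finset.mem_univ i),
    h2, multinomialMean_add, multinomialMean_mul, multinomialMean_mul, hFi]
  ring

/-- With `v = x i * (1 - x i) ≤ 1/4`, one more trial adds `6 v` times the second central moment `N
v`, a multiple of the first central moment (zero), and `v (1 - 3 v)`. The cubic term has coefficient
zero. The increment is thus at most `3 (2 N + 1)`. -/
theorem multinomialMean_centered_pow_four {x : Fin d → ℝ} (hx : x ∈ simplex d) (N : ℕ)
    (i : Fin d) :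
    multinomialMean N x (fun k => ((k i : ℝ) - N * x i) ^ 4) ≤ 3 * N ^ 2 := by
  induction N with
  | zero => simp [multinomialMean_zero]
  | succ N ih =>
    have h := multinomialMean_succ_coord hx N i (fun t => (t - (N + 1 : ℕ) * x i) ^ 4)
    have e : ∀ k : Fin d → ℕ, (1 - x i) * ((k i : ℝ) - (N + 1 : ℕ) * x i) ^ 4
        + x i * ((k i : ℝ) + 1 - (N + 1 : ℕ) * x i) ^ 4
        = ((k i : ℝ) - N * x i) ^ 4
          + (6 * (x i * (1 - x i)) * (((k i : ℝ) - N * x i) * (k i - N * x i))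
          + (4 * (x i * (1 - x i)) * (1 - 2 * x i) * ((k i : ℝ) - N * x i)
          + x i * (1 - x i) * (1 - 3 * (x i * (1 - x i))))) := by
      intro k; push_cast; ring
    simp only [e] at h
    rw [h, multinomialMean_add, multinomialMean_add, multinomialMean_add, multinomialMean_mul,
      multinomialMean_mul, multinomialMean_centered hx, multinomialMean_centered_mul hx,
      multinomialMean_const hx, if_pos rfl]
    have h0 := simplex_nonneg hx i
    have h1 := simplex_le_one hx i
    set v := x i * (1 - x i) with hv
    have hv0 : 0 ≤ v := mul_nonneg h0 (sub_nonneg.2 h1)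
    have hv1 : v ≤ 1 / 4 := by nlinarith [sq_nonneg (x i - 1 / 2)]
    have e2 : x i - x i * x i = v := by rw [hv]; ring
    rw [e2]
    have hN : (0 : ℝ) ≤ N := N.cast_nonneg
    push_cast
    have : v * v ≤ 1 / 16 := by nlinarith
    nlinarith [mul_le_mul_of_nonneg_left this hN]

/-- The exponential moment for a Markov bound: compared with `2 ^ N` it is exponentially small when
the coordinate sum is below one. -/
theorem multinomialMean_two_pow {x : Fin d → ℝ} (hx : x ∈ simplex d) (N : ℕ) :
    multinomialMean N x (fun k => (2 : ℝ) ^ ∑ i, k i) = (1 + ∑ i, x i) ^ N := by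
  have h := multinomialMean_prod_pow (A := ℝ) N x (fun _ => 2)
  simp only [Finset.prod_pow_eq_pow_sum] at h
  rw [h, simplex_sum_abs hx, ← Finset.sum_smul]
  simp
  ring

end Multinomial

/-! ### Fourier inversion for the multinomial probabilities -/

/-- The characteristic function of the multinomial distribution with one trial. -/
noncomputable def charFn {d : ℕ} (y θ : Fin d → ℝ) : ℂ :=
  ((1 - ∑ i, |y i| : ℝ) : ℂ) + ∑ i, (y i : ℂ) * Complex.exp (θ i * Complex.I)

/-- The box `∏ (-π c_j, π c_j]`. -/
def fourierBox {d : ℕ} (c : Fin d → ℝ) : Set (Fin d → ℝ) :=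
  Set.univ.pi fun j => Set.Ioc (-(Real.pi * c j)) (Real.pi * c j)

section Fourier

variable {d : ℕ}

theorem measurableSet_fourierBox (c : Fin d → ℝ) : MeasurableSet (fourierBox c) :=
  MeasurableSet.univ_pi fun _ => measurableSet_Ioc

theorem volume_fourierBox_lt_top (c : Fin d → ℝ) : volume (fourierBox c) < ⊤ := by
  rw [fourierBox, Real.volume_pi_Ioc]
  exact ENNReal.prod_lt_top fun _ _ => ENNReal.ofReal_lt_top

theorem continuous_charFn (y c : Fin d → ℝ) :
    Continuous fun t : Fin d → ℝ => charFn y (fun j => t j / c j) := by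
  unfold charFn
  fun_prop

theorem continuous_integrableOn_fourierBox {E : Type*} [NormedAddCommGroup E] (c : Fin d → ℝ)
    {g : (Fin d → ℝ) → E} (hg : Continuous g) : IntegrableOn g (fourierBox c) := by
  have h : IsCompact (Set.univ.pi fun j => Set.Icc (-(Real.pi * c j)) (Real.pi * c j)) :=
    isCompact_univ_pi fun _ => isCompact_Icc
  exact (hg.continuousOn.integrableOn_compact h).mono_set
    (Set.pi_mono fun _ _ => Set.Ioc_subset_Icc_self)

theorem charFn_pow (N : ℕ) (y θ : Fin d → ℝ) :
    charFn y θ ^ N = ∑ k ∈ latticePoints d N,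
      (multinomialProb N k y : ℂ) * ∏ j, Complex.exp (θ j * Complex.I) ^ k j := by
  have h := multinomialMean_prod_pow (A := ℂ) N y (fun j => Complex.exp (θ j * Complex.I))
  simpa [multinomialMean, charFn] using h.symm

theorem integral_exp_int_mul {c : ℝ} (hc : 0 < c) (n : ℤ) :
    ∫ t in Set.Ioc (-(Real.pi * c)) (Real.pi * c),
      Complex.exp ((n : ℂ) * ((t / c : ℝ) * Complex.I))
      = if n = 0 then ((2 * Real.pi * c : ℝ) : ℂ) else 0 := by
  have hle : -(Real.pi * c) ≤ Real.pi * c := by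
    have : 0 < Real.pi * c := by positivity
    linarith
  rw [← intervalIntegral.integral_of_le hle]
  split_ifs with h
  · subst h
    simp
    ring
  · have hc' : (c : ℂ) ≠ 0 := by exact_mod_cast hc.ne'
    have hn : (n : ℂ) ≠ 0 := by exact_mod_cast h
    have h1 : ((n : ℂ) * Complex.I / c) ≠ 0 := by simp [h, hc.ne']
    have e : ∀ t : ℝ, Complex.exp ((n : ℂ) * ((t / c : ℝ) * Complex.I))
        = Complex.exp (((n : ℂ) * Complex.I / c) * t) := by
      intro t; congr 1; push_cast; ring
    simp only [e]
    rw [integral_exp_mul_complex h1]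
    have e1 : (n : ℂ) * Complex.I / c * ((Real.pi * c : ℝ) : ℂ)
        = (n : ℂ) * Complex.I / c * ((-(Real.pi * c) : ℝ) : ℂ)
          + n * (2 * Real.pi * Complex.I) := by
      push_cast; field_simp; ring
    rw [e1, Complex.exp_periodic.int_mul n, sub_self, zero_div]

theorem integral_fourierBox_character {c : Fin d → ℝ} (hc : ∀ j, 0 < c j) (k l : Fin d → ℕ) :
    ∫ t in fourierBox c, ∏ j, Complex.exp (((t j / c j : ℝ) : ℂ) * Complex.I) ^ l j
        * (starRingEnd ℂ) (Complex.exp (((t j / c j : ℝ) : ℂ) * Complex.I) ^ k j)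
      = if l = k then ((∏ j, (2 * Real.pi * c j) : ℝ) : ℂ) else 0 := by
  have e : ∀ (j : Fin d) (s : ℝ), Complex.exp (((s / c j : ℝ) : ℂ) * Complex.I) ^ l j
        * (starRingEnd ℂ) (Complex.exp (((s / c j : ℝ) : ℂ) * Complex.I) ^ k j)
      = Complex.exp ((((l j : ℤ) - k j : ℤ) : ℂ) * ((s / c j : ℝ) * Complex.I)) := by
    intro j s
    rw [map_pow, ← Complex.exp_conj, ← Complex.exp_nat_mul, ← Complex.exp_nat_mul,
      ← Complex.exp_add]
    congr 1
    rw [map_mul, Complex.conj_ofReal, Complex.conj_I]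
    push_cast
    ring
  simp only [e]
  rw [fourierBox, volume_pi, Measure.restrict_pi_pi,
    integral_fintype_prod_eq_prod (fun j (s : ℝ) =>
      Complex.exp ((((l j : ℤ) - k j : ℤ) : ℂ) * ((s / c j : ℝ) * Complex.I)))]
  rw [Finset.prod_congr rfl fun j _ => integral_exp_int_mul (hc j) _]
  split_ifs with h
  · subst h
    simp
  · obtain ⟨j, hj⟩ := Function.ne_iff.1 h
    refine Finset.prod_eq_zero (Finset.mem_univ j) (if_neg ?_)
    omega

/-- Fourier inversion. -/
theorem integral_charFn_pow_mul {c : Fin d → ℝ} (hc : ∀ j, 0 < c j) {N : ℕ} (y : Fin d → ℝ)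
    {k : Fin d → ℕ} (hk : k ∈ latticePoints d N) :
    ∫ t in fourierBox c, charFn y (fun j => t j / c j) ^ N
        * (starRingEnd ℂ) (∏ j, Complex.exp (((t j / c j : ℝ) : ℂ) * Complex.I) ^ k j)
      = (((∏ j, (2 * Real.pi * c j)) * multinomialProb N k y : ℝ) : ℂ) := by
  simp only [charFn_pow, Finset.sum_mul, map_prod, mul_assoc, ← Finset.prod_mul_distrib]
  rw [integral_finsetSum]
  · simp only [integral_const_mul, integral_fourierBox_character hc]
    simp only [mul_ite, mul_zero, Finset.sum_ite_eq', hk, if_true]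
    push_cast
    ring_nf
  · intro l _
    refine continuous_integrableOn_fourierBox c ?_
    simp only [map_pow, ← Complex.exp_conj]
    fun_prop

/-- Parseval's identity. -/
theorem integral_norm_charFn_pow {c : Fin d → ℝ} (hc : ∀ j, 0 < c j) (N : ℕ) (y : Fin d → ℝ) :
    ∫ t in fourierBox c, (‖charFn y (fun j => t j / c j)‖ ^ 2) ^ N
      = (∏ j, (2 * Real.pi * c j)) * ∑ k ∈ latticePoints d N, multinomialProb N k y ^ 2 := by
  have e : ∀ t : Fin d → ℝ, (((‖charFn y (fun j => t j / c j)‖ ^ 2) ^ N : ℝ) : ℂ)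
      = ∑ k ∈ latticePoints d N, (multinomialProb N k y : ℂ)
        * (charFn y (fun j => t j / c j) ^ N
        * (starRingEnd ℂ) (∏ j, Complex.exp (((t j / c j : ℝ) : ℂ) * Complex.I) ^ k j)) := by
    intro t
    have h1 : (starRingEnd ℂ) (charFn y (fun j => t j / c j) ^ N)
        = ∑ k ∈ latticePoints d N, (multinomialProb N k y : ℂ)
          * (starRingEnd ℂ) (∏ j, Complex.exp (((t j / c j : ℝ) : ℂ) * Complex.I) ^ k j) := by
      rw [charFn_pow, map_sum]
      simp only [map_mul, Complex.conj_ofReal]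
    rw [Complex.ofReal_pow, Complex.ofReal_pow, ← Complex.mul_conj', mul_pow, ← map_pow, h1,
      Finset.mul_sum]
    refine Finset.sum_congr rfl fun k _ => ?_
    ring
  rw [← Complex.ofReal_inj, ← integral_complex_ofReal]
  simp only [e]
  rw [integral_finsetSum]
  · simp only [integral_const_mul]
    rw [Finset.sum_congr rfl fun k hk => by rw [integral_charFn_pow_mul hc y hk]]
    push_cast
    rw [Finset.mul_sum]
    refine Finset.sum_congr rfl fun k _ => ?_
    ring
  · intro k _
    refine continuous_integrableOn_fourierBox c ?_
    have := continuous_charFn y c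
    simp only [map_prod, map_pow, ← Complex.exp_conj]
    fun_prop

/-- Fourier inversion bounds every single probability by the `L¹` norm of the characteristic
function, uniformly in `k`. -/
theorem prod_mul_multinomialProb_le {c : Fin d → ℝ} (hc : ∀ j, 0 < c j) {N : ℕ} (y : Fin d → ℝ)
    {k : Fin d → ℕ} (hk : k ∈ latticePoints d N) :
    (∏ j, (2 * Real.pi * c j)) * multinomialProb N k y
      ≤ ∫ t in fourierBox c, ‖charFn y (fun j => t j / c j)‖ ^ N := by
  have h := integral_charFn_pow_mul hc y hk
  have h2 := norm_integral_le_integral_norm (μ := volume.restrict (fourierBox c))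
    (fun t : Fin d → ℝ => charFn y (fun j => t j / c j) ^ N
        * (starRingEnd ℂ) (∏ j, Complex.exp (((t j / c j : ℝ) : ℂ) * Complex.I) ^ k j))
  rw [h, Complex.norm_real] at h2
  refine (le_abs_self _).trans (h2.trans_eq ?_)
  refine integral_congr_ae (ae_of_all _ fun t => ?_)
  simp only [norm_mul, norm_pow, RCLike.norm_conj, norm_prod, Complex.norm_exp_ofReal_mul_I]
  simp

/-- Symmetrisation: the squared modulus is the characteristic function of the difference of two
independent trials. Writing the deficit from `1` through `1 - cos` makes each term nonnegative;
pairs involving the unlisted category give the factor `2 (1 - ∑ y i)`. -/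
theorem norm_charFn_sq {y : Fin d → ℝ} (hy : y ∈ simplex d) (θ : Fin d → ℝ) :
    ‖charFn y θ‖ ^ 2 = 1 - (2 * (1 - ∑ i, y i) * ∑ i, y i * (1 - Real.cos (θ i))
      + ∑ i, ∑ j, y i * y j * (1 - Real.cos (θ i - θ j))) := by
  have hre : (charFn y θ).re = (1 - ∑ i, y i) + ∑ i, y i * Real.cos (θ i) := by
    simp [charFn, simplex_sum_abs hy, Complex.exp_ofReal_mul_I_re]
  have him : (charFn y θ).im = ∑ i, y i * Real.sin (θ i) := by
    simp [charFn, Complex.exp_ofReal_mul_I_im]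
  have h1 : ∑ i, ∑ j, y i * y j * (1 - Real.cos (θ i - θ j))
      = (∑ i, y i) * (∑ i, y i)
        - ((∑ i, y i * Real.cos (θ i)) * (∑ i, y i * Real.cos (θ i))
          + (∑ i, y i * Real.sin (θ i)) * (∑ i, y i * Real.sin (θ i))) := by
    simp only [Finset.sum_mul_sum, ← Finset.sum_add_distrib, ← Finset.sum_sub_distrib]
    refine Finset.sum_congr rfl fun i _ => Finset.sum_congr rfl fun j _ => ?_
    rw [Real.cos_sub]
    ring
  have h2 : ∑ i, y i * (1 - Real.cos (θ i)) = ∑ i, y i - ∑ i, y i * Real.cos (θ i) := by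
    simp only [mul_sub, mul_one, Finset.sum_sub_distrib]
  rw [← Complex.normSq_eq_norm_sq, Complex.normSq_apply, hre, him, h1, h2]
  ring

theorem norm_charFn_sq_le {y : Fin d → ℝ} (hy : y ∈ simplex d) (θ : Fin d → ℝ) :
    ‖charFn y θ‖ ^ 2 ≤ 1 - 2 * (1 - ∑ i, y i) * ∑ i, y i * (1 - Real.cos (θ i)) := by
  rw [norm_charFn_sq hy]
  have : 0 ≤ ∑ i, ∑ j, y i * y j * (1 - Real.cos (θ i - θ j)) :=
    Finset.sum_nonneg fun i _ => Finset.sum_nonneg fun j _ =>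
      mul_nonneg (mul_nonneg (simplex_nonneg hy i) (simplex_nonneg hy j))
        (sub_nonneg.2 (Real.cos_le_one _))
  linarith

theorem norm_charFn_sq_le_one {y : Fin d → ℝ} (hy : y ∈ simplex d) (θ : Fin d → ℝ) :
    ‖charFn y θ‖ ^ 2 ≤ 1 := by
  refine (norm_charFn_sq_le hy θ).trans (sub_le_self _ ?_)
  exact mul_nonneg (mul_nonneg zero_le_two (sub_nonneg.2 (simplex_sum_le hy)))
    (Finset.sum_nonneg fun i _ => mul_nonneg (simplex_nonneg hy i)
      (sub_nonneg.2 (Real.cos_le_one _)))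

end Fourier

/-! ### The Bessel function as an integral -/

theorem integral_cos_pow_even (n : ℕ) :
    ∫ θ in (-Real.pi)..Real.pi, Real.cos θ ^ (2 * n)
      = 2 * Real.pi * ((2 * n).factorial / (4 ^ n * (n.factorial : ℝ) ^ 2)) := by
  induction n with
  | zero => simp; ring
  | succ n ih =>
    rw [mul_add, mul_one, integral_cos_pow, ih, Nat.factorial_succ, Nat.factorial_succ,
      Nat.factorial_succ]
    push_cast
    simp only [Real.sin_pi, Real.sin_neg, neg_zero, mul_zero, sub_zero, zero_div, zero_add]
    have h : (n.factorial : ℝ) ≠ 0 := by positivity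
    field_simp
    ring

theorem integral_cos_pow_odd (n : ℕ) :
    ∫ θ in (-Real.pi)..Real.pi, Real.cos θ ^ (2 * n + 1) = 0 := by
  induction n with
  | zero => simp
  | succ n ih =>
    rw [show 2 * (n + 1) + 1 = (2 * n + 1) + 2 by ring, integral_cos_pow, ih]
    simp

theorem hasSum_integral_exp_mul_cos (z : ℝ) :
    HasSum (fun n : ℕ => ∫ θ in (-Real.pi)..Real.pi, (z * Real.cos θ) ^ n / n.factorial)
      (∫ θ in (-Real.pi)..Real.pi, Real.exp (z * Real.cos θ)) := by
  have hπ : (-Real.pi) ≤ Real.pi := by linarith [Real.pi_pos]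
  refine intervalIntegral.hasSum_integral_of_dominated_convergence
    (fun n _ => |z| ^ n / n.factorial) (fun n => ?_) (fun n => ae_of_all _ fun θ _ => ?_)
    (ae_of_all _ fun θ _ => Real.summable_pow_div_factorial _) (by simp)
    (ae_of_all _ fun θ _ => ?_)
  · exact Continuous.aestronglyMeasurable (by fun_prop)
  · rw [norm_div, norm_pow, norm_mul]
    simp only [Real.norm_eq_abs, Nat.abs_cast]
    gcongr
    exact mul_le_of_le_one_right (abs_nonneg _) (Real.abs_cos_le_one θ)
  · rw [Real.exp_eq_exp_ℝ]
    exact NormedSpace.expSeries_div_hasSum_exp (z * Real.cos θ)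

/-- In the exponential series the odd powers of the cosine integrate to zero and the even ones
reproduce the coefficients of `I_0`. -/
theorem integral_exp_mul_cos (z : ℝ) :
    ∫ θ in (-Real.pi)..Real.pi, Real.exp (z * Real.cos θ) = 2 * Real.pi * besselI 0 z := by
  have h := hasSum_integral_exp_mul_cos z
  have h2 : HasSum (fun n : ℕ =>
      ∫ θ in (-Real.pi)..Real.pi, (z * Real.cos θ) ^ (2 * n) / (2 * n).factorial)
      (∫ θ in (-Real.pi)..Real.pi, Real.exp (z * Real.cos θ)) := by
    have hinj : Function.Injective fun n : ℕ => 2 * n := fun a b hab => by simpa using hab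
    refine (hinj.hasSum_iff (fun n hn => ?_)).2 h
    obtain ⟨k, rfl | rfl⟩ := n.even_or_odd'
    · exact (hn ⟨k, rfl⟩).elim
    · simp only [mul_pow, intervalIntegral.integral_div, intervalIntegral.integral_const_mul,
        integral_cos_pow_odd, mul_zero, zero_div]
  rw [← h2.tsum_eq, besselI, ← tsum_mul_left]
  refine tsum_congr fun n => ?_
  simp only [mul_pow, intervalIntegral.integral_div, intervalIntegral.integral_const_mul,
        integral_cos_pow_even]
  have h3 : ((2 * n).factorial : ℝ) ≠ 0 := by positivity
  have h4 : (n.factorial : ℝ) ≠ 0 := by positivity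
  simp only [add_zero, div_pow]
  have h5 : (2 : ℝ) ^ (2 * n) = 4 ^ n := by rw [pow_mul]; norm_num
  rw [h5]
  field_simp

/-- Source of the factors for `i ∈ J`: a coordinate with mean of order one is Poisson in the limit,
and `e^{-2λ} I_0(2λ)` is the sum of the squared Poisson probabilities, here in Fourier form. -/
theorem integral_exp_one_sub_cos (l : ℝ) :
    ∫ θ in Set.Ioc (-Real.pi) Real.pi, Real.exp (-(2 * l * (1 - Real.cos θ)))
      = 2 * Real.pi * (Real.exp (-2 * l) * besselI 0 (2 * l)) := by
  rw [← intervalIntegral.integral_of_le (by linarith [Real.pi_pos])]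
  have e : ∀ θ : ℝ, Real.exp (-(2 * l * (1 - Real.cos θ)))
      = Real.exp (-2 * l) * Real.exp (2 * l * Real.cos θ) := by
    intro θ; rw [← Real.exp_add]; congr 1; ring
  simp only [e, intervalIntegral.integral_const_mul, integral_exp_mul_cos]
  ring

theorem besselI_zero_pos (z : ℝ) : 0 < besselI 0 z := by
  have h : 0 < ∫ θ in (-Real.pi)..Real.pi, Real.exp (z * Real.cos θ) :=
    intervalIntegral.intervalIntegral_pos_of_pos
      (Continuous.intervalIntegrable (by fun_prop) _ _) (fun _ => Real.exp_pos _)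
      (by linarith [Real.pi_pos])
  rw [integral_exp_mul_cos] at h
  exact pos_of_mul_pos_right h (by positivity)

/-! ### The sum of the squared multinomial probabilities -/

section SquaredProb

variable {d : ℕ} {J : Finset (Fin d)} {lam x : Fin d → ℝ}

theorem sum_ite_mem_compl (J : Finset (Fin d)) (A B : Fin d → ℝ) :
    ∑ i, (if i ∈ J then A i else B i) = ∑ i ∈ J, A i + ∑ i ∈ Jᶜ, B i := by
  rw [← Finset.sum_add_sum_compl J]
  congr 1
  · exact Finset.sum_congr rfl fun i hi => if_pos hi
  · exact Finset.sum_congr rfl fun i hi => if_neg (Finset.mem_compl.1 hi)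

theorem prod_ite_mem_compl (J : Finset (Fin d)) (A B : Fin d → ℝ) :
    ∏ i, (if i ∈ J then A i else B i) = (∏ i ∈ J, A i) * ∏ i ∈ Jᶜ, B i := by
  rw [← Finset.prod_mul_prod_compl J]
  congr 1
  · exact Finset.prod_congr rfl fun i hi => if_pos hi
  · exact Finset.prod_congr rfl fun i hi => if_neg (Finset.mem_compl.1 hi)

theorem sum_nearPoint (J : Finset (Fin d)) (lam x : Fin d → ℝ) (m : ℕ) :
    ∑ i, nearPoint J lam x m i = (∑ i ∈ J, lam i) / m + ∑ i ∈ Jᶜ, x i := by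
  simp only [nearPoint]
  rw [sum_ite_mem_compl, Finset.sum_div]

theorem nearPoint_mem_simplex (hlam : ∀ i ∈ J, 0 ≤ lam i) (hx : x ∈ admissible J) {m : ℕ}
    (h : (∑ i ∈ J, lam i) / m + ∑ i ∈ Jᶜ, x i ≤ 1) : nearPoint J lam x m ∈ simplex d := by
  refine mem_simplex_iff.2 ⟨fun i => ?_, (sum_nearPoint J lam x m).trans_le h⟩
  unfold nearPoint
  split_ifs with hi
  · exact div_nonneg (hlam i hi) m.cast_nonneg
  · exact (hx.1 i hi).1.le

theorem facePoint_mem_simplex (hx : x ∈ admissible J) : facePoint J x ∈ simplex d := by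
  refine mem_simplex_iff.2 ⟨fun i => ?_, ?_⟩
  · unfold facePoint
    split_ifs with hi
    · exact le_rfl
    · exact (hx.1 i hi).1.le
  · simp only [facePoint]
    rw [sum_ite_mem_compl]
    simpa using hx.2.le

theorem eventually_sum_nearPoint_le (J : Finset (Fin d)) (lam : Fin d → ℝ) {δ : ℝ} (hδ : 0 < δ) :
    ∀ᶠ m : ℕ in atTop, (∑ i ∈ J, lam i) / m ≤ δ :=
  (tendsto_const_div_atTop_nhds_zero_nat _).eventually_le_const hδ

/-- Pair terms are dropped, `1 - cos θ ≥ 2θ²/π²` holds on `[-π, π]`, and `1 - s ≤ e^{-s}`. The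
directions of `J` are discarded too: their frequencies stay in a bounded interval and need no decay.
-/
theorem norm_charFn_sq_le_exp {y : Fin d → ℝ} (hy : y ∈ simplex d) (J : Finset (Fin d))
    {θ : Fin d → ℝ} (hθ : ∀ j, |θ j| ≤ Real.pi) :
    ‖charFn y θ‖ ^ 2
      ≤ Real.exp (-(4 / Real.pi ^ 2 * (1 - ∑ i, y i) * ∑ i ∈ Jᶜ, y i * θ i ^ 2)) := by
  refine (norm_charFn_sq_le hy θ).trans ?_
  refine le_trans ?_ (Real.add_one_le_exp _)
  have h1 : ∑ i ∈ Jᶜ, y i * (2 / Real.pi ^ 2 * θ i ^ 2) ≤ ∑ i, y i * (1 - Real.cos (θ i)) := by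
    refine le_trans (Finset.sum_le_sum fun i _ => mul_le_mul_of_nonneg_left ?_
      (simplex_nonneg hy i)) (Finset.sum_le_univ_sum_of_nonneg fun i => mul_nonneg
        (simplex_nonneg hy i) (sub_nonneg.2 (Real.cos_le_one _)))
    linarith [Real.cos_le_one_sub_mul_cos_sq (hθ i)]
  have h2 : ∑ i ∈ Jᶜ, y i * (2 / Real.pi ^ 2 * θ i ^ 2)
      = 2 / Real.pi ^ 2 * ∑ i ∈ Jᶜ, y i * θ i ^ 2 := by
    rw [Finset.mul_sum]
    exact Finset.sum_congr rfl fun i _ => by ring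
  rw [h2] at h1
  have h3 := mul_le_mul_of_nonneg_left h1
    (mul_nonneg zero_le_two (sub_nonneg.2 (simplex_sum_le hy)))
  have h4 : 2 * (1 - ∑ i, y i) * (2 / Real.pi ^ 2 * ∑ i ∈ Jᶜ, y i * θ i ^ 2)
      = 4 / Real.pi ^ 2 * (1 - ∑ i, y i) * ∑ i ∈ Jᶜ, y i * θ i ^ 2 := by ring
  linarith

/-- The frequency scale: `√m` in the directions outside `J`, and `1` in the directions of `J`. -/
noncomputable def freqScale (J : Finset (Fin d)) (m : ℕ) (j : Fin d) : ℝ :=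
  if j ∈ J then 1 else √m

theorem freqScale_pos (J : Finset (Fin d)) {m : ℕ} (hm : 1 ≤ m) (j : Fin d) :
    0 < freqScale J m j := by
  have : (0 : ℝ) < m := by exact_mod_cast hm
  unfold freqScale
  split_ifs <;> positivity

theorem prod_freqScale (J : Finset (Fin d)) (m : ℕ) :
    ∏ j, (2 * Real.pi * freqScale J m j) = (2 * Real.pi) ^ d * √m ^ (Jᶜ.card) := by
  rw [Finset.prod_mul_distrib]
  congr 1
  · simp
  · simp only [freqScale]
    rw [prod_ite_mem_compl]
    simp

/-- An integrable majorant of the rescaled characteristic functions. -/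
noncomputable def fourierMajorant (J : Finset (Fin d)) (x : Fin d → ℝ) (κ : ℝ) (j : Fin d)
    (s : ℝ) : ℝ :=
  if j ∈ J then (Set.Ioc (-Real.pi) Real.pi).indicator (fun _ => 1) s
    else Real.exp (-(κ * x j) * s ^ 2)

theorem fourierMajorant_nonneg (J : Finset (Fin d)) (x : Fin d → ℝ) (κ : ℝ) (j : Fin d) (s : ℝ) :
    0 ≤ fourierMajorant J x κ j s := by
  unfold fourierMajorant
  split_ifs
  · exact Set.indicator_nonneg (fun _ _ => zero_le_one) s
  · positivity

theorem integrable_fourierMajorant (hx : x ∈ admissible J) {κ : ℝ} (hκ : 0 < κ) :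
    Integrable (fun t : Fin d → ℝ => ∏ j, fourierMajorant J x κ j (t j)) := by
  refine Integrable.fintype_prod fun j => ?_
  unfold fourierMajorant
  split_ifs with hj
  · exact (integrable_indicator_iff measurableSet_Ioc).2 (by simp)
  · exact integrable_exp_neg_mul_sq (mul_pos hκ (hx.1 j hj).1)

theorem abs_div_freqScale_le {m : ℕ} (hm : 1 ≤ m) {t : Fin d → ℝ}
    (ht : t ∈ fourierBox (freqScale J m)) (j : Fin d) : |t j / freqScale J m j| ≤ Real.pi := by
  have hc := freqScale_pos J hm j
  have := ht j (Set.mem_univ j)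
  rw [abs_div, abs_of_pos hc, div_le_iff₀ hc, abs_le]
  exact ⟨this.1.le, this.2⟩

/-- The scale `√m` turns `N y θ²` into `x t² N/m`. The decay rate `(1 - ∑ x i) / (2π²)` loses one
factor two in `1 - ∑ y i ≥ (1 - ∑ x i)/2` and another in `N/(N + 1) ≥ 1/2`. The bound is for the
power `N`, not `2N`, so that it serves both the maximal probability and the sum of squares. -/
theorem norm_charFn_pow_le_majorant (hx : x ∈ admissible J) {N : ℕ} (hN : 1 ≤ N)
    (hy : nearPoint J lam x (N + 1) ∈ simplex d)
    (hy' : (1 - ∑ i ∈ Jᶜ, x i) / 2 ≤ 1 - ∑ i, nearPoint J lam x (N + 1) i)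
    {t : Fin d → ℝ} (ht : t ∈ fourierBox (freqScale J (N + 1))) :
    ‖charFn (nearPoint J lam x (N + 1)) (fun j => t j / freqScale J (N + 1) j)‖ ^ N
      ≤ ∏ j, fourierMajorant J x ((1 - ∑ i ∈ Jᶜ, x i) / (2 * Real.pi ^ 2)) j (t j) := by
  set y := nearPoint J lam x (N + 1) with hyd
  set x0 := 1 - ∑ i ∈ Jᶜ, x i with hx0
  have hx0p : 0 < x0 := sub_pos.2 hx.2
  have hm : (0 : ℝ) < ((N + 1 : ℕ) : ℝ) := by positivity
  have h := norm_charFn_sq_le_exp hy J (abs_div_freqScale_le (by omega) ht)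
  have e : ∑ i ∈ Jᶜ, y i * (t i / freqScale J (N + 1) i) ^ 2
      = (∑ i ∈ Jᶜ, x i * t i ^ 2) / ((N + 1 : ℕ) : ℝ) := by
    rw [Finset.sum_div]
    refine Finset.sum_congr rfl fun i hi => ?_
    have hi' := Finset.mem_compl.1 hi
    simp only [hyd, nearPoint, freqScale, if_neg hi', div_pow]
    rw [Real.sq_sqrt hm.le]
    ring
  rw [e] at h
  set S := ∑ i ∈ Jᶜ, x i * t i ^ 2 with hS
  have hS0 : 0 ≤ S := Finset.sum_nonneg fun i hi =>
    mul_nonneg (hx.1 i (Finset.mem_compl.1 hi)).1.le (sq_nonneg _)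
  have h1 : ‖charFn y (fun j => t j / freqScale J (N + 1) j)‖
      ≤ Real.exp (-(x0 / Real.pi ^ 2 * (S / ((N + 1 : ℕ) : ℝ)))) := by
    refine abs_le_of_sq_le_sq' ?_ (Real.exp_pos _).le |>.2
    refine h.trans ?_
    rw [← Real.exp_nat_mul, Real.exp_le_exp]
    have h2 : 0 ≤ S / ((N + 1 : ℕ) : ℝ) := by positivity
    have h3 : 4 / Real.pi ^ 2 * (x0 / 2) * (S / ((N + 1 : ℕ) : ℝ))
        ≤ 4 / Real.pi ^ 2 * (1 - ∑ i, y i) * (S / ((N + 1 : ℕ) : ℝ)) := by gcongr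
    have h4 : 4 / Real.pi ^ 2 * (x0 / 2) * (S / ((N + 1 : ℕ) : ℝ))
      = 2 * (x0 / Real.pi ^ 2 * (S / ((N + 1 : ℕ) : ℝ))) := by ring
    push_cast at h3 h4 ⊢
    linarith
  have hprod : Real.exp (-(x0 / (2 * Real.pi ^ 2) * S))
      ≤ ∏ j, fourierMajorant J x (x0 / (2 * Real.pi ^ 2)) j (t j) := by
    refine le_of_eq ?_
    unfold fourierMajorant
    rw [prod_ite_mem_compl, Finset.prod_eq_one, one_mul, ← Real.exp_sum]
    · congr 1
      rw [hS, Finset.mul_sum, ← Finset.sum_neg_distrib]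
      exact Finset.sum_congr rfl fun i _ => by ring
    · intro i hi
      have := ht i (Set.mem_univ i)
      simp only [freqScale, if_pos hi, mul_one] at this
      rw [Set.indicator_of_mem this]
  refine le_trans (pow_le_pow_left₀ (norm_nonneg _) h1 N) (le_trans ?_ hprod)
  rw [← Real.exp_nat_mul, Real.exp_le_exp]
  have h5 : (1 : ℝ) / 2 ≤ N / ((N + 1 : ℕ) : ℝ) := by
    rw [div_le_div_iff₀ two_pos hm]
    have : (1 : ℝ) ≤ N := by exact_mod_cast hN
    push_cast
    linarith
  have h6 : x0 / Real.pi ^ 2 * S * (1 / 2) ≤ x0 / Real.pi ^ 2 * S * (N / ((N + 1 : ℕ) : ℝ)) :=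
    mul_le_mul_of_nonneg_left h5 (by positivity)
  have h7 : x0 / (2 * Real.pi ^ 2) * S = x0 / Real.pi ^ 2 * S * (1 / 2) := by
    field_simp
  have h8 : (N : ℝ) * -(x0 / Real.pi ^ 2 * (S / ((N + 1 : ℕ) : ℝ)))
      = -(x0 / Real.pi ^ 2 * S * (N / ((N + 1 : ℕ) : ℝ))) := by ring
  rw [h7, h8]
  linarith

theorem eventually_nearPoint (hlam : ∀ i ∈ J, 0 ≤ lam i) (hx : x ∈ admissible J) :
    ∀ᶠ N : ℕ in atTop, 1 ≤ N ∧ nearPoint J lam x (N + 1) ∈ simplex d ∧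
      (1 - ∑ i ∈ Jᶜ, x i) / 2 ≤ 1 - ∑ i, nearPoint J lam x (N + 1) i := by
  have hx0p : 0 < (1 - ∑ i ∈ Jᶜ, x i) / 2 := half_pos (sub_pos.2 hx.2)
  filter_upwards [(tendsto_add_atTop_nat 1).eventually (eventually_sum_nearPoint_le J lam hx0p),
    eventually_ge_atTop 1] with N h h1
  refine ⟨h1, nearPoint_mem_simplex hlam hx (by linarith [hx.2]), ?_⟩
  rw [sum_nearPoint]
  linarith

/-- The multinomial probabilities are `O(m^{-(d-|J|)/2})` near a point of the face `x_J = 0`. -/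
theorem exists_multinomialProb_le (hlam : ∀ i ∈ J, 0 ≤ lam i) (hx : x ∈ admissible J) :
    ∃ K : ℝ, 0 ≤ K ∧ ∀ᶠ N : ℕ in atTop, ∀ k ∈ latticePoints d N,
      √((N + 1 : ℕ) : ℝ) ^ Jᶜ.card * multinomialProb N k (nearPoint J lam x (N + 1)) ≤ K := by
  set κ := (1 - ∑ i ∈ Jᶜ, x i) / (2 * Real.pi ^ 2) with hκ
  have hκp : 0 < κ := div_pos (sub_pos.2 hx.2) (by positivity)
  have hint := integrable_fourierMajorant hx hκp
  have hnn : ∀ t : Fin d → ℝ, 0 ≤ ∏ j, fourierMajorant J x κ j (t j) := fun t =>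
    Finset.prod_nonneg fun j _ => fourierMajorant_nonneg J x κ j _
  refine ⟨(∫ t : Fin d → ℝ, ∏ j, fourierMajorant J x κ j (t j)) / (2 * Real.pi) ^ d,
    div_nonneg (integral_nonneg hnn) (by positivity), ?_⟩
  filter_upwards [eventually_nearPoint hlam hx] with N hN k hk
  obtain ⟨hN1, hy, hy'⟩ := hN
  rw [le_div_iff₀ (by positivity)]
  have h := prod_mul_multinomialProb_le (freqScale_pos J (m := N + 1) (by omega))
    (nearPoint J lam x (N + 1)) hk
  rw [prod_freqScale] at h
  have hcont := continuous_charFn (nearPoint J lam x (N + 1)) (freqScale J (N + 1))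
  calc _ = (2 * Real.pi) ^ d * √((N + 1 : ℕ) : ℝ) ^ Jᶜ.card
        * multinomialProb N k (nearPoint J lam x (N + 1)) := by ring
    _ ≤ _ := h
    _ ≤ ∫ t in fourierBox (freqScale J (N + 1)), ∏ j, fourierMajorant J x κ j (t j) :=
        setIntegral_mono_on
          (continuous_integrableOn_fourierBox _ (hcont.norm.pow N)) hint.integrableOn
          (measurableSet_fourierBox _) fun t ht => norm_charFn_pow_le_majorant hx hN1 hy hy' ht
    _ ≤ _ := setIntegral_le_integral hint (ae_of_all _ hnn)

end SquaredProb

/-! ### Limit of the Parseval integral and its evaluation -/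

section Limit

variable {d : ℕ} {J : Finset (Fin d)} {lam x : Fin d → ℝ}

/-- The factors of the limiting integrand, after the Gaussian part has been linearised with the
auxiliary variable `u`. -/
noncomputable def limitFactor (J : Finset (Fin d)) (lam x : Fin d → ℝ) (u : ℝ) (j : Fin d)
    (s : ℝ) : ℝ :=
  if j ∈ J then
    (Set.Ioc (-Real.pi) Real.pi).indicator (fun s => Real.exp (-(2 * lam j * (1 - Real.cos s)))) s
  else Real.exp (-x j * (s - u) ^ 2)

/-- The pointwise limit of the rescaled squared characteristic functions. -/
noncomputable def limitIntegrand (J : Finset (Fin d)) (lam x t : Fin d → ℝ) : ℝ :=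
  (∏ j ∈ J, (Set.Ioc (-Real.pi) Real.pi).indicator
    (fun s => Real.exp (-(2 * lam j * (1 - Real.cos s)))) (t j))
    * Real.exp (-(∑ j ∈ Jᶜ, x j * t j ^ 2 - (∑ j ∈ Jᶜ, x j * t j) ^ 2))

/-- Completing the square in `u`: because the coefficients `1 - ∑ x j` and `x j` add up to one, the
exponent equals minus the quadratic form minus `(u - ∑ x j t j)²`. The rank-one square is thus
traded for an integral of functions that factor over the coordinates. -/
theorem integral_limitFactor_gaussian (J : Finset (Fin d)) (lam x t : Fin d → ℝ) :
    ∫ u : ℝ, Real.exp (-(1 - ∑ j ∈ Jᶜ, x j) * u ^ 2) * ∏ j, limitFactor J lam x u j (t j)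
      = √Real.pi * limitIntegrand J lam x t := by
  have e : ∀ u : ℝ, Real.exp (-(1 - ∑ j ∈ Jᶜ, x j) * u ^ 2) * ∏ j, limitFactor J lam x u j (t j)
      = limitIntegrand J lam x t * Real.exp (-1 * (u - ∑ j ∈ Jᶜ, x j * t j) ^ 2) := by
    intro u
    unfold limitFactor limitIntegrand
    rw [prod_ite_mem_compl, ← Real.exp_sum]
    have h : ∑ j ∈ Jᶜ, -x j * (t j - u) ^ 2
        = -∑ j ∈ Jᶜ, x j * t j ^ 2 + 2 * u * ∑ j ∈ Jᶜ, x j * t j - u ^ 2 * ∑ j ∈ Jᶜ, x j := by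
      rw [Finset.mul_sum, Finset.mul_sum, ← Finset.sum_neg_distrib, ← Finset.sum_add_distrib,
        ← Finset.sum_sub_distrib]
      exact Finset.sum_congr rfl fun j _ => by ring
    rw [h, mul_left_comm, mul_assoc, ← Real.exp_add]
    conv_rhs => rw [mul_assoc, ← Real.exp_add]
    congr 2
    ring
  simp only [e, integral_const_mul]
  rw [integral_sub_right_eq_self (fun u => Real.exp (-1 * u ^ 2)), integral_gaussian, div_one,
    mul_comm]

theorem limitFactor_nonneg (J : Finset (Fin d)) (lam x : Fin d → ℝ) (u : ℝ) (j : Fin d) (s : ℝ) :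
    0 ≤ limitFactor J lam x u j s := by
  unfold limitFactor
  split_ifs
  · exact Set.indicator_nonneg (fun _ _ => (Real.exp_pos _).le) s
  · positivity

theorem integral_limitFactor (J : Finset (Fin d)) (lam x : Fin d → ℝ) (u : ℝ) (j : Fin d) :
    ∫ s, limitFactor J lam x u j s
      = if j ∈ J then 2 * Real.pi * (Real.exp (-2 * lam j) * besselI 0 (2 * lam j))
        else √(Real.pi / x j) := by
  unfold limitFactor
  split_ifs with hj
  · rw [integral_indicator measurableSet_Ioc, integral_exp_one_sub_cos]
  · rw [integral_sub_right_eq_self (fun s => Real.exp (-x j * s ^ 2)), integral_gaussian]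

theorem integrable_limitFactor (hx : x ∈ admissible J) (lam : Fin d → ℝ) (u : ℝ) (j : Fin d) :
    Integrable (limitFactor J lam x u j) := by
  unfold limitFactor
  split_ifs with hj
  · refine (integrable_indicator_iff measurableSet_Ioc).2 ?_
    exact (Continuous.integrableOn_Icc (by fun_prop)).mono_set Set.Ioc_subset_Icc_self
  · exact (integrable_exp_neg_mul_sq (hx.1 j hj).1).comp_sub_right u

theorem measurable_limitFactor (J : Finset (Fin d)) (lam x : Fin d → ℝ) (j : Fin d) :
    Measurable fun p : ℝ × ℝ => limitFactor J lam x p.1 j p.2 := by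
  unfold limitFactor
  split_ifs with hj
  · refine Measurable.comp (g := (Set.Ioc (-Real.pi) Real.pi).indicator
      (fun s => Real.exp (-(2 * lam j * (1 - Real.cos s))))) ?_ measurable_snd
    exact Measurable.indicator (by fun_prop) measurableSet_Ioc
  · fun_prop

/-- By Fubini the `t`-integral is taken first, at fixed `u`. It factors over coordinates, and
translation invariance makes it independent of `u`, leaving a one-dimensional Gaussian integral. -/
theorem integral_limitIntegrand (hx : x ∈ admissible J) (lam : Fin d → ℝ) :
    √Real.pi * ∫ t : Fin d → ℝ, limitIntegrand J lam x t
      = √(Real.pi / (1 - ∑ j ∈ Jᶜ, x j))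
        * ((∏ j ∈ J, 2 * Real.pi * (Real.exp (-2 * lam j) * besselI 0 (2 * lam j)))
          * ∏ j ∈ Jᶜ, √(Real.pi / x j)) := by
  have hx0 : 0 < 1 - ∑ j ∈ Jᶜ, x j := sub_pos.2 hx.2
  have hprod : ∀ u : ℝ, ∫ t : Fin d → ℝ, ∏ j, limitFactor J lam x u j (t j)
      = (∏ j ∈ J, 2 * Real.pi * (Real.exp (-2 * lam j) * besselI 0 (2 * lam j)))
          * ∏ j ∈ Jᶜ, √(Real.pi / x j) := by
    intro u
    rw [volume_pi, integral_fintype_prod_eq_prod (fun j => limitFactor J lam x u j)]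
    simp only [integral_limitFactor]
    rw [prod_ite_mem_compl]
  rw [← integral_const_mul]
  simp only [← integral_limitFactor_gaussian]
  rw [integral_integral_swap]
  · simp only [integral_const_mul, hprod, integral_mul_const, integral_gaussian]
  · have hmeas : AEStronglyMeasurable (Function.uncurry fun (t : Fin d → ℝ) (u : ℝ) =>
        Real.exp (-(1 - ∑ j ∈ Jᶜ, x j) * u ^ 2) * ∏ j, limitFactor J lam x u j (t j))
        (volume.prod volume) := by
      refine Measurable.aestronglyMeasurable ?_
      refine Measurable.mul (by fun_prop) (Finset.measurable_prod _ fun j _ => ?_)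
      exact (measurable_limitFactor J lam x j).comp
        (measurable_snd.prodMk ((measurable_pi_apply j).comp measurable_fst))
    refine (integrable_prod_iff' hmeas).2 ⟨ae_of_all _ fun u => ?_, ?_⟩
    · have h := (Integrable.fintype_prod (μ := fun _ : Fin d => (volume : Measure ℝ)) fun j =>
        integrable_limitFactor hx lam u j).const_mul (Real.exp (-(1 - ∑ j ∈ Jᶜ, x j) * u ^ 2))
      exact h
    · have e : ∀ u : ℝ, (∫ t : Fin d → ℝ, ‖Function.uncurry (fun (t : Fin d → ℝ) (u : ℝ) =>
          Real.exp (-(1 - ∑ j ∈ Jᶜ, x j) * u ^ 2) * ∏ j, limitFactor J lam x u j (t j)) (t, u)‖)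
          = Real.exp (-(1 - ∑ j ∈ Jᶜ, x j) * u ^ 2)
            * ((∏ j ∈ J, 2 * Real.pi * (Real.exp (-2 * lam j) * besselI 0 (2 * lam j)))
              * ∏ j ∈ Jᶜ, √(Real.pi / x j)) := by
        intro u
        rw [← hprod u, ← integral_const_mul]
        refine integral_congr_ae (ae_of_all _ fun t => ?_)
        exact Real.norm_of_nonneg (mul_nonneg (Real.exp_pos _).le
          (Finset.prod_nonneg fun j _ => limitFactor_nonneg J lam x u j _))
      simp only [e]
      exact (integrable_exp_neg_mul_sq hx0).mul_const _

theorem tendsto_mul_one_sub_cos (a : ℝ) :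
    Tendsto (fun N : ℕ => (N : ℝ) * (1 - Real.cos (a / √((N + 1 : ℕ) : ℝ)))) atTop
      (𝓝 (a ^ 2 / 2)) := by
  have hratio : Tendsto (fun N : ℕ => (N : ℝ) / ((N + 1 : ℕ) : ℝ)) atTop (𝓝 1) := by
    simpa using tendsto_natCast_div_add_atTop (1 : ℝ)
  have hinv : Tendsto (fun N : ℕ => (((N + 1 : ℕ) : ℝ))⁻¹) atTop (𝓝 0) :=
    (tendsto_inv_atTop_nhds_zero_nat (𝕜 := ℝ)).comp (tendsto_add_atTop_nat 1)
  have hmain : Tendsto (fun N : ℕ => (N : ℝ) / ((N + 1 : ℕ) : ℝ) * (a ^ 2 / 2)) atTop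
      (𝓝 (a ^ 2 / 2)) := by simpa using hratio.mul_const (a ^ 2 / 2)
  -- `5 / 96` is the constant of `Real.cos_bound`, applicable once `a ^ 2 ≤ N + 1`.
  have herr : Tendsto (fun N : ℕ => a ^ 4 * (5 / 96) * (((N + 1 : ℕ) : ℝ))⁻¹) atTop (𝓝 0) := by
    simpa using hinv.const_mul (a ^ 4 * (5 / 96))
  refine tendsto_of_tendsto_of_dist hmain
    (squeeze_zero' (Eventually.of_forall fun _ => dist_nonneg) ?_ herr)
  have hlarge : ∀ᶠ N : ℕ in atTop, a ^ 2 ≤ ((N + 1 : ℕ) : ℝ) :=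
    ((tendsto_natCast_atTop_atTop (R := ℝ)).comp (tendsto_add_atTop_nat 1)).eventually_ge_atTop _
  filter_upwards [hlarge] with N hN
  have hm : (0 : ℝ) < ((N + 1 : ℕ) : ℝ) := by positivity
  have hs : 0 < √((N + 1 : ℕ) : ℝ) := Real.sqrt_pos.2 hm
  have h1 : |a / √((N + 1 : ℕ) : ℝ)| ≤ 1 := by
    rw [abs_div, abs_of_pos hs, div_le_one hs]
    exact Real.abs_le_sqrt hN
  have h2 := Real.cos_bound h1
  have e2 : (a / √((N + 1 : ℕ) : ℝ)) ^ 2 = a ^ 2 / ((N + 1 : ℕ) : ℝ) := by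
    rw [div_pow, Real.sq_sqrt hm.le]
  have e4 : |a / √((N + 1 : ℕ) : ℝ)| ^ 4 = a ^ 4 / ((N + 1 : ℕ) : ℝ) ^ 2 := by
    rw [show (4 : ℕ) = 2 * 2 from rfl, pow_mul, sq_abs, e2, div_pow]
    ring
  rw [e2, e4] at h2
  rw [dist_comm, Real.dist_eq]
  have hNm : (N : ℝ) ≤ ((N + 1 : ℕ) : ℝ) := by push_cast; linarith
  have e5 : (N : ℝ) * (1 - Real.cos (a / √((N + 1 : ℕ) : ℝ)))
      - (N : ℝ) / ((N + 1 : ℕ) : ℝ) * (a ^ 2 / 2)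
      = -(N * (Real.cos (a / √((N + 1 : ℕ) : ℝ)) - (1 - a ^ 2 / ((N + 1 : ℕ) : ℝ) / 2))) := by
    field_simp
    ring
  rw [e5, abs_neg, abs_mul, Nat.abs_cast]
  calc (N : ℝ) * |Real.cos (a / √((N + 1 : ℕ) : ℝ)) - (1 - a ^ 2 / ((N + 1 : ℕ) : ℝ) / 2)|
      ≤ ((N + 1 : ℕ) : ℝ) * (a ^ 4 / ((N + 1 : ℕ) : ℝ) ^ 2 * (5 / 96)) := by gcongr
    _ = _ := by field_simp

theorem tendsto_natCast_div_succ :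
    Tendsto (fun N : ℕ => (N : ℝ) / ((N + 1 : ℕ) : ℝ)) atTop (𝓝 1) := by
  simpa using tendsto_natCast_div_add_atTop (1 : ℝ)

theorem tendsto_div_sqrt_succ (a : ℝ) :
    Tendsto (fun N : ℕ => a / √((N + 1 : ℕ) : ℝ)) atTop (𝓝 0) := by
  refine Tendsto.div_atTop tendsto_const_nhds ?_
  exact Real.tendsto_sqrt_atTop.comp
    ((tendsto_natCast_atTop_atTop (R := ℝ)).comp (tendsto_add_atTop_nat 1))

theorem tendsto_div_succ (a : ℝ) :
    Tendsto (fun N : ℕ => a / ((N + 1 : ℕ) : ℝ)) atTop (𝓝 0) :=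
  (tendsto_const_div_atTop_nhds_zero_nat a).comp (tendsto_add_atTop_nat 1)

theorem tendsto_one_sub_sum_nearPoint (J : Finset (Fin d)) (lam x : Fin d → ℝ) :
    Tendsto (fun N : ℕ => 1 - ∑ i, nearPoint J lam x (N + 1) i) atTop
      (𝓝 (1 - ∑ i ∈ Jᶜ, x i)) := by
  simp only [sum_nearPoint]
  simpa using (((tendsto_div_succ (∑ i ∈ J, lam i)).add_const (∑ i ∈ Jᶜ, x i)).const_sub 1)

theorem tendsto_single_term (J : Finset (Fin d)) (lam x t : Fin d → ℝ) (i : Fin d) :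
    Tendsto (fun N : ℕ => (N : ℝ) * (nearPoint J lam x (N + 1) i
      * (1 - Real.cos (t i / freqScale J (N + 1) i)))) atTop
      (𝓝 (if i ∈ J then lam i * (1 - Real.cos (t i)) else x i * (t i ^ 2 / 2))) := by
  unfold nearPoint freqScale
  split_ifs with hi
  · have := tendsto_natCast_div_succ.mul_const (lam i * (1 - Real.cos (t i)))
    rw [one_mul] at this
    refine this.congr fun N => ?_
    rw [div_one]
    ring
  · refine ((tendsto_mul_one_sub_cos (t i)).const_mul (x i)).congr fun N => ?_
    ring

/-- Two indices in `J` give a product of order `m⁻²`, too small to survive the factor `N`. In a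
mixed pair the frequency outside `J` tends to zero and only the one in `J` remains. Two indices
outside `J` give the quadratic term. -/
theorem tendsto_pair_term (J : Finset (Fin d)) (lam x t : Fin d → ℝ) (i j : Fin d) :
    Tendsto (fun N : ℕ => (N : ℝ) * (nearPoint J lam x (N + 1) i * nearPoint J lam x (N + 1) j
      * (1 - Real.cos (t i / freqScale J (N + 1) i - t j / freqScale J (N + 1) j)))) atTop
      (𝓝 (if i ∈ J then (if j ∈ J then 0 else x j * (lam i * (1 - Real.cos (t i))))
        else (if j ∈ J then x i * (lam j * (1 - Real.cos (t j)))
          else x i * x j * ((t i - t j) ^ 2 / 2)))) := by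
  unfold nearPoint freqScale
  split_ifs with hi hj hj
  · have := (tendsto_natCast_div_succ.mul (tendsto_div_succ
      (lam i * lam j * (1 - Real.cos (t i - t j)))))
    rw [mul_zero] at this
    refine this.congr fun N => ?_
    rw [div_one, div_one]
    ring
  · have h1 : Tendsto (fun N : ℕ => Real.cos (t i - t j / √((N + 1 : ℕ) : ℝ))) atTop
        (𝓝 (Real.cos (t i))) := by
      have h := (tendsto_div_sqrt_succ (t j)).const_sub (t i)
      rw [sub_zero] at h
      exact (Real.continuous_cos.tendsto _).comp h
    have := tendsto_natCast_div_succ.mul ((h1.const_sub 1).const_mul (x j * lam i))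
    rw [one_mul, mul_assoc (x j)] at this
    refine this.congr fun N => ?_
    rw [div_one]
    ring
  · have h1 : Tendsto (fun N : ℕ => Real.cos (t i / √((N + 1 : ℕ) : ℝ) - t j)) atTop
        (𝓝 (Real.cos (t j))) := by
      have h := (tendsto_div_sqrt_succ (t i)).sub_const (t j)
      rw [zero_sub] at h
      rw [← Real.cos_neg (t j)]
      exact (Real.continuous_cos.tendsto _).comp h
    have := tendsto_natCast_div_succ.mul ((h1.const_sub 1).const_mul (x i * lam j))
    rw [one_mul, mul_assoc (x i)] at this
    refine this.congr fun N => ?_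
    rw [div_one]
    ring
  · refine ((tendsto_mul_one_sub_cos (t i - t j)).const_mul (x i * x j)).congr fun N => ?_
    rw [sub_div]
    ring

theorem tendsto_norm_charFn_pow (hlam : ∀ i ∈ J, 0 ≤ lam i) (hx : x ∈ admissible J)
    (t : Fin d → ℝ) :
    Tendsto (fun N : ℕ => (‖charFn (nearPoint J lam x (N + 1))
      (fun j => t j / freqScale J (N + 1) j)‖ ^ 2) ^ N) atTop
      (𝓝 (Real.exp (-(∑ j ∈ J, 2 * lam j * (1 - Real.cos (t j))
        + (∑ j ∈ Jᶜ, x j * t j ^ 2 - (∑ j ∈ Jᶜ, x j * t j) ^ 2))))) := by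
  have h1 : Tendsto (fun N : ℕ => (N : ℝ) * -(2 * (1 - ∑ i, nearPoint J lam x (N + 1) i)
        * (∑ i, nearPoint J lam x (N + 1) i * (1 - Real.cos (t i / freqScale J (N + 1) i)))
      + ∑ i, ∑ j, nearPoint J lam x (N + 1) i * nearPoint J lam x (N + 1) j
        * (1 - Real.cos (t i / freqScale J (N + 1) i - t j / freqScale J (N + 1) j)))) atTop
      (𝓝 (-(2 * (1 - ∑ i ∈ Jᶜ, x i) * (∑ i, if i ∈ J then lam i * (1 - Real.cos (t i))
          else x i * (t i ^ 2 / 2))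
        + ∑ i, ∑ j, if i ∈ J then (if j ∈ J then 0 else x j * (lam i * (1 - Real.cos (t i))))
        else (if j ∈ J then x i * (lam j * (1 - Real.cos (t j)))
          else x i * x j * ((t i - t j) ^ 2 / 2))))) := by
    have h2 := ((tendsto_one_sub_sum_nearPoint J lam x).const_mul 2).mul
      (tendsto_finsetSum Finset.univ fun i _ => tendsto_single_term J lam x t i)
    have h3 := tendsto_finsetSum Finset.univ fun i _ =>
      tendsto_finsetSum Finset.univ fun j _ => tendsto_pair_term J lam x t i j
    refine (h2.add h3).neg.congr fun N => ?_
    simp only [← Finset.mul_sum]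
    ring
  -- The mixed pairs supply the `∑ x j` missing in `1 - ∑ x j`, so that every direction of `J` has
  -- weight `2 λ (1 - cos)` regardless of `x`. Outside `J` the same completion happens with the
  -- diagonal terms of the pairs, and the cross terms leave `-(∑ x j t j)²`.
  have e : 2 * (1 - ∑ i ∈ Jᶜ, x i) * (∑ i, if i ∈ J then lam i * (1 - Real.cos (t i))
          else x i * (t i ^ 2 / 2))
        + (∑ i, ∑ j, if i ∈ J then (if j ∈ J then 0 else x j * (lam i * (1 - Real.cos (t i))))
        else (if j ∈ J then x i * (lam j * (1 - Real.cos (t j)))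
          else x i * x j * ((t i - t j) ^ 2 / 2)))
      = ∑ j ∈ J, 2 * lam j * (1 - Real.cos (t j))
        + (∑ j ∈ Jᶜ, x j * t j ^ 2 - (∑ j ∈ Jᶜ, x j * t j) ^ 2) := by
    have e1 : ∀ i, (∑ j, if i ∈ J then (if j ∈ J then 0 else x j * (lam i * (1 - Real.cos (t i))))
        else (if j ∈ J then x i * (lam j * (1 - Real.cos (t j)))
          else x i * x j * ((t i - t j) ^ 2 / 2)))
        = if i ∈ J then (∑ j ∈ Jᶜ, x j) * (lam i * (1 - Real.cos (t i)))
          else x i * (∑ j ∈ J, lam j * (1 - Real.cos (t j)))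
            + (x i * t i ^ 2 * (∑ j ∈ Jᶜ, x j) / 2 + x i * (∑ j ∈ Jᶜ, x j * t j ^ 2) / 2
              - x i * t i * ∑ j ∈ Jᶜ, x j * t j) := by
      intro i
      split_ifs with hi
      · rw [sum_ite_mem_compl, Finset.sum_const_zero, zero_add, Finset.sum_mul]
      · rw [sum_ite_mem_compl, Finset.mul_sum]
        congr 1
        rw [Finset.mul_sum, Finset.mul_sum, Finset.mul_sum, Finset.sum_div, Finset.sum_div,
          ← Finset.sum_add_distrib, ← Finset.sum_sub_distrib]
        exact Finset.sum_congr rfl fun j _ => by ring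
    simp only [e1]
    rw [sum_ite_mem_compl, sum_ite_mem_compl, Finset.sum_add_distrib, Finset.sum_sub_distrib,
      Finset.sum_add_distrib, ← Finset.mul_sum, ← Finset.sum_mul, ← Finset.sum_div,
      ← Finset.sum_div, ← Finset.sum_mul, ← Finset.sum_mul, ← Finset.sum_mul]
    have e2 : ∑ j ∈ J, 2 * lam j * (1 - Real.cos (t j))
        = 2 * ∑ j ∈ J, lam j * (1 - Real.cos (t j)) := by
      rw [Finset.mul_sum]
      exact Finset.sum_congr rfl fun j _ => by ring
    have e3 : ∑ j ∈ Jᶜ, x j * (t j ^ 2 / 2) = (∑ j ∈ Jᶜ, x j * t j ^ 2) / 2 := by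
      rw [Finset.sum_div]
      exact Finset.sum_congr rfl fun j _ => by ring
    rw [e2, e3]
    ring
  rw [e] at h1
  refine (Real.tendsto_one_add_pow_exp_of_tendsto h1).congr' ?_
  filter_upwards [eventually_nearPoint hlam hx] with N hN
  rw [norm_charFn_sq hN.2.1, ← sub_eq_add_neg]

/-- Outside `J` the boxes exhaust the line, so their indicator is eventually one; in the directions
of `J` the box is fixed, which is why the limit keeps an indicator there. -/
theorem tendsto_indicator_norm_charFn_pow (hlam : ∀ i ∈ J, 0 ≤ lam i) (hx : x ∈ admissible J)
    (t : Fin d → ℝ) :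
    Tendsto (fun N : ℕ => (fourierBox (freqScale J (N + 1))).indicator
      (fun t => (‖charFn (nearPoint J lam x (N + 1))
        (fun j => t j / freqScale J (N + 1) j)‖ ^ 2) ^ N) t) atTop
      (𝓝 (limitIntegrand J lam x t)) := by
  by_cases ht : ∀ j ∈ J, t j ∈ Set.Ioc (-Real.pi) Real.pi
  · have hL : limitIntegrand J lam x t = Real.exp (-(∑ j ∈ J, 2 * lam j * (1 - Real.cos (t j))
        + (∑ j ∈ Jᶜ, x j * t j ^ 2 - (∑ j ∈ Jᶜ, x j * t j) ^ 2))) := by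
      unfold limitIntegrand
      rw [Finset.prod_congr rfl fun j hj => Set.indicator_of_mem (ht j hj) _, ← Real.exp_sum,
        ← Real.exp_add, neg_add, Finset.sum_neg_distrib]
    rw [hL]
    refine (tendsto_norm_charFn_pow hlam hx t).congr' ?_
    have hbox : ∀ᶠ N : ℕ in atTop, ∀ j, |t j| < √((N + 1 : ℕ) : ℝ) := by
      refine eventually_all.2 fun j => ?_
      exact (Real.tendsto_sqrt_atTop.comp ((tendsto_natCast_atTop_atTop (R := ℝ)).comp
        (tendsto_add_atTop_nat 1))).eventually_gt_atTop _
    filter_upwards [hbox] with N hN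
    rw [Set.indicator_of_mem]
    intro j _
    by_cases hj : j ∈ J
    · simpa [freqScale, hj] using ht j hj
    · simp only [freqScale, hj, if_false]
      have h1 := abs_lt.1 (hN j)
      have h2 : √((N + 1 : ℕ) : ℝ) ≤ Real.pi * √((N + 1 : ℕ) : ℝ) :=
        le_mul_of_one_le_left (Real.sqrt_nonneg _) (by linarith [Real.pi_gt_three])
      exact ⟨by linarith, by linarith⟩
  · push Not at ht
    obtain ⟨j, hj, hjt⟩ := ht
    have hL : limitIntegrand J lam x t = 0 := by
      unfold limitIntegrand
      rw [Finset.prod_eq_zero hj (Set.indicator_of_notMem hjt _), zero_mul]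
    rw [hL]
    refine tendsto_const_nhds.congr fun N => ?_
    rw [Set.indicator_of_notMem]
    intro h
    refine hjt ?_
    simpa [freqScale, hj] using h j (Set.mem_univ j)

/-- The form in which the Fourier computation delivers `psi`: `√(π/x) / (2π) = 1/√(4π x)` for each
coordinate outside `J`. -/
theorem psi_compl_eq (hx : x ∈ admissible J) :
    psi Jᶜ x = (√(1 - ∑ j ∈ Jᶜ, x j))⁻¹ * ∏ j ∈ Jᶜ, (√(Real.pi / x j) / (2 * Real.pi)) := by
  have hx0 : 0 < 1 - ∑ j ∈ Jᶜ, x j := sub_pos.2 hx.2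
  have hpos : ∀ j ∈ Jᶜ, 0 < x j := fun j hj => (hx.1 j (Finset.mem_compl.1 hj)).1
  have hp : 0 < ∏ j ∈ Jᶜ, x j := Finset.prod_pos hpos
  unfold psi
  rw [Real.rpow_neg (by positivity), ← Real.sqrt_eq_rpow, Real.sqrt_mul (by positivity),
    Real.sqrt_mul (by positivity), mul_inv, mul_inv]
  have h2 : ∏ j ∈ Jᶜ, (√(Real.pi / x j) / (2 * Real.pi))
      = (√((4 * Real.pi) ^ Jᶜ.card))⁻¹ * (√(∏ j ∈ Jᶜ, x j))⁻¹ := by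
    rw [← mul_inv, ← Real.sqrt_mul (by positivity), ← Finset.prod_const, ← Finset.prod_mul_distrib,
      ← Real.sqrt_inv, ← Finset.prod_inv_distrib, Real.sqrt_prod _ fun j hj => by
        have := hpos j hj
        positivity]
    refine Finset.prod_congr rfl fun j hj => ?_
    have hj' := hpos j hj
    have h3 : 2 * Real.pi = √((2 * Real.pi) ^ 2) := (Real.sqrt_sq (by positivity)).symm
    conv_lhs => rw [h3]
    rw [← Real.sqrt_div (by positivity)]
    congr 1
    field_simp
    ring
  rw [h2]
  ring

/-- The local limit theorem for the sum of the squared probabilities. -/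
theorem tendsto_sum_multinomialProb_sq (hlam : ∀ i ∈ J, 0 ≤ lam i) (hx : x ∈ admissible J) :
    Tendsto (fun N : ℕ => √((N + 1 : ℕ) : ℝ) ^ Jᶜ.card * ∑ k ∈ latticePoints d N,
      multinomialProb N k (nearPoint J lam x (N + 1)) ^ 2) atTop
      (𝓝 (psi Jᶜ x * ∏ i ∈ J, (Real.exp (-2 * lam i) * besselI 0 (2 * lam i)))) := by
  set κ := (1 - ∑ i ∈ Jᶜ, x i) / (2 * Real.pi ^ 2) with hκ
  have hκp : 0 < κ := div_pos (sub_pos.2 hx.2) (by positivity)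
  have hnn : ∀ t : Fin d → ℝ, 0 ≤ ∏ j, fourierMajorant J x κ j (t j) := fun t =>
    Finset.prod_nonneg fun j _ => fourierMajorant_nonneg J x κ j _
  have hlim : Tendsto (fun N : ℕ => ∫ t, (fourierBox (freqScale J (N + 1))).indicator
      (fun t => (‖charFn (nearPoint J lam x (N + 1))
        (fun j => t j / freqScale J (N + 1) j)‖ ^ 2) ^ N) t) atTop
      (𝓝 (∫ t, limitIntegrand J lam x t)) := by
    refine tendsto_integral_filter_of_dominated_convergence
      (fun t => ∏ j, fourierMajorant J x κ j (t j)) (Eventually.of_forall fun N => ?_) ?_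
      (integrable_fourierMajorant hx hκp)
      (ae_of_all _ fun t => tendsto_indicator_norm_charFn_pow hlam hx t)
    · have := continuous_charFn (nearPoint J lam x (N + 1)) (freqScale J (N + 1))
      exact ((this.norm.pow 2).pow N).aestronglyMeasurable.indicator (measurableSet_fourierBox _)
    · filter_upwards [eventually_nearPoint hlam hx] with N hN
      refine ae_of_all _ fun t => ?_
      by_cases ht : t ∈ fourierBox (freqScale J (N + 1))
      -- The integrand is a `2N`-th power: one `N`-th power is bounded by the majorant, the other by
      -- one.
      · rw [Set.indicator_of_mem ht, Real.norm_of_nonneg (by positivity), ← pow_mul, mul_comm,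
          pow_mul, sq]
        have h1 := norm_charFn_pow_le_majorant hx hN.1 hN.2.1 hN.2.2 ht
        have h2 : ‖charFn (nearPoint J lam x (N + 1))
            (fun j => t j / freqScale J (N + 1) j)‖ ≤ 1 := by
          have := norm_charFn_sq_le_one hN.2.1 (fun j => t j / freqScale J (N + 1) j)
          exact (sq_le_one_iff₀ (norm_nonneg _)).1 this
        exact (mul_le_of_le_one_right (by positivity)
          (pow_le_one₀ (norm_nonneg _) h2)).trans h1
      · rw [Set.indicator_of_notMem ht, norm_zero]
        exact hnn t
  have hval : (∫ t, limitIntegrand J lam x t) / (2 * Real.pi) ^ d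
      = psi Jᶜ x * ∏ i ∈ J, (Real.exp (-2 * lam i) * besselI 0 (2 * lam i)) := by
    have h := integral_limitIntegrand hx lam
    -- The normalisation `(2π)^d` splits along `J`: the part for `J` cancels the factors `2π` of the
    -- Bessel integrals, the part for the complement enters `psi`.
    have hsπ : √Real.pi ≠ 0 := (Real.sqrt_pos.2 Real.pi_pos).ne'
    have hcard : (2 * Real.pi) ^ d = (2 * Real.pi) ^ J.card * (2 * Real.pi) ^ Jᶜ.card := by
      rw [← pow_add, Finset.card_add_card_compl, Fintype.card_fin]
    rw [Real.sqrt_div Real.pi_pos.le, Finset.prod_mul_distrib, Finset.prod_const] at h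
    have h' : ∫ t, limitIntegrand J lam x t = (√(1 - ∑ j ∈ Jᶜ, x j))⁻¹
        * ((2 * Real.pi) ^ J.card * (∏ j ∈ J, (Real.exp (-2 * lam j) * besselI 0 (2 * lam j)))
          * ∏ j ∈ Jᶜ, √(Real.pi / x j)) := by
      apply mul_left_cancel₀ hsπ
      rw [h]
      ring
    rw [h', psi_compl_eq hx, Finset.prod_div_distrib, Finset.prod_const, hcard]
    have : (2 * Real.pi) ≠ 0 := by positivity
    field_simp
  rw [← hval]
  refine (hlim.div_const _).congr fun N => ?_
  rw [integral_indicator (measurableSet_fourierBox _),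
    integral_norm_charFn_pow (freqScale_pos J (by omega)), prod_freqScale]
  have : (2 * Real.pi) ≠ 0 := by positivity
  field_simp

end Limit

/-! ### Rate of convergence of the squared probabilities at the vertex -/

section Vertex

variable {d : ℕ}

/-- The squared modulus and `b = e^{-2A/m}` both equal `1 - 2A/m` up to `O(m⁻²)`, and passing to
`N`-th powers of numbers in `[0, 1]` costs a factor `N ≤ m`. The `22` is `6` from the second-order
terms of the squared modulus plus `4² = 16` from the exponential; `4 Λ` pays for the power `N` of
`b` instead of `N + 1`. -/
theorem abs_norm_charFn_pow_sub_exp_le {lam : Fin d → ℝ} (hlam : ∀ i, 0 ≤ lam i) {N : ℕ}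
    (hN : 4 * ∑ i, lam i ≤ ((N + 1 : ℕ) : ℝ)) (t : Fin d → ℝ) :
    |(‖charFn (fun i => lam i / ((N + 1 : ℕ) : ℝ)) t‖ ^ 2) ^ N
        - Real.exp (-∑ i, 2 * lam i * (1 - Real.cos (t i)))|
      ≤ (22 * (∑ i, lam i) ^ 2 + 4 * ∑ i, lam i) / ((N + 1 : ℕ) : ℝ) := by
  obtain ⟨m, hm⟩ : ∃ m : ℝ, m = ((N + 1 : ℕ) : ℝ) := ⟨_, rfl⟩
  have hm0 : 0 < m := by rw [hm]; positivity
  rw [← hm] at hN ⊢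
  set Λ := ∑ i, lam i with hΛ
  have hΛ0 : 0 ≤ Λ := Finset.sum_nonneg fun i _ => hlam i
  set A := ∑ i, lam i * (1 - Real.cos (t i)) with hA
  have hc0 : ∀ s, 0 ≤ 1 - Real.cos s := fun s => sub_nonneg.2 (Real.cos_le_one s)
  have hc2 : ∀ s, 1 - Real.cos s ≤ 2 := fun s => by linarith [Real.neg_one_le_cos s]
  have hA0 : 0 ≤ A := Finset.sum_nonneg fun i _ => mul_nonneg (hlam i) (hc0 _)
  have hA2 : A ≤ 2 * Λ := by
    rw [hA, hΛ, Finset.mul_sum]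
    exact Finset.sum_le_sum fun i _ => by nlinarith [hlam i, hc2 (t i)]
  set R := ∑ i, ∑ j, lam i * lam j * (1 - Real.cos (t i - t j)) with hR
  have hR0 : 0 ≤ R := Finset.sum_nonneg fun i _ => Finset.sum_nonneg fun j _ =>
    mul_nonneg (mul_nonneg (hlam i) (hlam j)) (hc0 _)
  have hR2 : R ≤ 2 * Λ ^ 2 := by
    have : 2 * Λ ^ 2 = ∑ i, ∑ j, lam i * lam j * 2 := by
      simp only [← Finset.sum_mul, ← Finset.mul_sum, ← hΛ]
      ring
    rw [this]
    exact Finset.sum_le_sum fun i _ => Finset.sum_le_sum fun j _ =>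
      mul_le_mul_of_nonneg_left (hc2 _) (mul_nonneg (hlam i) (hlam j))
  have hsum : ∑ i, lam i / m = Λ / m := by rw [hΛ, Finset.sum_div]
  have hy : (fun i => lam i / m) ∈ simplex d := by
    refine mem_simplex_iff.2 ⟨fun i => div_nonneg (hlam i) hm0.le, ?_⟩
    rw [hsum, div_le_one hm0]
    linarith
  have hq : ‖charFn (fun i => lam i / m) t‖ ^ 2
      = 1 - 2 * A / m + (2 * Λ * A - R) / m ^ 2 := by
    rw [norm_charFn_sq hy, hsum]
    have e1 : ∑ i, lam i / m * (1 - Real.cos (t i)) = A / m := by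
      rw [hA, Finset.sum_div]
      exact Finset.sum_congr rfl fun i _ => by ring
    have e2 : ∑ i, ∑ j, lam i / m * (lam j / m) * (1 - Real.cos (t i - t j)) = R / m ^ 2 := by
      rw [hR, Finset.sum_div]
      refine Finset.sum_congr rfl fun i _ => ?_
      rw [Finset.sum_div]
      exact Finset.sum_congr rfl fun j _ => by ring
    rw [e1, e2]
    field_simp
    ring
  set q := ‖charFn (fun i => lam i / m) t‖ ^ 2 with hqd
  have hq0 : 0 ≤ q := sq_nonneg _
  have hq1 : q ≤ 1 := norm_charFn_sq_le_one hy t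
  set b := Real.exp (-(2 * A / m)) with hb
  have hb0 : 0 ≤ b := (Real.exp_pos _).le
  have hAm : 0 ≤ 2 * A / m := by positivity
  have hAm1 : 2 * A / m ≤ 1 := by
    rw [div_le_one hm0]; linarith
  have hb1 : b ≤ 1 := Real.exp_le_one_iff.2 (neg_nonpos.2 hAm)
  have hAm4 : 2 * A / m ≤ 4 * Λ / m :=
    div_le_div_of_nonneg_right (by linarith) hm0.le
  have hqb : |q - b| ≤ 22 * Λ ^ 2 / m ^ 2 := by
    have h1 : |b - 1 - -(2 * A / m)| ≤ (-(2 * A / m)) ^ 2 :=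
      Real.abs_exp_sub_one_sub_id_le (by rwa [abs_neg, abs_of_nonneg hAm])
    have h2 : (-(2 * A / m)) ^ 2 ≤ (4 * Λ / m) ^ 2 := by
      rw [neg_sq]; gcongr
    have h3 : |(2 * Λ * A - R) / m ^ 2| ≤ 6 * Λ ^ 2 / m ^ 2 := by
      rw [abs_div, abs_of_pos (pow_pos hm0 2)]
      gcongr
      rw [abs_le]
      constructor <;> nlinarith
    have e : q - b = (2 * Λ * A - R) / m ^ 2 - (b - 1 - -(2 * A / m)) := by rw [hq]; ring
    rw [e]
    refine (abs_sub _ _).trans ?_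
    calc _ ≤ 6 * Λ ^ 2 / m ^ 2 + (4 * Λ / m) ^ 2 := add_le_add h3 (h1.trans h2)
      _ = _ := by field_simp; ring
  have hNm : (N : ℝ) ≤ m := by rw [hm]; push_cast; linarith
  have hpow : |q ^ N - b ^ N| ≤ 22 * Λ ^ 2 / m := by
    refine (abs_pow_sub_pow_le q b N).trans ?_
    have hmax : max |q| |b| ^ (N - 1) ≤ 1 := by
      refine pow_le_one₀ (le_max_of_le_left (abs_nonneg _)) (max_le ?_ ?_)
      · rwa [abs_of_nonneg hq0]
      · rwa [abs_of_nonneg hb0]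
    calc |q - b| * N * max |q| |b| ^ (N - 1) ≤ |q - b| * N * 1 := by gcongr
      _ ≤ 22 * Λ ^ 2 / m ^ 2 * m := by rw [mul_one]; gcongr
      _ = _ := by field_simp
  have hexp : Real.exp (-∑ i, 2 * lam i * (1 - Real.cos (t i))) = b ^ N * b := by
    have e1 : ∑ i, 2 * lam i * (1 - Real.cos (t i)) = 2 * A := by
      rw [hA, Finset.mul_sum]
      exact Finset.sum_congr rfl fun i _ => by ring
    rw [e1, ← pow_succ, hb, ← Real.exp_nat_mul, ← hm]
    congr 1
    field_simp
  have hlast : |b ^ N - b ^ N * b| ≤ 4 * Λ / m := by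
    have h1 : b ^ N - b ^ N * b = b ^ N * (1 - b) := by ring
    rw [h1, abs_of_nonneg (mul_nonneg (pow_nonneg hb0 _) (sub_nonneg.2 hb1))]
    refine (mul_le_of_le_one_left (sub_nonneg.2 hb1) (pow_le_one₀ hb0 hb1)).trans ?_
    have := Real.add_one_le_exp (-(2 * A / m))
    linarith
  rw [hexp]
  calc |q ^ N - b ^ N * b| ≤ |q ^ N - b ^ N| + |b ^ N - b ^ N * b| := abs_sub_le _ _ _
    _ ≤ 22 * Λ ^ 2 / m + 4 * Λ / m := add_le_add hpow hlast
    _ = _ := by ring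

/-- At distance `O(1/m)` from the vertex `0`, the sum of the squared probabilities converges with
rate `1/m`. -/
theorem abs_sum_multinomialProb_sq_sub_le {lam : Fin d → ℝ} (hlam : ∀ i, 0 ≤ lam i) {N : ℕ}
    (hN : 4 * ∑ i, lam i ≤ ((N + 1 : ℕ) : ℝ)) :
    |∑ k ∈ latticePoints d N, multinomialProb N k (fun i => lam i / ((N + 1 : ℕ) : ℝ)) ^ 2
        - ∏ i, (Real.exp (-2 * lam i) * besselI 0 (2 * lam i))|
      ≤ (22 * (∑ i, lam i) ^ 2 + 4 * ∑ i, lam i) / ((N + 1 : ℕ) : ℝ) := by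
  have h1 := integral_norm_charFn_pow (c := fun _ : Fin d => (1 : ℝ)) (fun _ => one_pos) N
    (fun i => lam i / ((N + 1 : ℕ) : ℝ))
  have h2 : ∫ t in fourierBox (fun _ : Fin d => (1 : ℝ)),
      Real.exp (-∑ i, 2 * lam i * (1 - Real.cos (t i)))
      = (2 * Real.pi) ^ d * ∏ i, (Real.exp (-2 * lam i) * besselI 0 (2 * lam i)) := by
    simp only [← Finset.sum_neg_distrib, Real.exp_sum]
    rw [fourierBox, volume_pi, Measure.restrict_pi_pi,
      integral_fintype_prod_eq_prod (fun i (s : ℝ) =>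
        Real.exp (-(2 * lam i * (1 - Real.cos s))))]
    simp only [mul_one, integral_exp_one_sub_cos, Finset.prod_mul_distrib (f := fun _ => 2 * Real.pi)]
    simp
  have hc := continuous_charFn (fun i => lam i / ((N + 1 : ℕ) : ℝ)) (fun _ => (1 : ℝ))
  simp only [mul_one, Finset.prod_const, Finset.card_univ, Fintype.card_fin] at h1
  have h3 := norm_setIntegral_le_of_norm_le_const (μ := volume)
    (f := fun t : Fin d → ℝ => (‖charFn (fun i => lam i / ((N + 1 : ℕ) : ℝ)) fun j => t j / 1‖ ^ 2) ^ N
      - Real.exp (-∑ i, 2 * lam i * (1 - Real.cos (t i))))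
    (volume_fourierBox_lt_top (fun _ : Fin d => (1 : ℝ)))
    (fun t _ => by
      simp only [div_one]
      exact abs_norm_charFn_pow_sub_exp_le hlam hN t)
  have hvol : volume.real (fourierBox (fun _ : Fin d => (1 : ℝ))) = (2 * Real.pi) ^ d := by
    rw [fourierBox, Measure.real, Real.volume_pi_Ioc_toReal]
    · simp only [mul_one, sub_neg_eq_add, Finset.prod_const, Finset.card_univ, Fintype.card_fin]
      ring
    · intro i
      simp only [mul_one]
      linarith [Real.pi_pos]
  rw [integral_sub, h1, h2, hvol, ← mul_sub, norm_mul, Real.norm_of_nonneg (by positivity),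
    mul_comm] at h3
  · exact le_of_mul_le_mul_right h3 (by positivity)
  · exact continuous_integrableOn_fourierBox _ ((hc.norm.pow 2).pow N)
  · exact continuous_integrableOn_fourierBox _ (by fun_prop)

end Vertex

/-! ### Cell averages -/

/-- The average of `g` over the cell `(k/m, (k+1)/m]`. -/
noncomputable def cellMean {d : ℕ} (m : ℕ) (g : (Fin d → ℝ) → ℝ) (k : Fin d → ℕ) : ℝ :=
  (m : ℝ) ^ d * ∫ z in cell m k, g z

section Cell

variable {d : ℕ}

theorem cell_eq_pi (m : ℕ) (k : Fin d → ℕ) :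
    cell m k = Set.univ.pi fun i => Set.Ioc ((k i : ℝ) / m) (((k i : ℝ) + 1) / m) := by
  ext z
  simp [cell, Set.mem_pi]

theorem measurableSet_cell (m : ℕ) (k : Fin d → ℕ) : MeasurableSet (cell m k) := by
  rw [cell_eq_pi]
  exact MeasurableSet.univ_pi fun _ => measurableSet_Ioc

theorem volume_cell_lt_top (m : ℕ) (k : Fin d → ℕ) : volume (cell m k) < ⊤ := by
  rw [cell_eq_pi, Real.volume_pi_Ioc]
  exact ENNReal.prod_lt_top fun _ _ => ENNReal.ofReal_lt_top

theorem volume_real_cell {m : ℕ} (k : Fin d → ℕ) :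
    volume.real (cell m k) = ((m : ℝ) ^ d)⁻¹ := by
  rw [cell_eq_pi, Measure.real, Real.volume_pi_Ioc_toReal]
  · simp [← sub_div]
  · intro i
    simp only
    gcongr
    linarith

theorem disjoint_cell {m : ℕ} (hm : 1 ≤ m) {k l : Fin d → ℕ} (hkl : k ≠ l) :
    Disjoint (cell m k) (cell m l) := by
  have hm0 : (0 : ℝ) < m := by exact_mod_cast hm
  rw [Set.disjoint_left]
  intro z hk hl
  refine hkl (funext fun i => ?_)
  have h1 := hk i
  have h2 := hl i
  rw [div_lt_iff₀ hm0, le_div_iff₀ hm0] at h1 h2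
  have h3 : (k i : ℝ) < l i + 1 := by linarith
  have h4 : (l i : ℝ) < k i + 1 := by linarith
  have h5 : k i < l i + 1 := by exact_mod_cast h3
  have h6 : l i < k i + 1 := by exact_mod_cast h4
  omega

theorem cellMean_const {m : ℕ} (hm : 1 ≤ m) (c : ℝ) (k : Fin d → ℕ) :
    cellMean m (fun _ => c) k = c := by
  have hm0 : (m : ℝ) ≠ 0 := by positivity
  rw [cellMean, setIntegral_const, volume_real_cell, smul_eq_mul, ← mul_assoc,
    mul_inv_cancel₀ (pow_ne_zero _ hm0), one_mul]

theorem abs_cellMean_le {m : ℕ} (hm : 1 ≤ m) {g : (Fin d → ℝ) → ℝ} {k : Fin d → ℕ} {C : ℝ}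
    (h : ∀ z ∈ cell m k, |g z| ≤ C) : |cellMean m g k| ≤ C := by
  have hm0 : (0 : ℝ) < m := by exact_mod_cast hm
  have h1 := norm_setIntegral_le_of_norm_le_const (μ := volume) (f := g) (volume_cell_lt_top m k) h
  rw [volume_real_cell, Real.norm_eq_abs] at h1
  rw [cellMean, abs_mul, abs_of_pos (pow_pos hm0 d)]
  calc _ ≤ (m : ℝ) ^ d * (C * ((m : ℝ) ^ d)⁻¹) := by gcongr
    _ = C := by field_simp

theorem cellMean_add {m : ℕ} {g h : (Fin d → ℝ) → ℝ} {k : Fin d → ℕ}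
    (hg : IntegrableOn g (cell m k)) (hh : IntegrableOn h (cell m k)) :
    cellMean m (fun z => g z + h z) k = cellMean m g k + cellMean m h k := by
  rw [cellMean, integral_add hg hh, mul_add]; rfl

theorem cellMean_sub {m : ℕ} {g h : (Fin d → ℝ) → ℝ} {k : Fin d → ℕ}
    (hg : IntegrableOn g (cell m k)) (hh : IntegrableOn h (cell m k)) :
    cellMean m (fun z => g z - h z) k = cellMean m g k - cellMean m h k := by
  rw [cellMean, integral_sub hg hh, mul_sub]; rfl

theorem continuous_integrableOn_cell (m : ℕ) (k : Fin d → ℕ) {g : (Fin d → ℝ) → ℝ}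
    (hg : Continuous g) : IntegrableOn g (cell m k) := by
  have h : IsCompact (Set.univ.pi fun i => Set.Icc ((k i : ℝ) / m) (((k i : ℝ) + 1) / m)) :=
    isCompact_univ_pi fun _ => isCompact_Icc
  rw [cell_eq_pi]
  exact (hg.continuousOn.integrableOn_compact h).mono_set
    (Set.pi_mono fun _ _ => Set.Ioc_subset_Icc_self)

theorem cellMean_coord {m : ℕ} (hm : 1 ≤ m) (k : Fin d → ℕ) (i : Fin d) :
    cellMean m (fun z => z i) k = ((k i : ℝ) + 1 / 2) / m := by
  have hm0 : (0 : ℝ) < m := by exact_mod_cast hm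
  have h1 : ∀ j, ∫ s in Set.Ioc ((k j : ℝ) / m) (((k j : ℝ) + 1) / m), (if j = i then s else 1)
      = (m : ℝ)⁻¹ * if j = i then ((k j : ℝ) + 1 / 2) / m else 1 := by
    intro j
    have hle : (k j : ℝ) / m ≤ ((k j : ℝ) + 1) / m := by gcongr; linarith
    rw [← intervalIntegral.integral_of_le hle]
    split_ifs with hj
    · rw [integral_id]
      field_simp
      ring
    · rw [intervalIntegral.integral_const, smul_eq_mul, ← sub_div]
      simp
  -- The coordinate is written as a product of one-variable functions, so that the integral over the
  -- cell factors.
  have h2 : ∀ z : Fin d → ℝ, z i = ∏ j, (if j = i then z j else 1) := by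
    intro z; simp
  rw [cellMean]
  conv_lhs => rw [integral_congr_ae (ae_of_all _ h2)]
  rw [cell_eq_pi, volume_pi, Measure.restrict_pi_pi,
    integral_fintype_prod_eq_prod (fun j (s : ℝ) => if j = i then s else 1)]
  simp only [h1]
  rw [Finset.prod_mul_distrib]
  simp
  field_simp

/-- The upper corner `(k + 1)/m` has coordinate sum `(∑ k i + d)/m`. Lattice points in the top
layers may violate the condition; their cells can leave the simplex. -/
theorem cell_subset_simplex {m : ℕ} (hm : 1 ≤ m) {k : Fin d → ℕ} (hk : ∑ i, k i + d ≤ m) :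
    cell m k ⊆ simplex d := by
  have hm0 : (0 : ℝ) < m := by exact_mod_cast hm
  intro z hz
  refine mem_simplex_iff.2 ⟨fun i => ?_, ?_⟩
  · exact (lt_of_le_of_lt (by positivity) (hz i).1).le
  · calc ∑ i, z i ≤ ∑ i, ((k i : ℝ) + 1) / m := Finset.sum_le_sum fun i _ => (hz i).2
      _ = ((∑ i, k i + d : ℕ) : ℝ) / m := by
        rw [← Finset.sum_div, Finset.sum_add_distrib]
        push_cast
        simp
      _ ≤ 1 := by
        rw [div_le_one hm0]
        exact_mod_cast hk

theorem norm_sub_le_of_mem_cell {m : ℕ} {k : Fin d → ℕ} {z : Fin d → ℝ}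
    (hz : z ∈ cell m k) : ‖z - fun i => (k i : ℝ) / m‖ ≤ 1 / m := by
  refine (pi_norm_le_iff_of_nonneg (by positivity)).2 fun i => ?_
  have h := hz i
  rw [add_div] at h
  rw [Pi.sub_apply, Real.norm_eq_abs, abs_le]
  exact ⟨by linarith [show (0 : ℝ) ≤ 1 / m by positivity], by linarith⟩

end Cell

/-! ### Taylor expansion on the simplex -/

section Taylor

/-- Two applications of the mean value inequality along the segment, first to the derivative minus
`t * A v v`, then to the function minus its quadratic model. The form `A` is free: `A = 0` gives the
first-order expansion, the second derivative at `y` gives the second-order one. -/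
theorem abs_taylor_two_le {E : Type*} [NormedAddCommGroup E] [NormedSpace ℝ E] {F : E → ℝ}
    {U : Set E} (hU : IsOpen U) (hF : ContDiffOn ℝ 2 F U) {y v : E}
    (hseg : ∀ t ∈ Set.Icc (0 : ℝ) 1, y + t • v ∈ U) (A : E →L[ℝ] E →L[ℝ] ℝ) {ε : ℝ}
    (hA : ∀ t ∈ Set.Icc (0 : ℝ) 1, ‖fderiv ℝ (fderiv ℝ F) (y + t • v) - A‖ ≤ ε) :
    |F (y + v) - (F y + fderiv ℝ F y v + 1 / 2 * A v v)| ≤ ε * ‖v‖ ^ 2 := by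
  have hD1 : ContDiffOn ℝ 1 (fderiv ℝ F) U := hF.fderiv_of_isOpen hU (by norm_num)
  have hpath : ∀ t : ℝ, HasDerivAt (fun t : ℝ => y + t • v) v t := fun t => by
    simpa using ((hasDerivAt_id t).smul_const v).const_add y
  have hd1 : ∀ t ∈ Set.Icc (0 : ℝ) 1,
      HasDerivAt (fun t : ℝ => F (y + t • v)) (fderiv ℝ F (y + t • v) v) t := fun t ht =>
    (((hF.differentiableOn (by norm_num)).differentiableAt
      (hU.mem_nhds (hseg t ht))).hasFDerivAt.comp_hasDerivAt t (hpath t))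
  have hd2 : ∀ t ∈ Set.Icc (0 : ℝ) 1,
      HasDerivAt (fun t : ℝ => fderiv ℝ F (y + t • v) v)
        (fderiv ℝ (fderiv ℝ F) (y + t • v) v v) t := fun t ht => by
    have := ((hD1.differentiableOn one_ne_zero).differentiableAt
      (hU.mem_nhds (hseg t ht))).hasFDerivAt.comp_hasDerivAt t (hpath t)
    simpa using HasDerivAt.clm_apply this (hasDerivAt_const t v)
  have hd3 : ∀ t ∈ Set.Icc (0 : ℝ) 1,
      HasDerivWithinAt (fun t : ℝ => fderiv ℝ F (y + t • v) v - t * A v v)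
        (fderiv ℝ (fderiv ℝ F) (y + t • v) v v - A v v) (Set.Icc 0 1) t := fun t ht => by
    have h1 := (hasDerivAt_id t).mul_const (A v v)
    rw [one_mul] at h1
    exact ((hd2 t ht).sub h1).hasDerivWithinAt
  have hε : 0 ≤ ε := 
    le_trans (norm_nonneg (fderiv ℝ (fderiv ℝ F) (y + (0 : ℝ) • v) - A)) (hA 0 (by simp))
  have hb1 : ∀ t ∈ Set.Icc (0 : ℝ) 1,
      ‖fderiv ℝ (fderiv ℝ F) (y + t • v) v v - A v v‖ ≤ ε * ‖v‖ ^ 2 := fun t ht => by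
    have := ContinuousLinearMap.le_opNorm₂ (fderiv ℝ (fderiv ℝ F) (y + t • v) - A) v v
    simp only [sub_apply] at this
    refine this.trans ?_
    rw [mul_assoc, ← sq]
    gcongr
    exact hA t ht
  have hd4 : ∀ t ∈ Set.Icc (0 : ℝ) 1,
      HasDerivWithinAt (fun t : ℝ => F (y + t • v) - (t * fderiv ℝ F y v + t ^ 2 / 2 * A v v))
        (fderiv ℝ F (y + t • v) v - (fderiv ℝ F y v + t * A v v)) (Set.Icc 0 1) t := fun t ht => by
    have h1 : HasDerivAt (fun t : ℝ => t * fderiv ℝ F y v + t ^ 2 / 2 * A v v)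
        (fderiv ℝ F y v + t * A v v) t := by
      have h2 : HasDerivAt (fun t : ℝ => t * fderiv ℝ F y v + t ^ 2 / 2 * A v v)
          (1 * fderiv ℝ F y v + ((2 : ℕ) : ℝ) * t ^ (2 - 1) * 1 / 2 * A v v) t :=
        ((hasDerivAt_id t).mul_const (fderiv ℝ F y v)).add
          ((((hasDerivAt_id t).pow 2).div_const 2).mul_const (A v v))
      have e : 1 * fderiv ℝ F y v + ((2 : ℕ) : ℝ) * t ^ (2 - 1) * 1 / 2 * A v v
          = fderiv ℝ F y v + t * A v v := by
        push_cast
        ring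
      rwa [e] at h2
    exact ((hd1 t ht).sub h1).hasDerivWithinAt
  have hb2 : ∀ t ∈ Set.Icc (0 : ℝ) 1,
      ‖fderiv ℝ F (y + t • v) v - (fderiv ℝ F y v + t * A v v)‖ ≤ ε * ‖v‖ ^ 2 := fun t ht => by
    have h := (convex_Icc (0 : ℝ) 1).norm_image_sub_le_of_norm_hasDerivWithin_le hd3 hb1
      (Set.left_mem_Icc.2 zero_le_one) ht
    simp only [zero_smul, add_zero, zero_mul, sub_zero] at h
    have e : fderiv ℝ F (y + t • v) v - (fderiv ℝ F y v + t * A v v)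
        = fderiv ℝ F (y + t • v) v - t * A v v - fderiv ℝ F y v := by ring
    rw [e]
    refine h.trans (mul_le_of_le_one_right (by positivity) ?_)
    rw [Real.norm_of_nonneg ht.1]
    exact ht.2
  have h := (convex_Icc (0 : ℝ) 1).norm_image_sub_le_of_norm_hasDerivWithin_le hd4 hb2
      (Set.left_mem_Icc.2 zero_le_one) (Set.right_mem_Icc.2 zero_le_one)
  simp only [zero_smul, one_smul, add_zero, zero_mul, sub_zero, norm_one, mul_one, one_mul,
    one_pow, ne_eq, OfNat.ofNat_ne_zero, not_false_eq_true, zero_pow, zero_div] at h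
  have e : F (y + v) - (F y + fderiv ℝ F y v + 1 / 2 * A v v)
      = F (y + v) - (fderiv ℝ F y v + 1 / 2 * A v v) - F y := by ring
  rw [e]
  exact h

variable {d : ℕ}

theorem convex_simplex (d : ℕ) : Convex ℝ (simplex d) := by
  intro x hx y hy a b ha hb hab
  rw [mem_simplex_iff] at hx hy ⊢
  refine ⟨fun i => ?_, ?_⟩
  · exact add_nonneg (mul_nonneg ha (hx.1 i)) (mul_nonneg hb (hy.1 i))
  · simp only [Pi.add_apply, Pi.smul_apply, smul_eq_mul, Finset.sum_add_distrib, ← Finset.mul_sum]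
    nlinarith [hx.2, hy.2]

theorem isCompact_simplex (d : ℕ) : IsCompact (simplex d) := by
  have h : IsCompact (Set.univ.pi fun _ : Fin d => Set.Icc (0 : ℝ) 1) :=
    isCompact_univ_pi fun _ => isCompact_Icc
  refine h.of_isClosed_subset ?_ fun x hx i _ => hx.1 i
  have : simplex d = {x | ∀ i, 0 ≤ x i} ∩ {x | ∑ i, x i ≤ 1} := by
    ext x
    exact mem_simplex_iff
  rw [this]
  refine IsClosed.inter ?_ (isClosed_le (by fun_prop) continuous_const)
  simp only [Set.ofPred_forall]
  exact isClosed_iInter fun i => isClosed_le continuous_const (by fun_prop)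

theorem segment_mem_simplex {y z : Fin d → ℝ} (hy : y ∈ simplex d) (hz : z ∈ simplex d) {t : ℝ}
    (ht : t ∈ Set.Icc (0 : ℝ) 1) : y + t • (z - y) ∈ simplex d :=
  (convex_simplex d).add_smul_sub_mem hy hz ht

theorem fderiv_apply_eq_sum_pderiv (g : (Fin d → ℝ) → ℝ) (y v : Fin d → ℝ) :
    fderiv ℝ g y v = ∑ i, pderiv i g y * v i := by
  have h := LinearMap.pi_apply_eq_sum_univ (fderiv ℝ g y).toLinearMap v
  simp only [ContinuousLinearMap.coe_coe, smul_eq_mul] at h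
  rw [h]
  refine Finset.sum_congr rfl fun i _ => ?_
  rw [mul_comm, pderiv]
  congr 2
  ext j
  simp [Pi.single_apply, eq_comm]

theorem fderiv_fderiv_apply_eq_sum_pderiv {g : (Fin d → ℝ) → ℝ} {y : Fin d → ℝ}
    (h : DifferentiableAt ℝ (fderiv ℝ g) y) (v : Fin d → ℝ) :
    fderiv ℝ (fderiv ℝ g) y v v = ∑ i, ∑ j, pderiv i (pderiv j g) y * (v i * v j) := by
  have h1 : ∀ j, fderiv ℝ (pderiv j g) y v = fderiv ℝ (fderiv ℝ g) y v (Pi.single j 1) := by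
    intro j
    have := (h.hasFDerivAt.clm_apply (hasFDerivAt_const (Pi.single j (1 : ℝ)) y)).fderiv
    change fderiv ℝ (fun y => fderiv ℝ g y (Pi.single j 1)) y v = _
    rw [this]
    simp
  have h2 := LinearMap.pi_apply_eq_sum_univ (fderiv ℝ (fderiv ℝ g) y v).toLinearMap v
  simp only [ContinuousLinearMap.coe_coe, smul_eq_mul] at h2
  rw [h2, Finset.sum_comm]
  refine Finset.sum_congr rfl fun j _ => ?_
  have e : (fun i => if j = i then (1 : ℝ) else 0) = Pi.single j 1 := by
    ext i
    simp [Pi.single_apply, eq_comm]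
  rw [e, ← h1, fderiv_apply_eq_sum_pderiv, Finset.mul_sum]
  exact Finset.sum_congr rfl fun i _ => by ring

end Taylor

/-! ### The bias -/

/-- Uniform Taylor estimates on the simplex for a density `f` with smooth extension `g`. -/
structure SimplexTaylor {d : ℕ} (f g : (Fin d → ℝ) → ℝ) (M : ℝ) : Prop where
  integrable : Integrable f
  bounded : ∀ z, |f z| ≤ M
  norm_fderiv_le : ∀ y ∈ simplex d, ‖fderiv ℝ g y‖ ≤ M
  norm_fderiv_fderiv_le : ∀ y ∈ simplex d, ‖fderiv ℝ (fderiv ℝ g) y‖ ≤ M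
  differentiableAt_fderiv : ∀ y ∈ simplex d, DifferentiableAt ℝ (fderiv ℝ g) y
  continuousOn_fderiv : ContinuousOn (fderiv ℝ g) (simplex d)
  continuousOn_fderiv_fderiv : ContinuousOn (fderiv ℝ (fderiv ℝ g)) (simplex d)
  lipschitz : ∀ y ∈ simplex d, ∀ z ∈ simplex d, |f z - f y| ≤ M * ‖z - y‖
  lipschitz_fderiv : ∀ y ∈ simplex d, ∀ z ∈ simplex d,
    ‖fderiv ℝ g z - fderiv ℝ g y‖ ≤ M * ‖z - y‖
  taylor_one : ∀ y ∈ simplex d, ∀ z ∈ simplex d,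
    |f z - (f y + fderiv ℝ g y (z - y))| ≤ M * ‖z - y‖ ^ 2
  taylor_two : ∀ ε : ℝ, 0 < ε → ∃ K : ℝ, 0 ≤ K ∧ ∀ y ∈ simplex d, ∀ z ∈ simplex d,
    |f z - (f y + fderiv ℝ g y (z - y) + 1 / 2 * fderiv ℝ (fderiv ℝ g) y (z - y) (z - y))|
      ≤ ε * ‖z - y‖ ^ 2 + K * ‖z - y‖ ^ 4

theorem IsSimplexDensity.integrable {d : ℕ} {f : (Fin d → ℝ) → ℝ} (hf : IsSimplexDensity f) :
    Integrable f := by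
  by_contra h
  have := hf.integral_eq_one
  rw [integral_undef h] at this
  exact zero_ne_one this

/-- Compactness bounds the derivatives and convexity keeps segments inside the simplex. Since `f`
may jump at the boundary, only pairs of points of the simplex are compared; boundedness alone holds
everywhere. -/
theorem exists_simplexTaylor {d : ℕ} {f g : (Fin d → ℝ) → ℝ} {U : Set (Fin d → ℝ)}
    (hf : IsSimplexDensity f) (hU : IsOpen U) (hSU : simplex d ⊆ U) (hC2 : ContDiffOn ℝ 2 g U)
    (hext : Set.EqOn g f (simplex d)) : ∃ M : ℝ, SimplexTaylor f g M := by
  have hD1 : ContDiffOn ℝ 1 (fderiv ℝ g) U := hC2.fderiv_of_isOpen hU (by norm_num)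
  have hD2 : ContinuousOn (fderiv ℝ (fderiv ℝ g)) U :=
    hD1.continuousOn_fderiv_of_isOpen hU le_rfl
  have hc0 : ContinuousOn g (simplex d) := hC2.continuousOn.mono hSU
  have hc1 : ContinuousOn (fderiv ℝ g) (simplex d) := hD1.continuousOn.mono hSU
  have hc2 : ContinuousOn (fderiv ℝ (fderiv ℝ g)) (simplex d) := hD2.mono hSU
  obtain ⟨M0, hM0⟩ := (isCompact_simplex d).exists_bound_of_continuousOn hc0
  obtain ⟨M1, hM1⟩ := (isCompact_simplex d).exists_bound_of_continuousOn hc1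
  obtain ⟨M2, hM2⟩ := (isCompact_simplex d).exists_bound_of_continuousOn
    (f := fderiv ℝ (fderiv ℝ g)) hc2
  set M := max (max M0 M1) (max M2 0) with hM
  have h0 : ∀ y ∈ simplex d, ‖g y‖ ≤ M := fun y hy =>
    (hM0 y hy).trans (le_max_of_le_left (le_max_left _ _))
  have h1 : ∀ y ∈ simplex d, ‖fderiv ℝ g y‖ ≤ M := fun y hy =>
    (hM1 y hy).trans (le_max_of_le_left (le_max_right _ _))
  have h2 : ∀ y ∈ simplex d, ‖fderiv ℝ (fderiv ℝ g) y‖ ≤ M := fun y hy =>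
    (hM2 y hy).trans (le_max_of_le_right (le_max_left _ _))
  have hMnn : 0 ≤ M := le_max_of_le_right (le_max_right _ _)
  have hdg : ∀ y ∈ simplex d, DifferentiableAt ℝ g y := fun y hy =>
    (hC2.differentiableOn (by norm_num)).differentiableAt (hU.mem_nhds (hSU hy))
  have hdf : ∀ y ∈ simplex d, DifferentiableAt ℝ (fderiv ℝ g) y := fun y hy =>
    (hD1.differentiableOn one_ne_zero).differentiableAt (hU.mem_nhds (hSU hy))
  have hseg : ∀ y ∈ simplex d, ∀ z ∈ simplex d, ∀ t ∈ Set.Icc (0 : ℝ) 1,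
      y + t • (z - y) ∈ simplex d := fun y hy z hz t ht => segment_mem_simplex hy hz ht
  refine ⟨M, ?_, ?_, h1, h2, hdf, hc1, hc2, ?_, ?_, ?_, ?_⟩
  · exact hf.integrable
  · intro z
    by_cases hz : z ∈ simplex d
    · rw [← hext hz]
      exact h0 z hz
    · rw [hf.eq_zero z hz, abs_zero]
      exact hMnn
  · intro y hy z hz
    rw [← hext hz, ← hext hy]
    exact (convex_simplex d).norm_image_sub_le_of_norm_fderiv_le hdg h1 hy hz
  · intro y hy z hz
    exact (convex_simplex d).norm_image_sub_le_of_norm_fderiv_le hdf h2 hy hz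
  · intro y hy z hz
    have h := abs_taylor_two_le hU hC2 (fun t ht => hSU (hseg y hy z hz t ht)) 0 (ε := M)
      (fun t ht => by simpa using h2 _ (hseg y hy z hz t ht))
    rw [add_sub_cancel, hext hz, hext hy] at h
    simpa using h
  · intro ε hε
    obtain ⟨η, hη, hη'⟩ := (Metric.uniformContinuousOn_iff (f := fderiv ℝ (fderiv ℝ g))
      (s := simplex d)).1
      ((isCompact_simplex d).uniformContinuousOn_of_continuous
        (f := fderiv ℝ (fderiv ℝ g)) hc2) ε hε
    -- Uniform continuity handles displacements shorter than `η`. For longer ones the crude error `2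
    -- M r²` is at most `(2 M / η²) r⁴`, which the fourth moments make negligible.
    refine ⟨2 * M / η ^ 2, by positivity, fun y hy z hz => ?_⟩
    rcases lt_or_ge ‖z - y‖ η with hlt | hge
    · have h := abs_taylor_two_le hU hC2 (fun t ht => hSU (hseg y hy z hz t ht))
        (fderiv ℝ (fderiv ℝ g) y) (ε := ε) (fun t ht => by
          refine le_trans (dist_eq_norm (fderiv ℝ (fderiv ℝ g) (y + t • (z - y)))
            (fderiv ℝ (fderiv ℝ g) y)).ge (hη' _ (hseg y hy z hz t ht) y hy ?_).le
          rw [dist_eq_norm, add_sub_cancel_left, norm_smul, Real.norm_of_nonneg ht.1]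
          exact (mul_le_of_le_one_left (norm_nonneg _) ht.2).trans_lt hlt)
      rw [add_sub_cancel, hext hz, hext hy] at h
      exact h.trans (le_add_of_nonneg_right (by positivity))
    · have h := abs_taylor_two_le hU hC2 (fun t ht => hSU (hseg y hy z hz t ht))
        (fderiv ℝ (fderiv ℝ g) y) (ε := 2 * M) (fun t ht =>
          (norm_sub_le (fderiv ℝ (fderiv ℝ g) (y + t • (z - y))) (fderiv ℝ (fderiv ℝ g) y)).trans
            (by linarith [h2 _ (hseg y hy z hz t ht), h2 y hy]))
      rw [add_sub_cancel, hext hz, hext hy] at h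
      refine h.trans (le_trans ?_ (le_add_of_nonneg_left (by positivity)))
      have h3 : 1 ≤ ‖z - y‖ ^ 2 / η ^ 2 := by
        rw [one_le_div (by positivity)]
        gcongr
      calc 2 * M * ‖z - y‖ ^ 2 ≤ 2 * M * ‖z - y‖ ^ 2 * (‖z - y‖ ^ 2 / η ^ 2) :=
            le_mul_of_one_le_right (by positivity) h3
        _ = _ := by ring

section Bias

variable {d : ℕ} {f g : (Fin d → ℝ) → ℝ} {M : ℝ}

theorem SimplexTaylor.nonneg (h : SimplexTaylor f g M) : 0 ≤ M :=
  (abs_nonneg _).trans (h.bounded 0)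

/-- The bias constant at an arbitrary point of the simplex. -/
noncomputable def fullBiasConst {d : ℕ} (g : (Fin d → ℝ) → ℝ) (y : Fin d → ℝ) : ℝ :=
  (∑ i, (1 / 2 - y i) * pderiv i g y)
    + 1 / 2 * ∑ i, ∑ j, ((if i = j then y i else 0) - y i * y j) * pderiv i (pderiv j g) y

/-- On the face the coordinates in `J` vanish, and with them every second-order coefficient carrying
an index of `J`. The bias can therefore be analysed at arbitrary points of the simplex, without
reference to `J`. -/
theorem biasConst_eq_fullBiasConst (g : (Fin d → ℝ) → ℝ) (J : Finset (Fin d)) (x : Fin d → ℝ) :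
    biasConst g J x = fullBiasConst g (facePoint J x) := by
  have hS : ∀ (T : Finset (Fin d)) (A : Fin d → ℝ), (∀ i ∉ T, A i = 0) →
      ∑ i ∈ T, A i = ∑ i, A i := fun T A h =>
    Finset.sum_subset (Finset.subset_univ T) fun i _ hi => h i hi
  have hz : ∀ i, i ∉ Jᶜ → facePoint J x i = 0 := fun i hi => by
    simp [facePoint, Finset.mem_compl.not_left.1 hi]
  have hx : ∀ i ∈ Jᶜ, facePoint J x i = x i := fun i hi => by
    simp [facePoint, Finset.mem_compl.1 hi]
  unfold biasConst fullBiasConst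
  congr 1
  rw [Finset.mul_sum, ← hS Jᶜ]
  · refine Finset.sum_congr rfl fun i hi => ?_
    rw [Finset.mul_sum, ← hS Jᶜ]
    · refine Finset.sum_congr rfl fun j hj => ?_
      rw [hx i hi, hx j hj, mul_assoc]
    · intro j hj
      have : (if i = j then facePoint J x i else 0) = 0 := by
        split_ifs with hij
        · subst hij; exact hz i hj
        · rfl
      rw [hz j hj, this]
      simp
  · intro i hi
    simp [hz i hi]

/-- Distance of the lattice point `k/m` to `y`. -/
noncomputable def latticeDist {d : ℕ} (m : ℕ) (y : Fin d → ℝ) (k : Fin d → ℕ) : ℝ :=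
  ‖(fun i => (k i : ℝ) / m) - y‖

theorem latticeDist_nonneg (m : ℕ) (y : Fin d → ℝ) (k : Fin d → ℕ) : 0 ≤ latticeDist m y k :=
  norm_nonneg _

theorem latticeDist_pow_le (m : ℕ) (y : Fin d → ℝ) (k : Fin d → ℕ) {p : ℕ} (hp : p ≠ 0) :
    latticeDist m y k ^ p ≤ ∑ i, |(k i : ℝ) / m - y i| ^ p := by
  have h0 : 0 ≤ ∑ i, |(k i : ℝ) / m - y i| ^ p := Finset.sum_nonneg fun i _ => by positivity
  have h : latticeDist m y k ≤ (∑ i, |(k i : ℝ) / m - y i| ^ p) ^ ((p : ℝ)⁻¹) := by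
    refine (pi_norm_le_iff_of_nonneg (Real.rpow_nonneg h0 _)).2 fun i => ?_
    rw [Pi.sub_apply, Real.norm_eq_abs]
    calc |(k i : ℝ) / m - y i| = (|(k i : ℝ) / m - y i| ^ p) ^ ((p : ℝ)⁻¹) :=
          (Real.pow_rpow_inv_natCast (abs_nonneg _) hp).symm
      _ ≤ _ := Real.rpow_le_rpow (by positivity)
          (Finset.single_le_sum (f := fun i => |(k i : ℝ) / m - y i| ^ p)
            (fun i _ => by positivity) (Finset.mem_univ i)) (by positivity)
  calc _ ≤ ((∑ i, |(k i : ℝ) / m - y i| ^ p) ^ ((p : ℝ)⁻¹)) ^ p := by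
        gcongr
        exact latticeDist_nonneg m y k
    _ = _ := Real.rpow_inv_natCast_pow h0 hp

/-- There are `N = m - 1` trials but the scale is `m`, so `k/m` has mean `(N/m) y` instead of `y`;
the squared offset is the extra term `y i * y j`. -/
theorem multinomialMean_scaled_mul {y : Fin d → ℝ} (hy : y ∈ simplex d) (N : ℕ) (i j : Fin d) :
    multinomialMean N y (fun k => ((k i : ℝ) / ((N + 1 : ℕ) : ℝ) - y i)
      * ((k j : ℝ) / ((N + 1 : ℕ) : ℝ) - y j))
      = (N * ((if i = j then y i else 0) - y i * y j) + y i * y j) / ((N + 1 : ℕ) : ℝ) ^ 2 := by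
  have hm : ((N + 1 : ℕ) : ℝ) ≠ 0 := by positivity
  have e : ∀ k : Fin d → ℕ, ((k i : ℝ) / ((N + 1 : ℕ) : ℝ) - y i)
      * ((k j : ℝ) / ((N + 1 : ℕ) : ℝ) - y j)
      = (((N + 1 : ℕ) : ℝ) ^ 2)⁻¹ * (((k i : ℝ) - N * y i) * (k j - N * y j)
        + (-y j * ((k i : ℝ) - N * y i) + (-y i * ((k j : ℝ) - N * y j) + y i * y j))) := by
    intro k
    field_simp
    push_cast
    ring
  simp only [e]
  rw [multinomialMean_mul, multinomialMean_add, multinomialMean_add, multinomialMean_add,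
    multinomialMean_mul, multinomialMean_mul, multinomialMean_centered hy,
    multinomialMean_centered hy, multinomialMean_centered_mul hy, multinomialMean_const hy]
  field_simp
  ring

/-- Keeping `∑ y i` in the numerator matters: for `y = λ/m` the bound becomes `O(m⁻²)`, the origin
of the sharper rates at the vertex. -/
theorem multinomialMean_latticeDist_sq_le {y : Fin d → ℝ} (hy : y ∈ simplex d) (N : ℕ) :
    multinomialMean N y (fun k => latticeDist (N + 1) y k ^ 2)
      ≤ (∑ i, y i) / ((N + 1 : ℕ) : ℝ) := by
  have hm : (0 : ℝ) < ((N + 1 : ℕ) : ℝ) := by positivity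
  refine (multinomialMean_mono hy N fun k _ => latticeDist_pow_le (N + 1) y k two_ne_zero).trans ?_
  rw [multinomialMean_sum, Finset.sum_div]
  refine Finset.sum_le_sum fun i _ => ?_
  have h := multinomialMean_scaled_mul hy N i i
  simp only [← sq] at h
  simp only [sq_abs]
  rw [h, if_pos trivial, div_le_div_iff₀ (by positivity) hm]
  have h0 := simplex_nonneg hy i
  have h1 := simplex_le_one hy i
  have h2 : N * (y i - y i ^ 2) + y i ^ 2 ≤ y i * ((N + 1 : ℕ) : ℝ) := by
    push_cast
    have hN : (0 : ℝ) ≤ N := N.cast_nonneg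
    nlinarith [mul_nonneg hN (sq_nonneg (y i))]
  calc _ ≤ y i * ((N + 1 : ℕ) : ℝ) * ((N + 1 : ℕ) : ℝ) := by gcongr
    _ = _ := by ring

/-- By `(a - y)⁴ ≤ 8 (a⁴ + y⁴)` and the fourth central moment bound `3 N²`; the constant is `32 = 8
(3 + 1)`. -/
theorem multinomialMean_latticeDist_pow_four_le {y : Fin d → ℝ} (hy : y ∈ simplex d) (N : ℕ) :
    multinomialMean N y (fun k => latticeDist (N + 1) y k ^ 4)
      ≤ 32 * d / ((N + 1 : ℕ) : ℝ) ^ 2 := by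
  have hm : (0 : ℝ) < ((N + 1 : ℕ) : ℝ) := by positivity
  have hm1 : (1 : ℝ) ≤ ((N + 1 : ℕ) : ℝ) := by push_cast; linarith [(N.cast_nonneg : (0 : ℝ) ≤ N)]
  have hNm : (N : ℝ) ≤ ((N + 1 : ℕ) : ℝ) := by push_cast; linarith
  refine (multinomialMean_mono hy N fun k _ => latticeDist_pow_le (N + 1) y k four_ne_zero).trans ?_
  rw [multinomialMean_sum]
  have h : ∀ i : Fin d, multinomialMean N y
      (fun k => |(k i : ℝ) / ((N + 1 : ℕ) : ℝ) - y i| ^ 4) ≤ 32 / ((N + 1 : ℕ) : ℝ) ^ 2 := by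
    intro i
    have h0 := simplex_nonneg hy i
    have h1 := simplex_le_one hy i
    have e : ∀ k ∈ latticePoints d N, |(k i : ℝ) / ((N + 1 : ℕ) : ℝ) - y i| ^ 4
        ≤ 8 * (((N + 1 : ℕ) : ℝ) ^ 4)⁻¹ * (((k i : ℝ) - N * y i) ^ 4 + 1) := by
      intro k _
      have e1 : (k i : ℝ) / ((N + 1 : ℕ) : ℝ) - y i
          = (((k i : ℝ) - N * y i) - y i) / ((N + 1 : ℕ) : ℝ) := by
        field_simp
        push_cast
        ring
      rw [e1, abs_div, div_pow, abs_of_pos hm, div_eq_inv_mul, mul_comm (8 : ℝ), mul_assoc]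
      gcongr
      set a := (k i : ℝ) - N * y i
      have h4 : |a - y i| ^ 4 = (a - y i) ^ 4 := by
        rw [show (4 : ℕ) = 2 * 2 from rfl, pow_mul, sq_abs, ← pow_mul]
      have h5 : y i ^ 4 ≤ 1 := pow_le_one₀ h0 h1
      rw [h4]
      have h6 : (a - y i) ^ 2 ≤ 2 * a ^ 2 + 2 * y i ^ 2 := by nlinarith [sq_nonneg (a + y i)]
      have h7 : ((a - y i) ^ 2) ^ 2 ≤ (2 * a ^ 2 + 2 * y i ^ 2) ^ 2 := by gcongr
      nlinarith [sq_nonneg (a ^ 2 - y i ^ 2)]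
    refine (multinomialMean_mono hy N e).trans ?_
    rw [multinomialMean_mul, multinomialMean_add, multinomialMean_const hy]
    have h8 := multinomialMean_centered_pow_four hy N i
    calc _ ≤ 8 * (((N + 1 : ℕ) : ℝ) ^ 4)⁻¹ * (3 * ((N + 1 : ℕ) : ℝ) ^ 2 + ((N + 1 : ℕ) : ℝ) ^ 2) := by
          gcongr
          · refine h8.trans ?_
            gcongr
          · exact one_le_pow₀ hm1
      _ = _ := by field_simp; ring
  calc _ ≤ ∑ _i : Fin d, 32 / ((N + 1 : ℕ) : ℝ) ^ 2 := Finset.sum_le_sum fun i _ => h i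
    _ = _ := by
      rw [Finset.sum_const, Finset.card_univ, Fintype.card_fin, nsmul_eq_mul]
      ring

/-- Lattice points whose cell may leave the simplex have exponentially small probability. -/
theorem multinomialMean_le_of_inner {y : Fin d → ℝ} (hy : y ∈ simplex d) (N : ℕ)
    {u b : (Fin d → ℕ) → ℝ} {C : ℝ} (hC : 0 ≤ C)
    (hin : ∀ k ∈ latticePoints d N, ∑ i, k i + d ≤ N + 1 → u k ≤ b k)
    (hall : ∀ k ∈ latticePoints d N, u k ≤ C) (hb : ∀ k ∈ latticePoints d N, 0 ≤ b k) :
    multinomialMean N y u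
      ≤ multinomialMean N y b + C * 2 ^ d * ((1 + ∑ i, y i) / 2) ^ N := by
  have h : ∀ k ∈ latticePoints d N, u k ≤ b k + C * 2 ^ d * (2 ^ N)⁻¹ * 2 ^ ∑ i, k i := by
    intro k hk
    have hnn : 0 ≤ C * 2 ^ d * (2 ^ N)⁻¹ * 2 ^ ∑ i, k i := by positivity
    by_cases hk' : ∑ i, k i + d ≤ N + 1
    · exact (hin k hk hk').trans (le_add_of_nonneg_right hnn)
    · refine (hall k hk).trans (le_trans ?_ (le_add_of_nonneg_left (hb k hk)))
      -- Exponential Markov inequality with base two: an exceptional point has `∑ k i + d > N + 1`,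
      -- so this weight is at least one, while its mean is `2^d ((1 + ∑ y i)/2)^N`.
      have h1 : (1 : ℝ) ≤ 2 ^ d * (2 ^ N)⁻¹ * 2 ^ ∑ i, k i := by
        have h2 : (2 : ℝ) ^ N ≤ 2 ^ (∑ i, k i + d) :=
          pow_le_pow_right₀ one_le_two (by omega)
        have h3 : 2 ^ d * (2 ^ N)⁻¹ * 2 ^ ∑ i, k i = (2 : ℝ) ^ (∑ i, k i + d) / 2 ^ N := by
          rw [pow_add]; ring
        rw [h3, one_le_div (by positivity)]
        exact h2
      calc C = C * 1 := (mul_one C).symm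
        _ ≤ C * (2 ^ d * (2 ^ N)⁻¹ * 2 ^ ∑ i, k i) := by gcongr
        _ = _ := by ring
  refine (multinomialMean_mono hy N h).trans_eq ?_
  rw [multinomialMean_add, multinomialMean_mul, multinomialMean_two_pow hy, div_pow]
  ring

theorem latticeDist_le_one {y : Fin d → ℝ} (hy : y ∈ simplex d) {N : ℕ} {k : Fin d → ℕ}
    (hk : k ∈ latticePoints d N) : latticeDist (N + 1) y k ≤ 1 := by
  refine (pi_norm_le_iff_of_nonneg zero_le_one).2 fun i => ?_
  have h1 : (k i : ℝ) / ((N + 1 : ℕ) : ℝ) ≤ 1 := by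
    rw [div_le_one (by positivity)]
    have := Finset.single_le_sum (f := k) (fun _ _ => Nat.zero_le _) (Finset.mem_univ i)
    have h2 := mem_latticePoints.1 hk
    exact_mod_cast (by omega : k i ≤ N + 1)
  have h2 : 0 ≤ (k i : ℝ) / ((N + 1 : ℕ) : ℝ) := by positivity
  rw [Pi.sub_apply, Real.norm_eq_abs, abs_le]
  exact ⟨by linarith [simplex_le_one hy i], by linarith [simplex_nonneg hy i]⟩

theorem norm_sub_le_latticeDist {m : ℕ} (y : Fin d → ℝ) {k : Fin d → ℕ} {z : Fin d → ℝ}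
    (hz : z ∈ cell m k) : ‖z - y‖ ≤ latticeDist m y k + 1 / m := by
  have h1 := norm_sub_le_of_mem_cell hz
  have h2 : z - y = (z - fun i => (k i : ℝ) / m) + ((fun i => (k i : ℝ) / m) - y) := by abel
  rw [h2]
  exact (norm_add_le _ _).trans (by unfold latticeDist; linarith)

/-- Mean deviation of the cell averages from the value at `y`. -/
theorem SimplexTaylor.mean_abs_cellMean_sub_le (h : SimplexTaylor f g M) {y : Fin d → ℝ}
    (hy : y ∈ simplex d) (N : ℕ) :
    multinomialMean N y (fun k => |cellMean (N + 1) f k - f y|)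
      ≤ M * (multinomialMean N y (fun k => latticeDist (N + 1) y k) + 1 / ((N + 1 : ℕ) : ℝ))
        + 2 * M * 2 ^ d * ((1 + ∑ i, y i) / 2) ^ N := by
  have hM := h.nonneg
  have h1 := multinomialMean_le_of_inner hy N (C := 2 * M)
    (u := fun k => |cellMean (N + 1) f k - f y|)
    (b := fun k => M * (latticeDist (N + 1) y k + 1 / ((N + 1 : ℕ) : ℝ))) (by positivity) ?_ ?_ ?_
  · refine h1.trans_eq ?_
    rw [multinomialMean_mul, multinomialMean_add, multinomialMean_const hy]
  · intro k hk hin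
    rw [← cellMean_const (m := N + 1) (by omega) (f y) k,
      ← cellMean_sub h.integrable.integrableOn
        (continuous_integrableOn_cell _ _ continuous_const)]
    refine abs_cellMean_le (by omega) fun z hz => ?_
    refine (h.lipschitz y hy z (cell_subset_simplex (by omega) hin hz)).trans ?_
    gcongr
    exact norm_sub_le_latticeDist y hz
  · intro k hk
    have := abs_cellMean_le (m := N + 1) (k := k) (by omega) (fun z _ => h.bounded z)
    exact (abs_sub _ _).trans (by linarith [h.bounded y])
  · intro k hk
    have := latticeDist_nonneg (N + 1) y k
    positivity

end Bias

/-! ### First- and second-order expansion of the mean -/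

section BiasExpansion

variable {d : ℕ} {f g : (Fin d → ℝ) → ℝ} {M : ℝ}

/-- The centre of the cell `(k/m, (k+1)/m]`. -/
noncomputable def cellCenter {d : ℕ} (m : ℕ) (k : Fin d → ℕ) : Fin d → ℝ :=
  fun i => ((k i : ℝ) + 1 / 2) / m

theorem cellCenter_mem_cell {m : ℕ} (hm : 1 ≤ m) (k : Fin d → ℕ) : cellCenter m k ∈ cell m k := by
  have hm0 : (0 : ℝ) < m := by exact_mod_cast hm
  intro i
  simp only [cellCenter]
  constructor
  · gcongr
    linarith
  · gcongr
    linarith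

theorem cellMean_clm {m : ℕ} (hm : 1 ≤ m) (k : Fin d → ℕ) (c : ℝ) (L : (Fin d → ℝ) →L[ℝ] ℝ)
    (y : Fin d → ℝ) :
    cellMean m (fun z => c + L (z - y)) k = c + L (cellCenter m k - y) := by
  have hL : ∀ v, L v = ∑ i, v i * L (fun j => if i = j then 1 else 0) := fun v => by
    have := LinearMap.pi_apply_eq_sum_univ L.toLinearMap v
    simpa only [ContinuousLinearMap.coe_coe, smul_eq_mul] using this
  have h1 : cellMean m (fun z => L z) k = L (cellCenter m k) := by
    have hc : ∀ i, ∫ z in cell m k, z i = ((m : ℝ) ^ d)⁻¹ * cellCenter m k i := fun i => by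
      have hm0 : (m : ℝ) ≠ 0 := by positivity
      have h := cellMean_coord hm k i
      rw [cellMean] at h
      rw [cellCenter, ← h, ← mul_assoc, inv_mul_cancel₀ (pow_ne_zero _ hm0), one_mul]
    have hm0 : (m : ℝ) ≠ 0 := by positivity
    rw [cellMean, integral_congr_ae (ae_of_all _ hL), integral_finsetSum]
    · simp only [integral_mul_const, hc]
      rw [hL (cellCenter m k), Finset.mul_sum]
      refine Finset.sum_congr rfl fun i _ => ?_
      field_simp
    · intro i _
      exact continuous_integrableOn_cell _ _ (by fun_prop)
  have h2 : (fun z => c + L (z - y)) = fun z => (c - L y) + L z := by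
    ext z
    rw [map_sub]
    ring
  rw [h2, cellMean_add (continuous_integrableOn_cell _ _ (by fun_prop))
    (continuous_integrableOn_cell _ _ (by fun_prop)), cellMean_const hm, h1, map_sub]
  ring

/-- The `1/2` is the offset of the centre within its cell; the `-y i` comes from having `m - 1`
trials at scale `m`. -/
theorem multinomialMean_cellCenter {y : Fin d → ℝ} (hy : y ∈ simplex d) (N : ℕ)
    (g : (Fin d → ℝ) → ℝ) :
    multinomialMean N y (fun k => fderiv ℝ g y (cellCenter (N + 1) k - y))
      = (∑ i, (1 / 2 - y i) * pderiv i g y) / ((N + 1 : ℕ) : ℝ) := by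
  have hm : ((N + 1 : ℕ) : ℝ) ≠ 0 := by positivity
  simp only [fderiv_apply_eq_sum_pderiv]
  rw [multinomialMean_sum, Finset.sum_div]
  refine Finset.sum_congr rfl fun i _ => ?_
  have e : ∀ k : Fin d → ℕ, pderiv i g y * (cellCenter (N + 1) k - y) i
      = pderiv i g y / ((N + 1 : ℕ) : ℝ) * (((k i : ℝ) - N * y i) + (1 / 2 - y i)) := by
    intro k
    simp only [cellCenter, Pi.sub_apply]
    field_simp
    push_cast
    ring
  simp only [e]
  rw [multinomialMean_mul, multinomialMean_add, multinomialMean_centered hy,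
    multinomialMean_const hy]
  ring

theorem norm_cellCenter_sub_le {y : Fin d → ℝ} (hy : y ∈ simplex d) {N : ℕ} {k : Fin d → ℕ}
    (hk : k ∈ latticePoints d N) : ‖cellCenter (N + 1) k - y‖ ≤ 2 := by
  have h1 := norm_sub_le_latticeDist y (cellCenter_mem_cell (m := N + 1) (by omega) k)
  have h2 := latticeDist_le_one hy hk
  have h3 : 1 / ((N + 1 : ℕ) : ℝ) ≤ 1 := by
    rw [div_le_one (by positivity)]
    push_cast
    linarith [(N.cast_nonneg : (0 : ℝ) ≤ N)]
  linarith

theorem SimplexTaylor.abs_fderiv_le (h : SimplexTaylor f g M) {y : Fin d → ℝ} (hy : y ∈ simplex d)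
    (v : Fin d → ℝ) : |fderiv ℝ g y v| ≤ M * ‖v‖ :=
  ((fderiv ℝ g y).le_opNorm v).trans
    (mul_le_mul_of_nonneg_right (h.norm_fderiv_le y hy) (norm_nonneg v))

theorem SimplexTaylor.abs_fderiv_fderiv_le (h : SimplexTaylor f g M) {y : Fin d → ℝ}
    (hy : y ∈ simplex d) (v w : Fin d → ℝ) :
    |fderiv ℝ (fderiv ℝ g) y v w| ≤ M * ‖v‖ * ‖w‖ := by
  refine (ContinuousLinearMap.le_opNorm₂ (fderiv ℝ (fderiv ℝ g) y) v w).trans ?_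
  gcongr
  exact h.norm_fderiv_fderiv_le y hy

theorem SimplexTaylor.pderiv_pderiv_eq (h : SimplexTaylor f g M) {y : Fin d → ℝ}
    (hy : y ∈ simplex d) (i j : Fin d) :
    pderiv i (pderiv j g) y = fderiv ℝ (fderiv ℝ g) y (Pi.single i 1) (Pi.single j 1) := by
  have := ((h.differentiableAt_fderiv y hy).hasFDerivAt.clm_apply
    (hasFDerivAt_const (Pi.single j (1 : ℝ)) y)).fderiv
  change fderiv ℝ (fun y => fderiv ℝ g y (Pi.single j 1)) y (Pi.single i 1) = _
  rw [this]
  simp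

theorem SimplexTaylor.abs_pderiv_pderiv_le (h : SimplexTaylor f g M) {y : Fin d → ℝ}
    (hy : y ∈ simplex d) (i j : Fin d) : |pderiv i (pderiv j g) y| ≤ M := by
  have h2 : ∀ i : Fin d, ‖(Pi.single i (1 : ℝ) : Fin d → ℝ)‖ ≤ 1 := fun i => by
    refine (pi_norm_le_iff_of_nonneg zero_le_one).2 fun j => ?_
    by_cases hj : j = i
    · subst hj; simp
    · simp [hj]
  rw [h.pderiv_pderiv_eq hy]
  refine (h.abs_fderiv_fderiv_le hy _ _).trans ?_
  have hM := h.nonneg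
  calc M * ‖(Pi.single i (1 : ℝ) : Fin d → ℝ)‖ * ‖(Pi.single j (1 : ℝ) : Fin d → ℝ)‖
      ≤ M * 1 * 1 := by gcongr <;> exact h2 _
    _ = M := by ring

/-- First-order expansion of the mean of the cell averages, with an error that is `O(m⁻²)` near
the vertex `0`. -/
theorem SimplexTaylor.abs_mean_cellMean_sub_first_order (h : SimplexTaylor f g M)
    {y : Fin d → ℝ} (hy : y ∈ simplex d) (N : ℕ) :
    |multinomialMean N y (cellMean (N + 1) f)
        - (f y + (∑ i, (1 / 2 - y i) * pderiv i g y) / ((N + 1 : ℕ) : ℝ))|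
      ≤ M * (2 * ((∑ i, y i) / ((N + 1 : ℕ) : ℝ)) + 2 * (1 / ((N + 1 : ℕ) : ℝ)) ^ 2)
        + 4 * M * 2 ^ d * ((1 + ∑ i, y i) / 2) ^ N := by
  have hM := h.nonneg
  have e : multinomialMean N y (cellMean (N + 1) f)
        - (f y + (∑ i, (1 / 2 - y i) * pderiv i g y) / ((N + 1 : ℕ) : ℝ))
      = multinomialMean N y (fun k => cellMean (N + 1) f k
        - (f y + fderiv ℝ g y (cellCenter (N + 1) k - y))) := by
    rw [multinomialMean_sub, multinomialMean_add, multinomialMean_const hy,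
      multinomialMean_cellCenter hy]
  rw [e]
  refine (abs_multinomialMean_le hy N _).trans ?_
  -- The trivial bound adds `M` for the cell average, `M` for `f y` and `2 M` for the linear term,
  -- the centre being at distance at most two from `y`.
  have h1 := multinomialMean_le_of_inner hy N (C := 4 * M)
    (u := fun k => |cellMean (N + 1) f k - (f y + fderiv ℝ g y (cellCenter (N + 1) k - y))|)
    (b := fun k => M * (2 * latticeDist (N + 1) y k ^ 2 + 2 * (1 / ((N + 1 : ℕ) : ℝ)) ^ 2))
    (by positivity) ?_ ?_ ?_
  · refine h1.trans ?_
    rw [multinomialMean_mul, multinomialMean_add, multinomialMean_mul, multinomialMean_const hy]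
    gcongr
    exact multinomialMean_latticeDist_sq_le hy N
  · intro k hk hin
    rw [← cellMean_clm (m := N + 1) (by omega) k (f y) (fderiv ℝ g y) y,
      ← cellMean_sub h.integrable.integrableOn
        (continuous_integrableOn_cell _ _ (by fun_prop))]
    refine abs_cellMean_le (by omega) fun z hz => ?_
    refine (h.taylor_one y hy z (cell_subset_simplex (by omega) hin hz)).trans ?_
    gcongr
    have h2 := norm_sub_le_latticeDist y hz
    calc ‖z - y‖ ^ 2 ≤ (latticeDist (N + 1) y k + 1 / ((N + 1 : ℕ) : ℝ)) ^ 2 := by gcongr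
      _ ≤ _ := by nlinarith [sq_nonneg (latticeDist (N + 1) y k - 1 / ((N + 1 : ℕ) : ℝ))]
  · intro k hk
    have h2 := abs_le.1 (abs_cellMean_le (m := N + 1) (k := k) (by omega) (fun z _ => h.bounded z))
    have h3 := abs_le.1 (h.bounded y)
    have h4 := abs_le.1 (h.abs_fderiv_le hy (cellCenter (N + 1) k - y))
    have h5 : M * ‖cellCenter (N + 1) k - y‖ ≤ M * 2 := by
      gcongr
      exact norm_cellCenter_sub_le hy hk
    rw [abs_le]
    constructor <;> linarith
  · intro k hk
    positivity

/-- Polarisation of a quadratic form. It allows the quadratic Taylor term to be evaluated at the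
lattice point instead of at each point of the cell. -/
theorem SimplexTaylor.abs_second_order_le (h : SimplexTaylor f g M) {y : Fin d → ℝ}
    (hy : y ∈ simplex d) (v w : Fin d → ℝ) :
    |fderiv ℝ (fderiv ℝ g) y v v - fderiv ℝ (fderiv ℝ g) y w w|
      ≤ M * ‖v - w‖ * (‖v‖ + ‖w‖) := by
  have e : fderiv ℝ (fderiv ℝ g) y v v - fderiv ℝ (fderiv ℝ g) y w w
      = fderiv ℝ (fderiv ℝ g) y (v - w) v + fderiv ℝ (fderiv ℝ g) y w (v - w) := by
    simp only [map_sub, sub_apply]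
    ring
  rw [e]
  refine (abs_add_le _ _).trans ?_
  have h1 := h.abs_fderiv_fderiv_le hy (v - w) v
  have h2 := h.abs_fderiv_fderiv_le hy w (v - w)
  linarith

/-- With `c` the covariance coefficient and `p = y i * y j`, the exact second moment gives `(N c +
p)/m² - c/m = (p - c)/m²`, so the error is explicit and of order `m⁻²`. -/
theorem SimplexTaylor.mean_second_order (h : SimplexTaylor f g M) {y : Fin d → ℝ}
    (hy : y ∈ simplex d) (N : ℕ) :
    |multinomialMean N y (fun k => 1 / 2 * fderiv ℝ (fderiv ℝ g) y
        ((fun i => (k i : ℝ) / ((N + 1 : ℕ) : ℝ)) - y)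
        ((fun i => (k i : ℝ) / ((N + 1 : ℕ) : ℝ)) - y))
      - 1 / 2 * (∑ i, ∑ j, ((if i = j then y i else 0) - y i * y j) * pderiv i (pderiv j g) y)
        / ((N + 1 : ℕ) : ℝ)|
      ≤ d ^ 2 * M * (1 / ((N + 1 : ℕ) : ℝ)) ^ 2 := by
  have hm : ((N + 1 : ℕ) : ℝ) ≠ 0 := by positivity
  simp only [fderiv_fderiv_apply_eq_sum_pderiv (h.differentiableAt_fderiv y hy), Pi.sub_apply]
  have e : multinomialMean N y (fun k => 1 / 2 * ∑ i, ∑ j, pderiv i (pderiv j g) y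
        * (((k i : ℝ) / ((N + 1 : ℕ) : ℝ) - y i) * ((k j : ℝ) / ((N + 1 : ℕ) : ℝ) - y j)))
      - 1 / 2 * (∑ i, ∑ j, ((if i = j then y i else 0) - y i * y j) * pderiv i (pderiv j g) y)
        / ((N + 1 : ℕ) : ℝ)
      = ∑ i, ∑ j, 1 / 2 * pderiv i (pderiv j g) y
        * (y i * y j - ((if i = j then y i else 0) - y i * y j)) * (1 / ((N + 1 : ℕ) : ℝ)) ^ 2 := by
    rw [multinomialMean_mul, multinomialMean_sum, mul_div_assoc, Finset.sum_div, ← mul_sub,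
      ← Finset.sum_sub_distrib, Finset.mul_sum]
    refine Finset.sum_congr rfl fun i _ => ?_
    rw [multinomialMean_sum, Finset.sum_div, ← Finset.sum_sub_distrib, Finset.mul_sum]
    refine Finset.sum_congr rfl fun j _ => ?_
    rw [multinomialMean_mul, multinomialMean_scaled_mul hy]
    field_simp
    push_cast
    ring
  rw [e]
  have hb : ∀ i j : Fin d, |1 / 2 * pderiv i (pderiv j g) y
        * (y i * y j - ((if i = j then y i else 0) - y i * y j)) * (1 / ((N + 1 : ℕ) : ℝ)) ^ 2|
        ≤ M * (1 / ((N + 1 : ℕ) : ℝ)) ^ 2 := by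
    intro i j
    have hi0 := simplex_nonneg hy i
    have hi1 := simplex_le_one hy i
    have hj0 := simplex_nonneg hy j
    have hj1 := simplex_le_one hy j
    have hp0 : 0 ≤ y i * y j := mul_nonneg hi0 hj0
    have hp1 : y i * y j ≤ 1 := mul_le_one₀ hi1 hj0 hj1
    have h1 : |y i * y j - ((if i = j then y i else 0) - y i * y j)| ≤ 2 := by
      rw [abs_le]
      split_ifs <;> constructor <;> linarith
    rw [abs_mul, abs_mul, abs_mul, abs_of_nonneg (sq_nonneg (1 / ((N + 1 : ℕ) : ℝ)))]
    gcongr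
    calc |(1 / 2 : ℝ)| * |pderiv i (pderiv j g) y|
          * |y i * y j - ((if i = j then y i else 0) - y i * y j)|
        ≤ (1 / 2) * M * 2 := by
          have := h.abs_pderiv_pderiv_le hy i j
          have hM := h.nonneg
          gcongr
          rw [abs_of_pos (by norm_num)]
      _ = M := by ring
  refine (Finset.abs_sum_le_sum_abs _ _).trans ?_
  calc ∑ i, |∑ j, 1 / 2 * pderiv i (pderiv j g) y
        * (y i * y j - ((if i = j then y i else 0) - y i * y j)) * (1 / ((N + 1 : ℕ) : ℝ)) ^ 2|
      ≤ ∑ _i : Fin d, ∑ _j : Fin d, M * (1 / ((N + 1 : ℕ) : ℝ)) ^ 2 :=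
        Finset.sum_le_sum fun i _ => (Finset.abs_sum_le_sum_abs _ _).trans
          (Finset.sum_le_sum fun j _ => hb i j)
    _ = _ := by
      simp only [Finset.sum_const, Finset.card_univ, Fintype.card_fin, nsmul_eq_mul]
      ring

/-- With `τ = 1/m` and `a` the lattice distance, the error in an inner cell is `ε r² + K r⁴`, `r ≤ a
+ τ`, plus a cross term `M a τ` from moving the quadratic term to the lattice point. The means of
`a²` and `a⁴` are at most `τ` and `32 d τ²`. The `5 ε` is `2 ε` from `a²`, `2 ε` from `τ²` and `ε`
from the cross term. -/
theorem SimplexTaylor.abs_mean_cellMean_sub_second_order (h : SimplexTaylor f g M) {ε : ℝ}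
    (hε : 0 < ε) : ∃ C : ℝ, 0 ≤ C ∧ ∀ N : ℕ, ∀ y ∈ simplex d,
    |multinomialMean N y (cellMean (N + 1) f) - f y - fullBiasConst g y / ((N + 1 : ℕ) : ℝ)|
      ≤ 5 * ε * (1 / ((N + 1 : ℕ) : ℝ)) + C * (1 / ((N + 1 : ℕ) : ℝ)) ^ 2
        + 5 * M * 2 ^ d * ((1 + ∑ i, y i) / 2) ^ N := by
  have hM := h.nonneg
  obtain ⟨K, hK, hT⟩ := h.taylor_two ε hε
  refine ⟨256 * d * K + 8 * K + M ^ 2 / ε + M + d ^ 2 * M, by positivity, fun N y hy => ?_⟩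
  have hm : (0 : ℝ) < ((N + 1 : ℕ) : ℝ) := by positivity
  obtain ⟨τ, hτ⟩ : ∃ τ : ℝ, τ = 1 / ((N + 1 : ℕ) : ℝ) := ⟨_, rfl⟩
  have hτ0 : 0 < τ := by rw [hτ]; positivity
  have hτ1 : τ ≤ 1 := by
    rw [hτ, div_le_one hm]
    push_cast
    linarith [(N.cast_nonneg : (0 : ℝ) ≤ N)]
  set Q : (Fin d → ℕ) → ℝ := fun k => 1 / 2 * fderiv ℝ (fderiv ℝ g) y
        ((fun i => (k i : ℝ) / ((N + 1 : ℕ) : ℝ)) - y)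
        ((fun i => (k i : ℝ) / ((N + 1 : ℕ) : ℝ)) - y) with hQ
  have hQmean := h.mean_second_order hy N
  have hpw : multinomialMean N y (fun k => |cellMean (N + 1) f k
        - (f y + fderiv ℝ g y (cellCenter (N + 1) k - y) + Q k)|)
      ≤ 5 * ε * τ + (256 * d * K + 8 * K + M ^ 2 / ε + M) * τ ^ 2
        + 5 * M * 2 ^ d * ((1 + ∑ i, y i) / 2) ^ N := by
    have h1 := multinomialMean_le_of_inner hy N (C := 5 * M)
      (u := fun k => |cellMean (N + 1) f k
        - (f y + fderiv ℝ g y (cellCenter (N + 1) k - y) + Q k)|)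
      (b := fun k => ((2 * ε + M ^ 2 / ε * τ) * latticeDist (N + 1) y k ^ 2
        + (8 * K * latticeDist (N + 1) y k ^ 4 + (2 * ε * τ ^ 2 + 8 * K * τ ^ 4 + ε * τ
          + M * τ ^ 2))))
      (by positivity) ?_ ?_ ?_
    · refine h1.trans ?_
      rw [multinomialMean_add, multinomialMean_add, multinomialMean_mul, multinomialMean_mul,
        multinomialMean_const hy]
      have h2 : multinomialMean N y (fun k => latticeDist (N + 1) y k ^ 2) ≤ τ := by
        refine (multinomialMean_latticeDist_sq_le hy N).trans ?_
        rw [hτ]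
        gcongr
        exact simplex_sum_le hy
      have h4 : multinomialMean N y (fun k => latticeDist (N + 1) y k ^ 4) ≤ 32 * d * τ ^ 2 := by
        refine (multinomialMean_latticeDist_pow_four_le hy N).trans_eq ?_
        rw [hτ]
        ring
      have h5 : (2 * ε + M ^ 2 / ε * τ) * multinomialMean N y (fun k => latticeDist (N + 1) y k ^ 2)
          ≤ (2 * ε + M ^ 2 / ε * τ) * τ := by gcongr
      have h6 : 8 * K * multinomialMean N y (fun k => latticeDist (N + 1) y k ^ 4)
          ≤ 8 * K * (32 * d * τ ^ 2) := by gcongr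
      have h7 : 8 * K * τ ^ 4 ≤ 8 * K * τ ^ 2 :=
        mul_le_mul_of_nonneg_left (pow_le_pow_of_le_one hτ0.le hτ1 (by norm_num)) (by positivity)
      have h8 : 2 * ε * τ ^ 2 ≤ 2 * ε * τ := by
        refine mul_le_mul_of_nonneg_left ?_ (by positivity)
        nlinarith
      linarith
    · intro k hk hin
      have e : f y + fderiv ℝ g y (cellCenter (N + 1) k - y) + Q k
          = (f y + Q k) + fderiv ℝ g y (cellCenter (N + 1) k - y) := by ring
      rw [e, ← cellMean_clm (m := N + 1) (by omega) k (f y + Q k) (fderiv ℝ g y) y,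
        ← cellMean_sub h.integrable.integrableOn
          (continuous_integrableOn_cell _ _ (by fun_prop))]
      refine abs_cellMean_le (by omega) fun z hz => ?_
      set a := latticeDist (N + 1) y k with ha
      have ha0 : 0 ≤ a := latticeDist_nonneg _ _ _
      have hzy : ‖z - y‖ ≤ a + τ := by rw [hτ]; exact norm_sub_le_latticeDist y hz
      have hzq : ‖z - fun i => (k i : ℝ) / ((N + 1 : ℕ) : ℝ)‖ ≤ τ := by
        rw [hτ]; exact norm_sub_le_of_mem_cell hz
      have t1 := hT y hy z (cell_subset_simplex (by omega) hin hz)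
      have t2 := h.abs_second_order_le hy (z - y) ((fun i => (k i : ℝ) / ((N + 1 : ℕ) : ℝ)) - y)
      rw [sub_sub_sub_cancel_right] at t2
      have t3 : ε * ‖z - y‖ ^ 2 + K * ‖z - y‖ ^ 4 ≤ ε * (2 * a ^ 2 + 2 * τ ^ 2)
          + K * (8 * a ^ 4 + 8 * τ ^ 4) := by
        have s2 : ‖z - y‖ ^ 2 ≤ 2 * a ^ 2 + 2 * τ ^ 2 := by
          calc ‖z - y‖ ^ 2 ≤ (a + τ) ^ 2 := by gcongr
            _ ≤ _ := by nlinarith [sq_nonneg (a - τ)]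
        have s4 : ‖z - y‖ ^ 4 ≤ 8 * a ^ 4 + 8 * τ ^ 4 := by
          calc ‖z - y‖ ^ 4 = (‖z - y‖ ^ 2) ^ 2 := by ring
            _ ≤ (2 * a ^ 2 + 2 * τ ^ 2) ^ 2 := by gcongr
            _ ≤ _ := by nlinarith [sq_nonneg (a ^ 2 - τ ^ 2)]
        gcongr
      have t4 : M * ‖z - fun i => (k i : ℝ) / ((N + 1 : ℕ) : ℝ)‖
          * (‖z - y‖ + ‖(fun i => (k i : ℝ) / ((N + 1 : ℕ) : ℝ)) - y‖)
          ≤ M * τ * ((a + τ) + a) := by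
        gcongr
        exact le_rfl
      -- The mean of `a` is only `O(√τ)`, so `M a τ` would be too large to be `O(τ²)`; it is split
      -- into a small multiple of `τ` and a term with `a² τ`.
      have t5 : M * a ≤ ε + M ^ 2 / ε * a ^ 2 := by
        have : M ^ 2 / ε * a ^ 2 = (M * a) ^ 2 / ε := by ring
        rw [this, ← sub_nonneg]
        have e2 : ε + (M * a) ^ 2 / ε - M * a
            = ((ε - M * a / 2) ^ 2 + 3 / 4 * (M * a) ^ 2) / ε := by
          field_simp
          ring
        rw [e2]
        positivity
      have t6 : M * a * τ ≤ (ε + M ^ 2 / ε * a ^ 2) * τ := by gcongr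
      have t1' := abs_le.1 t1
      have t2' := abs_le.1 (t2.trans t4)
      have hM2 : 0 ≤ M * τ ^ 2 := by positivity
      rw [abs_le]
      simp only [hQ]
      constructor <;> linarith
    · intro k hk
      have b1 := abs_le.1 (abs_cellMean_le (m := N + 1) (k := k) (by omega)
        (fun z _ => h.bounded z))
      have b2 := abs_le.1 (h.bounded y)
      have b3 := abs_le.1 (h.abs_fderiv_le hy (cellCenter (N + 1) k - y))
      have b4 : M * ‖cellCenter (N + 1) k - y‖ ≤ M * 2 := by
        gcongr
        exact norm_cellCenter_sub_le hy hk
      have b5 := abs_le.1 (h.abs_fderiv_fderiv_le hy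
        ((fun i => (k i : ℝ) / ((N + 1 : ℕ) : ℝ)) - y) ((fun i => (k i : ℝ) / ((N + 1 : ℕ) : ℝ)) - y))
      have b6 : M * ‖(fun i => (k i : ℝ) / ((N + 1 : ℕ) : ℝ)) - y‖
          * ‖(fun i => (k i : ℝ) / ((N + 1 : ℕ) : ℝ)) - y‖ ≤ M * 1 * 1 := by
        have := latticeDist_le_one hy hk
        unfold latticeDist at this
        gcongr
      rw [abs_le]
      simp only [hQ]
      constructor <;> linarith
    · intro k hk
      positivity
  have e : multinomialMean N y (cellMean (N + 1) f) - f y - fullBiasConst g y / ((N + 1 : ℕ) : ℝ)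
      = multinomialMean N y (fun k => cellMean (N + 1) f k
        - (f y + fderiv ℝ g y (cellCenter (N + 1) k - y) + Q k))
        + (multinomialMean N y Q - 1 / 2 * (∑ i, ∑ j, ((if i = j then y i else 0) - y i * y j)
          * pderiv i (pderiv j g) y) / ((N + 1 : ℕ) : ℝ)) := by
    rw [multinomialMean_sub, multinomialMean_add, multinomialMean_add, multinomialMean_const hy,
      multinomialMean_cellCenter hy, fullBiasConst]
    ring
  rw [e, ← hτ]
  rw [← hτ] at hQmean
  have hA := (abs_multinomialMean_le hy N _).trans hpw
  refine (abs_add_le _ _).trans ?_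
  linarith

theorem eventually_const_mul_pow_le {r : ℝ} (hr0 : 0 < r) (hr1 : r < 1) (C : ℝ) (p : ℕ) {η : ℝ}
    (hη : 0 < η) : ∀ᶠ N : ℕ in atTop, C * r ^ N ≤ η * (1 / ((N + 1 : ℕ) : ℝ)) ^ p := by
  have h := ((tendsto_pow_const_mul_const_pow_of_lt_one p hr0.le hr1).comp
    (tendsto_add_atTop_nat 1)).const_mul (C / r)
  rw [mul_zero] at h
  filter_upwards [h.eventually_le_const hη] with N hN
  have hm : (0 : ℝ) < ((N + 1 : ℕ) : ℝ) := by positivity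
  rw [div_pow, one_pow, mul_one_div, le_div_iff₀ (by positivity)]
  refine le_trans (le_of_eq ?_) hN
  simp only [Function.comp]
  rw [pow_succ]
  field_simp

/-- Uniform expansion of the bias away from the face `∑ x_i = 1`. -/
theorem SimplexTaylor.eventually_abs_bias_sub_le (h : SimplexTaylor f g M) {δ η : ℝ} (hδ : 0 < δ)
    (hη : 0 < η) : ∀ᶠ N : ℕ in atTop, ∀ y ∈ simplex d, ∑ i, y i ≤ 1 - δ →
    |multinomialMean N y (cellMean (N + 1) f) - f y - fullBiasConst g y / ((N + 1 : ℕ) : ℝ)|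
      ≤ η / ((N + 1 : ℕ) : ℝ) := by
  obtain ⟨C, hC, hmain⟩ := h.abs_mean_cellMean_sub_second_order (ε := η / 15) (by positivity)
  have hM := h.nonneg
  -- This bounds `(1 + ∑ y i)/2`; the minimum with one keeps `r` positive.
  set r := 1 - min δ 1 / 2 with hr
  have hmin : 0 < min δ 1 := lt_min hδ one_pos
  have hmin1 : min δ 1 ≤ 1 := min_le_right _ _
  have h1 := eventually_const_mul_pow_le (r := r) (by linarith) (by linarith) (5 * M * 2 ^ d) 1
    (η := η / 3) (by positivity)
  have h2 : ∀ᶠ N : ℕ in atTop, C / ((N + 1 : ℕ) : ℝ) ≤ η / 3 :=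
    (tendsto_div_succ C).eventually_le_const (by positivity)
  filter_upwards [h1, h2] with N hN1 hN2 y hy hyδ
  refine (hmain N y hy).trans ?_
  have hm : (0 : ℝ) < ((N + 1 : ℕ) : ℝ) := by positivity
  have h3 : 5 * M * 2 ^ d * ((1 + ∑ i, y i) / 2) ^ N ≤ 5 * M * 2 ^ d * r ^ N := by
    have h0 : 0 ≤ ∑ i, y i := Finset.sum_nonneg fun i _ => simplex_nonneg hy i
    gcongr
    have := min_le_left δ 1
    linarith
  have h4 : C * (1 / ((N + 1 : ℕ) : ℝ)) ^ 2 ≤ η / 3 * (1 / ((N + 1 : ℕ) : ℝ)) := by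
    have : C * (1 / ((N + 1 : ℕ) : ℝ)) ^ 2
        = C / ((N + 1 : ℕ) : ℝ) * (1 / ((N + 1 : ℕ) : ℝ)) := by ring
    rw [this]
    gcongr
  rw [pow_one] at hN1
  have h5 : η / ((N + 1 : ℕ) : ℝ) = 5 * (η / 15) * (1 / ((N + 1 : ℕ) : ℝ))
      + η / 3 * (1 / ((N + 1 : ℕ) : ℝ)) + η / 3 * (1 / ((N + 1 : ℕ) : ℝ)) := by ring
  rw [h5]
  linarith

end BiasExpansion

/-! ### The variance -/

/-- The variance of the estimator with `m = N + 1`, multiplied by the sample size. -/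
noncomputable def scaledVar {d : ℕ} (f : (Fin d → ℝ) → ℝ) (N : ℕ) (y : Fin d → ℝ) : ℝ :=
  ((N + 1 : ℕ) : ℝ) ^ d
      * ∑ k ∈ latticePoints d N, multinomialProb N k y ^ 2 * cellMean (N + 1) f k
    - multinomialMean N y (cellMean (N + 1) f) ^ 2

section Variance

variable {d : ℕ} {f g : (Fin d → ℝ) → ℝ} {M : ℝ} {J : Finset (Fin d)} {lam x : Fin d → ℝ}

theorem norm_nearPoint_sub_facePoint_le (hlam : ∀ i ∈ J, 0 ≤ lam i) (x : Fin d → ℝ) (m : ℕ) :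
    ‖nearPoint J lam x m - facePoint J x‖ ≤ (∑ i ∈ J, lam i) / m := by
  have h0 : 0 ≤ ∑ i ∈ J, lam i := Finset.sum_nonneg hlam
  refine (pi_norm_le_iff_of_nonneg (by positivity)).2 fun i => ?_
  simp only [Pi.sub_apply, nearPoint, facePoint]
  split_ifs with hi
  · rw [sub_zero, Real.norm_of_nonneg (div_nonneg (hlam i hi) m.cast_nonneg)]
    gcongr
    exact Finset.single_le_sum hlam hi
  · simp only [sub_self, norm_zero]
    positivity

/-- Cauchy–Schwarz in linear form: `a ≤ s a²/2 + 1/(2 s)` with `s = √m`, followed by the second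
moment. -/
theorem multinomialMean_latticeDist_le {y : Fin d → ℝ} (hy : y ∈ simplex d) (N : ℕ) :
    multinomialMean N y (fun k => latticeDist (N + 1) y k) ≤ 1 / √((N + 1 : ℕ) : ℝ) := by
  have hm : (0 : ℝ) < ((N + 1 : ℕ) : ℝ) := by positivity
  obtain ⟨s, hs⟩ : ∃ s : ℝ, s = √((N + 1 : ℕ) : ℝ) := ⟨_, rfl⟩
  have hs0 : 0 < s := by rw [hs]; exact Real.sqrt_pos.2 hm
  have hs2 : s ^ 2 = ((N + 1 : ℕ) : ℝ) := by rw [hs]; exact Real.sq_sqrt hm.le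
  rw [← hs]
  have h : ∀ k ∈ latticePoints d N, latticeDist (N + 1) y k
      ≤ s / 2 * latticeDist (N + 1) y k ^ 2 + 1 / (2 * s) := by
    intro k _
    rw [← sub_nonneg]
    have e : s / 2 * latticeDist (N + 1) y k ^ 2 + 1 / (2 * s) - latticeDist (N + 1) y k
        = (s * latticeDist (N + 1) y k - 1) ^ 2 / (2 * s) := by
      field_simp
      ring
    rw [e]
    positivity
  refine (multinomialMean_mono hy N h).trans ?_
  rw [multinomialMean_add, multinomialMean_mul, multinomialMean_const hy]
  have h2 : multinomialMean N y (fun k => latticeDist (N + 1) y k ^ 2) ≤ 1 / s ^ 2 := by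
    rw [hs2]
    refine (multinomialMean_latticeDist_sq_le hy N).trans ?_
    gcongr
    exact simplex_sum_le hy
  calc _ ≤ s / 2 * (1 / s ^ 2) + 1 / (2 * s) := by gcongr
    _ = _ := by field_simp; ring

/-- Triangle inequality and first moments. At `y = λ/m` this is `O(1/m)`, better than the general
`1/√m`. -/
theorem multinomialMean_latticeDist_le_two_mul {y : Fin d → ℝ} (hy : y ∈ simplex d) (N : ℕ) :
    multinomialMean N y (fun k => latticeDist (N + 1) y k) ≤ 2 * ∑ i, y i := by
  have hm : (0 : ℝ) < ((N + 1 : ℕ) : ℝ) := by positivity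
  have h : ∀ k ∈ latticePoints d N, latticeDist (N + 1) y k
      ≤ ∑ i, (1 / ((N + 1 : ℕ) : ℝ) * (k i : ℝ) + y i) := by
    intro k _
    have h1 := latticeDist_pow_le (N + 1) y k one_ne_zero
    simp only [pow_one] at h1
    refine h1.trans (Finset.sum_le_sum fun i _ => ?_)
    refine (abs_sub _ _).trans_eq ?_
    rw [abs_of_nonneg (simplex_nonneg hy i), abs_of_nonneg (by positivity)]
    ring
  refine (multinomialMean_mono hy N h).trans ?_
  rw [multinomialMean_sum, Finset.mul_sum]
  refine Finset.sum_le_sum fun i _ => ?_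
  rw [multinomialMean_add, multinomialMean_mul, multinomialMean_const hy,
    multinomialMean_coord hy]
  have h0 := simplex_nonneg hy i
  have h1 : 1 / ((N + 1 : ℕ) : ℝ) * (N * y i) ≤ y i := by
    rw [one_div, inv_mul_le_iff₀ hm]
    gcongr
    linarith
  linarith

/-- The exponents satisfy `(d + |J|)/2 + (d - |J|)/2 = d`. This is how the cell volume `m^{-d}` and
the local limit scale `m^{-(d-|J|)/2}` combine into the variance order `m^{q/2}`. -/
theorem rpow_mul_sqrt_pow (J : Finset (Fin d)) (N : ℕ) :
    ((N + 1 : ℕ) : ℝ) ^ (((d : ℝ) + J.card) / 2) * √((N + 1 : ℕ) : ℝ) ^ Jᶜ.card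
      = ((N + 1 : ℕ) : ℝ) ^ d := by
  have hm : (0 : ℝ) < ((N + 1 : ℕ) : ℝ) := by positivity
  have hc : J.card + Jᶜ.card = d := by rw [Finset.card_add_card_compl, Fintype.card_fin]
  have hc' : (J.card : ℝ) + Jᶜ.card = d := by exact_mod_cast hc
  rw [Real.sqrt_eq_rpow, ← Real.rpow_natCast (_ ^ _), ← Real.rpow_mul hm.le, ← Real.rpow_add hm,
    ← Real.rpow_natCast _ d]
  congr 1
  linarith

theorem scaledVar_div_rpow (f : (Fin d → ℝ) → ℝ) (J : Finset (Fin d)) (N : ℕ) (y : Fin d → ℝ) :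
    scaledVar f N y / ((N + 1 : ℕ) : ℝ) ^ (((d : ℝ) + J.card) / 2)
      = √((N + 1 : ℕ) : ℝ) ^ Jᶜ.card
          * ∑ k ∈ latticePoints d N, multinomialProb N k y ^ 2 * cellMean (N + 1) f k
        - multinomialMean N y (cellMean (N + 1) f) ^ 2
          / ((N + 1 : ℕ) : ℝ) ^ (((d : ℝ) + J.card) / 2) := by
  have hm : (0 : ℝ) < ((N + 1 : ℕ) : ℝ) := by positivity
  have hp : 0 < ((N + 1 : ℕ) : ℝ) ^ (((d : ℝ) + J.card) / 2) := Real.rpow_pos_of_pos hm _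
  rw [scaledVar, sub_div, ← rpow_mul_sqrt_pow J N, mul_assoc, mul_div_cancel_left₀ _ hp.ne']

theorem SimplexTaylor.abs_mean_cellMean_le (h : SimplexTaylor f g M) {y : Fin d → ℝ}
    (hy : y ∈ simplex d) (N : ℕ) : |multinomialMean N y (cellMean (N + 1) f)| ≤ M := by
  refine (abs_multinomialMean_le hy N _).trans ?_
  rw [← multinomialMean_const hy N M]
  exact multinomialMean_mono hy N fun k _ => abs_cellMean_le (by omega) fun z _ => h.bounded z

/-- Replacing the cell averages by a constant in the sum of the squared probabilities. -/
theorem abs_sum_sq_mul_sub_le {y : Fin d → ℝ} (hy : y ∈ simplex d) (N : ℕ)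
    (u : (Fin d → ℕ) → ℝ) (c : ℝ) {K s : ℝ} (hs : 0 ≤ s)
    (hK : ∀ k ∈ latticePoints d N, s * multinomialProb N k y ≤ K) :
    |s * ∑ k ∈ latticePoints d N, multinomialProb N k y ^ 2 * u k
        - c * (s * ∑ k ∈ latticePoints d N, multinomialProb N k y ^ 2)|
      ≤ K * multinomialMean N y (fun k => |u k - c|) := by
  have e : s * ∑ k ∈ latticePoints d N, multinomialProb N k y ^ 2 * u k
        - c * (s * ∑ k ∈ latticePoints d N, multinomialProb N k y ^ 2)
      = ∑ k ∈ latticePoints d N, s * multinomialProb N k y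
        * (multinomialProb N k y * (u k - c)) := by
    rw [mul_left_comm, ← mul_sub, Finset.mul_sum, ← Finset.sum_sub_distrib, Finset.mul_sum]
    exact Finset.sum_congr rfl fun k _ => by ring
  rw [e, multinomialMean, Finset.mul_sum]
  refine (Finset.abs_sum_le_sum_abs _ _).trans (Finset.sum_le_sum fun k hk => ?_)
  have hP := multinomialProb_nonneg hy N k
  rw [abs_mul, abs_of_nonneg (mul_nonneg hs hP), abs_mul, abs_of_nonneg hP, smul_eq_mul]
  have := hK k hk
  gcongr

theorem SimplexTaylor.mean_abs_cellMean_sub_face_le (h : SimplexTaylor f g M)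
    (hlam : ∀ i ∈ J, 0 ≤ lam i) (hx : x ∈ admissible J) {N : ℕ}
    (hy : nearPoint J lam x (N + 1) ∈ simplex d) :
    multinomialMean N (nearPoint J lam x (N + 1))
        (fun k => |cellMean (N + 1) f k - f (facePoint J x)|)
      ≤ multinomialMean N (nearPoint J lam x (N + 1))
          (fun k => |cellMean (N + 1) f k - f (nearPoint J lam x (N + 1))|)
        + M * ((∑ i ∈ J, lam i) / ((N + 1 : ℕ) : ℝ)) := by
  have h1 := h.lipschitz _ (facePoint_mem_simplex hx) _ hy
  have h2 := norm_nearPoint_sub_facePoint_le hlam x (N + 1)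
  have hM := h.nonneg
  have h3 : |f (nearPoint J lam x (N + 1)) - f (facePoint J x)|
      ≤ M * ((∑ i ∈ J, lam i) / ((N + 1 : ℕ) : ℝ)) := by
    refine h1.trans ?_
    gcongr
  have h4 := multinomialMean_mono hy N
    (g := fun k => |cellMean (N + 1) f k - f (facePoint J x)|)
    (h := fun k => |cellMean (N + 1) f k - f (nearPoint J lam x (N + 1))|
      + M * ((∑ i ∈ J, lam i) / ((N + 1 : ℕ) : ℝ)))
    (fun k _ => (abs_sub_le _ (f (nearPoint J lam x (N + 1))) _).trans (by linarith))
  rwa [multinomialMean_add, multinomialMean_const hy] at h4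

/-- The leading term of the variance. -/
theorem SimplexTaylor.tendsto_scaledVar (h : SimplexTaylor f g M) (hd : 1 ≤ d)
    (hlam : ∀ i ∈ J, 0 ≤ lam i) (hx : x ∈ admissible J) :
    Tendsto (fun N : ℕ => scaledVar f N (nearPoint J lam x (N + 1))
      / ((N + 1 : ℕ) : ℝ) ^ (((d : ℝ) + J.card) / 2)) atTop (𝓝 (varConst f J lam x)) := by
  have hM := h.nonneg
  have hx0 : 0 < 1 - ∑ i ∈ Jᶜ, x i := sub_pos.2 hx.2
  have hx1 : 1 - ∑ i ∈ Jᶜ, x i ≤ 1 :=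
    sub_le_self _ (Finset.sum_nonneg fun i hi => (hx.1 i (Finset.mem_compl.1 hi)).1.le)
  have hmtop : Tendsto (fun N : ℕ => ((N + 1 : ℕ) : ℝ)) atTop atTop :=
    (tendsto_natCast_atTop_atTop (R := ℝ)).comp (tendsto_add_atTop_nat 1)
  obtain ⟨K, hK0, hK⟩ := exists_multinomialProb_le hlam hx
  have hmean : Tendsto (fun N : ℕ => multinomialMean N (nearPoint J lam x (N + 1))
      (fun k => |cellMean (N + 1) f k - f (facePoint J x)|)) atTop (𝓝 0) := by
    -- The geometric ratio arises from `∑ y i ≤ 1 - (1 - ∑ x i)/2`, which gives `(1 + ∑ y i)/2 ≤ 1 -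
    -- (1 - ∑ x i)/4`.
    have hb : Tendsto (fun N : ℕ => M * (1 / √((N + 1 : ℕ) : ℝ) + 1 / ((N + 1 : ℕ) : ℝ))
        + 2 * M * 2 ^ d * (1 - (1 - ∑ i ∈ Jᶜ, x i) / 4) ^ N
        + M * ((∑ i ∈ J, lam i) / ((N + 1 : ℕ) : ℝ))) atTop (𝓝 0) := by
      have t1 := ((tendsto_div_sqrt_succ 1).add (tendsto_div_succ 1)).const_mul M
      have t2 := (tendsto_pow_atTop_nhds_zero_of_lt_one
        (r := 1 - (1 - ∑ i ∈ Jᶜ, x i) / 4) (by linarith) (by linarith)).const_mul (2 * M * 2 ^ d)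
      have t3 := (tendsto_div_succ (∑ i ∈ J, lam i)).const_mul M
      simpa using (t1.add t2).add t3
    refine squeeze_zero' ?_ ?_ hb
    · filter_upwards [eventually_nearPoint hlam hx] with N hN
      exact Finset.sum_nonneg fun k _ =>
        mul_nonneg (multinomialProb_nonneg hN.2.1 N k) (abs_nonneg _)
    · filter_upwards [eventually_nearPoint hlam hx] with N hN
      refine (h.mean_abs_cellMean_sub_face_le hlam hx hN.2.1).trans ?_
      gcongr
      refine (h.mean_abs_cellMean_sub_le hN.2.1 N).trans ?_
      have h0 : 0 ≤ ∑ i, nearPoint J lam x (N + 1) i :=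
        Finset.sum_nonneg fun i _ => simplex_nonneg hN.2.1 i
      gcongr
      · exact multinomialMean_latticeDist_le hN.2.1 N
      · linarith [hN.2.2]
  have hsum := (tendsto_sum_multinomialProb_sq hlam hx).const_mul (f (facePoint J x))
  rw [← mul_assoc, ← varConst] at hsum
  have hdiff : Tendsto (fun N : ℕ => √((N + 1 : ℕ) : ℝ) ^ Jᶜ.card
      * ∑ k ∈ latticePoints d N, multinomialProb N k (nearPoint J lam x (N + 1)) ^ 2
        * cellMean (N + 1) f k
      - f (facePoint J x) * (√((N + 1 : ℕ) : ℝ) ^ Jᶜ.card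
        * ∑ k ∈ latticePoints d N, multinomialProb N k (nearPoint J lam x (N + 1)) ^ 2))
      atTop (𝓝 0) := by
    refine squeeze_zero_norm' ?_ (by simpa using hmean.const_mul K)
    filter_upwards [eventually_nearPoint hlam hx, hK] with N hN hKN
    exact abs_sum_sq_mul_sub_le hN.2.1 N _ _ (by positivity) hKN
  -- The squared mean is bounded by `M²`, while the variance scale has the positive exponent `(d +
  -- |J|)/2`.
  have hsq : Tendsto (fun N : ℕ => multinomialMean N (nearPoint J lam x (N + 1))
      (cellMean (N + 1) f) ^ 2 / ((N + 1 : ℕ) : ℝ) ^ (((d : ℝ) + J.card) / 2)) atTop (𝓝 0) := by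
    have hd' : (0 : ℝ) < ((d : ℝ) + J.card) / 2 := by
      have : (0 : ℝ) < d := by exact_mod_cast hd
      positivity
    have t : Tendsto (fun N : ℕ => M ^ 2 / ((N + 1 : ℕ) : ℝ) ^ (((d : ℝ) + J.card) / 2)) atTop
        (𝓝 0) := tendsto_const_nhds.div_atTop ((tendsto_rpow_atTop hd').comp hmtop)
    refine squeeze_zero' (Eventually.of_forall fun N => by positivity) ?_ t
    filter_upwards [eventually_nearPoint hlam hx] with N hN
    have := h.abs_mean_cellMean_le hN.2.1 N
    exact div_le_div_of_nonneg_right (sq_le_sq' (abs_le.1 this).1 (abs_le.1 this).2)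
      (by positivity)
  have := (hdiff.add hsum).sub hsq
  rw [zero_add, sub_zero] at this
  refine this.congr fun N => ?_
  rw [scaledVar_div_rpow]
  ring

theorem nearPoint_univ (lam x : Fin d → ℝ) (m : ℕ) :
    nearPoint Finset.univ lam x m = fun i => lam i / m := by
  ext i
  simp [nearPoint]

theorem facePoint_univ (x : Fin d → ℝ) : facePoint Finset.univ x = 0 := by
  ext i
  simp [facePoint]

theorem psi_empty (x : Fin d → ℝ) : psi ∅ x = 1 := by simp [psi]

/-- At a vertex, the variance has a relative error of order `1/m`. -/
theorem SimplexTaylor.exists_abs_scaledVar_sub_le (h : SimplexTaylor f g M) (hd : 1 ≤ d)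
    (hlam : ∀ i, 0 ≤ lam i) : ∃ C : ℝ, ∀ᶠ N : ℕ in atTop, ∀ x : Fin d → ℝ,
    |scaledVar f N (nearPoint Finset.univ lam x (N + 1))
      / ((N + 1 : ℕ) : ℝ) ^ (((d : ℝ) + (Finset.univ : Finset (Fin d)).card) / 2)
        - varConst f Finset.univ lam x| ≤ C * ((N + 1 : ℕ) : ℝ)⁻¹ := by
  have hM := h.nonneg
  set Λ := ∑ i, lam i with hΛ
  have hΛ0 : 0 ≤ Λ := Finset.sum_nonneg fun i _ => hlam i
  have hadm : ∀ x : Fin d → ℝ, x ∈ admissible (Finset.univ : Finset (Fin d)) := fun x => by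
    simp [admissible]
  set P0 := ∏ i, (Real.exp (-2 * lam i) * besselI 0 (2 * lam i)) with hP0
  refine ⟨1 * (M * (2 * Λ + 1) + 1 + M * Λ) + M * (22 * Λ ^ 2 + 4 * Λ) + M ^ 2, ?_⟩
  have h1 : ∀ᶠ N : ℕ in atTop, 4 * Λ ≤ ((N + 1 : ℕ) : ℝ) :=
    ((tendsto_natCast_atTop_atTop (R := ℝ)).comp (tendsto_add_atTop_nat 1)).eventually_ge_atTop _
  -- `5 / 8 = (1 + 1/4)/2`, since the coordinate sum `Λ/m` is at most `1/4`.
  filter_upwards [h1, eventually_const_mul_pow_le (r := 5 / 8) (by norm_num) (by norm_num)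
    (2 * M * 2 ^ d) 1 one_pos] with N hN hexp x
  have hm : (0 : ℝ) < ((N + 1 : ℕ) : ℝ) := by positivity
  have hm1 : (1 : ℝ) ≤ ((N + 1 : ℕ) : ℝ) := by
    push_cast
    linarith [(N.cast_nonneg : (0 : ℝ) ≤ N)]
  have hsum : ∑ i, nearPoint Finset.univ lam x (N + 1) i = Λ / ((N + 1 : ℕ) : ℝ) := by
    rw [nearPoint_univ, hΛ, Finset.sum_div]
  have hΛm : Λ / ((N + 1 : ℕ) : ℝ) ≤ 1 / 4 := by
    rw [div_le_iff₀ hm]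
    linarith
  have hy : nearPoint Finset.univ lam x (N + 1) ∈ simplex d := by
    refine mem_simplex_iff.2 ⟨fun i => ?_, by rw [hsum]; linarith⟩
    rw [nearPoint_univ]
    exact div_nonneg (hlam i) hm.le
  have hsq := abs_sum_multinomialProb_sq_sub_le hlam hN
  rw [← hP0, ← hΛ, ← nearPoint_univ lam x] at hsq
  -- At the vertex no direction is rescaled, so the trivial bound `P_k ≤ 1` replaces the Fourier
  -- bound on the maximal probability.
  have hP1 : ∀ k ∈ latticePoints d N,
      1 * multinomialProb N k (nearPoint Finset.univ lam x (N + 1)) ≤ 1 := by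
    intro k hk
    have h2 := multinomialMean_const hy N (1 : ℝ)
    simp only [multinomialMean, smul_eq_mul, mul_one] at h2
    rw [one_mul, ← h2]
    exact Finset.single_le_sum (f := fun k => multinomialProb N k _)
      (fun k _ => multinomialProb_nonneg hy N k) hk
  have hrep := abs_sum_sq_mul_sub_le hy N (cellMean (N + 1) f)
    (f (facePoint Finset.univ x)) zero_le_one hP1
  have hmean : multinomialMean N (nearPoint Finset.univ lam x (N + 1))
      (fun k => |cellMean (N + 1) f k - f (facePoint Finset.univ x)|)
      ≤ (M * (2 * Λ + 1) + 1 + M * Λ) * ((N + 1 : ℕ) : ℝ)⁻¹ := by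
    refine (h.mean_abs_cellMean_sub_face_le (fun i _ => hlam i) (hadm x) hy).trans ?_
    have h2 := h.mean_abs_cellMean_sub_le hy N
    have h3 := multinomialMean_latticeDist_le_two_mul hy N
    rw [hsum] at h2 h3
    have h4 : 2 * M * 2 ^ d * ((1 + Λ / ((N + 1 : ℕ) : ℝ)) / 2) ^ N
        ≤ 2 * M * 2 ^ d * (5 / 8) ^ N := by
      have : 0 ≤ Λ / ((N + 1 : ℕ) : ℝ) := by positivity
      refine mul_le_mul_of_nonneg_left (pow_le_pow_left₀ (by positivity) ?_ N) (by positivity)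
      linarith
    have h5 : M * (multinomialMean N (nearPoint Finset.univ lam x (N + 1))
        (fun k => latticeDist (N + 1) (nearPoint Finset.univ lam x (N + 1)) k)
        + 1 / ((N + 1 : ℕ) : ℝ)) ≤ M * (2 * (Λ / ((N + 1 : ℕ) : ℝ)) + 1 / ((N + 1 : ℕ) : ℝ)) := by
      gcongr
    rw [pow_one] at hexp
    have h6 : (M * (2 * Λ + 1) + 1 + M * Λ) * ((N + 1 : ℕ) : ℝ)⁻¹
        = M * (2 * (Λ / ((N + 1 : ℕ) : ℝ)) + 1 / ((N + 1 : ℕ) : ℝ))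
          + 1 * (1 / ((N + 1 : ℕ) : ℝ)) + M * (Λ / ((N + 1 : ℕ) : ℝ)) := by ring
    rw [h6]
    linarith
  have hV : varConst f Finset.univ lam x = f (facePoint Finset.univ x) * P0 := by
    simp [varConst, psi_empty, hP0]
  -- For `J = [d]` the exponent `(d + |J|)/2` is `d ≥ 1`, so the squared mean contributes at most
  -- `M²/m`.
  have hE : multinomialMean N (nearPoint Finset.univ lam x (N + 1)) (cellMean (N + 1) f) ^ 2
      / ((N + 1 : ℕ) : ℝ) ^ (((d : ℝ) + (Finset.univ : Finset (Fin d)).card) / 2)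
      ≤ M ^ 2 * ((N + 1 : ℕ) : ℝ)⁻¹ := by
    have h2 := abs_le.1 (h.abs_mean_cellMean_le hy N)
    rw [← div_eq_mul_inv]
    refine div_le_div₀ (sq_nonneg M) (sq_le_sq' h2.1 h2.2) hm ?_
    have h3 : ((N + 1 : ℕ) : ℝ) = ((N + 1 : ℕ) : ℝ) ^ (1 : ℝ) := (Real.rpow_one _).symm
    conv_lhs => rw [h3]
    refine Real.rpow_le_rpow_of_exponent_le hm1 ?_
    have : (1 : ℝ) ≤ d := by exact_mod_cast hd
    simp only [Finset.card_univ, Fintype.card_fin]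
    linarith
  have hE0 : 0 ≤ multinomialMean N (nearPoint Finset.univ lam x (N + 1)) (cellMean (N + 1) f) ^ 2
      / ((N + 1 : ℕ) : ℝ) ^ (((d : ℝ) + (Finset.univ : Finset (Fin d)).card) / 2) := by positivity
  rw [scaledVar_div_rpow, hV]
  simp only [Finset.compl_univ, Finset.card_empty, pow_zero, one_mul] at hrep ⊢
  have hf0 := h.bounded (facePoint Finset.univ x)
  have hprod : |f (facePoint Finset.univ x) * ∑ k ∈ latticePoints d N,
      multinomialProb N k (nearPoint Finset.univ lam x (N + 1)) ^ 2
      - f (facePoint Finset.univ x) * P0|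
      ≤ M * ((22 * Λ ^ 2 + 4 * Λ) / ((N + 1 : ℕ) : ℝ)) := by
    rw [← mul_sub, abs_mul]
    gcongr
  have hr := abs_le.1 (hrep.trans hmean)
  have hp := abs_le.1 hprod
  have e : (M * (2 * Λ + 1) + 1 + M * Λ + M * (22 * Λ ^ 2 + 4 * Λ) + M ^ 2) * ((N + 1 : ℕ) : ℝ)⁻¹
      = (M * (2 * Λ + 1) + 1 + M * Λ) * ((N + 1 : ℕ) : ℝ)⁻¹
        + M * ((22 * Λ ^ 2 + 4 * Λ) / ((N + 1 : ℕ) : ℝ)) + M ^ 2 * ((N + 1 : ℕ) : ℝ)⁻¹ := by ring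
  rw [e, abs_le]
  constructor <;> linarith

end Variance

/-! ### Mean and variance of the estimator -/

/-- The contribution of an observation at `z` to the estimator. -/
noncomputable def kernelFn {d : ℕ} (N : ℕ) (y z : Fin d → ℝ) : ℝ :=
  ∑ k ∈ latticePoints d N, ((N + 1 : ℕ) : ℝ) ^ d * multinomialProb N k y
    * (cell (N + 1) k).indicator (fun _ => (1 : ℝ)) z

theorem estimatorRV_eq {d : ℕ} {Ω : Type*} (X : ℕ → Ω → Fin d → ℝ) (n N : ℕ) (y : Fin d → ℝ) :
    estimatorRV X n (N + 1) y
      = fun ω => (n : ℝ)⁻¹ * (∑ i ∈ Finset.range n, fun ω => kernelFn N y (X i ω)) ω := by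
  ext ω
  simp only [estimatorRV, densityEstimator, kernelFn, Nat.add_sub_cancel, Finset.sum_apply]
  rw [Finset.sum_comm, Finset.mul_sum]
  refine Finset.sum_congr rfl fun k _ => ?_
  rw [← Finset.mul_sum]
  ring

section Estimator

variable {d : ℕ} {f : (Fin d → ℝ) → ℝ} {Ω : Type*} [MeasurableSpace Ω] {μ : Measure Ω}
  {X : ℕ → Ω → Fin d → ℝ}

theorem integral_indicator_cell (hf : IsSimplexDensity f) (hXmeas : ∀ i, Measurable (X i))
    (hXlaw : ∀ i, μ.map (X i) = (volume : Measure (Fin d → ℝ)).withDensity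
      fun y => ENNReal.ofReal (f y)) (i m : ℕ) (k : Fin d → ℕ) :
    ∫ ω, (cell m k).indicator (fun _ => (1 : ℝ)) (X i ω) ∂μ = ∫ z in cell m k, f z := by
  have hms := measurableSet_cell m k
  have h1 : ∫ ω, (cell m k).indicator (fun _ => (1 : ℝ)) (X i ω) ∂μ
      = ∫ z, (cell m k).indicator (fun _ => (1 : ℝ)) z ∂(μ.map (X i)) :=
    (integral_map (hXmeas i).aemeasurable
      (measurable_const.indicator hms).aestronglyMeasurable).symm
  rw [h1, integral_indicator hms, setIntegral_const, smul_eq_mul, mul_one, hXlaw, Measure.real,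
    withDensity_apply _ hms,
    ← ofReal_integral_eq_lintegral_ofReal hf.integrable.integrableOn (ae_of_all _ hf.nonneg),
    ENNReal.toReal_ofReal (integral_nonneg hf.nonneg)]

variable [IsProbabilityMeasure μ]

theorem measurable_kernelFn (N : ℕ) (y : Fin d → ℝ) : Measurable (kernelFn N y) := by
  unfold kernelFn
  refine Finset.measurable_sum _ fun k _ => Measurable.const_mul ?_ _
  exact measurable_const.indicator (measurableSet_cell _ _)

theorem abs_kernelFn_le (N : ℕ) (y z : Fin d → ℝ) :
    |kernelFn N y z|
      ≤ ∑ k ∈ latticePoints d N, |((N + 1 : ℕ) : ℝ) ^ d * multinomialProb N k y| := by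
  refine (Finset.abs_sum_le_sum_abs _ _).trans (Finset.sum_le_sum fun k _ => ?_)
  rw [abs_mul]
  refine mul_le_of_le_one_right (abs_nonneg _) ?_
  by_cases hz : z ∈ cell (N + 1) k <;> simp [hz]

/-- The cells are pairwise disjoint, so all cross terms vanish; this is what reduces the variance to
squared probabilities. -/
theorem kernelFn_sq (N : ℕ) (y z : Fin d → ℝ) :
    kernelFn N y z ^ 2 = ∑ k ∈ latticePoints d N,
      (((N + 1 : ℕ) : ℝ) ^ d * multinomialProb N k y) ^ 2
        * (cell (N + 1) k).indicator (fun _ => (1 : ℝ)) z := by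
  rw [kernelFn, sq, Finset.sum_mul_sum]
  refine Finset.sum_congr rfl fun k hk => ?_
  rw [Finset.sum_eq_single k]
  · by_cases hz : z ∈ cell (N + 1) k
    · simp only [Set.indicator_of_mem hz]
      ring
    · simp [hz]
  · intro l _ hlk
    by_cases hz : z ∈ cell (N + 1) k
    · have : z ∉ cell (N + 1) l := Set.disjoint_left.1 (disjoint_cell (by omega) hlk.symm) hz
      simp [this]
    · simp [hz]
  · exact fun h => (h hk).elim

theorem integrable_indicator_cell (hXmeas : ∀ i, Measurable (X i)) (i m : ℕ) (k : Fin d → ℕ) :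
    Integrable (fun ω => (cell m k).indicator (fun _ => (1 : ℝ)) (X i ω)) μ := by
  refine Integrable.of_bound (C := 1) ?_ (ae_of_all _ fun ω => ?_)
  · exact ((measurable_const.indicator (measurableSet_cell m k)).comp
      (hXmeas i)).aestronglyMeasurable
  · by_cases hz : X i ω ∈ cell m k <;> simp [hz]

theorem memLp_kernelFn (hXmeas : ∀ i, Measurable (X i)) (i N : ℕ) (y : Fin d → ℝ) :
    MemLp (fun ω => kernelFn N y (X i ω)) 2 μ :=
  MemLp.of_bound ((measurable_kernelFn N y).comp (hXmeas i)).aestronglyMeasurable _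
    (ae_of_all _ fun ω => abs_kernelFn_le N y (X i ω))

theorem memLp_estimatorRV (hXmeas : ∀ i, Measurable (X i)) (n N : ℕ) (y : Fin d → ℝ) :
    MemLp (estimatorRV X n (N + 1) y) 2 μ := by
  rw [estimatorRV_eq]
  exact (memLp_finsetSum' _ fun i _ => memLp_kernelFn hXmeas i N y).const_mul _

theorem integral_kernelFn (hf : IsSimplexDensity f) (hXmeas : ∀ i, Measurable (X i))
    (hXlaw : ∀ i, μ.map (X i) = (volume : Measure (Fin d → ℝ)).withDensity
      fun y => ENNReal.ofReal (f y)) (i N : ℕ) (y : Fin d → ℝ) :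
    ∫ ω, kernelFn N y (X i ω) ∂μ = multinomialMean N y (cellMean (N + 1) f) := by
  simp only [kernelFn]
  rw [integral_finsetSum _ fun k _ => (integrable_indicator_cell hXmeas i _ k).const_mul _]
  refine Finset.sum_congr rfl fun k _ => ?_
  rw [integral_const_mul, integral_indicator_cell hf hXmeas hXlaw, cellMean, smul_eq_mul]
  ring

theorem variance_kernelFn (hf : IsSimplexDensity f) (hXmeas : ∀ i, Measurable (X i))
    (hXlaw : ∀ i, μ.map (X i) = (volume : Measure (Fin d → ℝ)).withDensity
      fun y => ENNReal.ofReal (f y)) (i N : ℕ) (y : Fin d → ℝ) :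
    variance (fun ω => kernelFn N y (X i ω)) μ = scaledVar f N y := by
  rw [variance_eq_sub (memLp_kernelFn hXmeas i N y), integral_kernelFn hf hXmeas hXlaw, scaledVar]
  congr 1
  simp only [Pi.pow_apply, kernelFn_sq]
  rw [integral_finsetSum _ fun k _ => (integrable_indicator_cell hXmeas i _ k).const_mul _,
    Finset.mul_sum]
  refine Finset.sum_congr rfl fun k _ => ?_
  rw [integral_const_mul, integral_indicator_cell hf hXmeas hXlaw, cellMean]
  ring

theorem integral_estimatorRV (hf : IsSimplexDensity f) (hXmeas : ∀ i, Measurable (X i))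
    (hXlaw : ∀ i, μ.map (X i) = (volume : Measure (Fin d → ℝ)).withDensity
      fun y => ENNReal.ofReal (f y)) {n : ℕ} (hn : 1 ≤ n) (N : ℕ) (y : Fin d → ℝ) :
    ∫ ω, estimatorRV X n (N + 1) y ω ∂μ = multinomialMean N y (cellMean (N + 1) f) := by
  have hn0 : (n : ℝ) ≠ 0 := by positivity
  rw [estimatorRV_eq]
  simp only [Finset.sum_apply]
  rw [integral_const_mul, integral_finsetSum _ fun i _ =>
    (memLp_kernelFn hXmeas i N y).integrable one_le_two]
  simp only [integral_kernelFn hf hXmeas hXlaw, Finset.sum_const, Finset.card_range, nsmul_eq_mul]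
  rw [← mul_assoc, inv_mul_cancel₀ hn0, one_mul]

theorem variance_estimatorRV (hf : IsSimplexDensity f) (hXmeas : ∀ i, Measurable (X i))
    (hXindep : iIndepFun X μ)
    (hXlaw : ∀ i, μ.map (X i) = (volume : Measure (Fin d → ℝ)).withDensity
      fun y => ENNReal.ofReal (f y)) {n : ℕ} (hn : 1 ≤ n) (N : ℕ) (y : Fin d → ℝ) :
    variance (estimatorRV X n (N + 1) y) μ = (n : ℝ)⁻¹ * scaledVar f N y := by
  have hn0 : (n : ℝ) ≠ 0 := by positivity
  rw [estimatorRV_eq, variance_const_mul, IndepFun.variance_sum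
    (fun i _ => memLp_kernelFn hXmeas i N y)
    (fun i _ j _ hij => (hXindep.indepFun hij).comp (measurable_kernelFn N y)
      (measurable_kernelFn N y))]
  simp only [variance_kernelFn hf hXmeas hXlaw, Finset.sum_const, Finset.card_range, nsmul_eq_mul]
  field_simp

theorem mse_eq_variance_add_bias_sq (f : (Fin d → ℝ) → ℝ) (hXmeas : ∀ i, Measurable (X i))
    (n N : ℕ) (y : Fin d → ℝ) :
    mse μ X f n (N + 1) y
      = variance (estimatorRV X n (N + 1) y) μ + bias μ X f n (N + 1) y ^ 2 := by
  have hZ := memLp_estimatorRV (μ := μ) hXmeas n N y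
  have h1 : Integrable (estimatorRV X n (N + 1) y) μ := hZ.integrable one_le_two
  have h2 : Integrable (fun ω => estimatorRV X n (N + 1) y ω ^ 2) μ := hZ.integrable_sq
  have e : ∀ ω, (estimatorRV X n (N + 1) y ω - f y) ^ 2
      = estimatorRV X n (N + 1) y ω ^ 2 + (-(2 * f y) * estimatorRV X n (N + 1) y ω + f y ^ 2) := by
    intro ω; ring
  rw [variance_eq_sub hZ, mse, bias]
  simp only [e, Pi.pow_apply]
  have h3 : Integrable (fun ω => -(2 * f y) * estimatorRV X n (N + 1) y ω + f y ^ 2) μ :=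
    (h1.const_mul _).add (integrable_const _)
  rw [integral_add h2 h3, integral_add (h1.const_mul _) (integrable_const _),
    integral_const_mul, integral_const]
  simp
  ring

/-- An exact identity in which `n` enters only through the factor `n⁻¹`. It is the reason why no
remainder depends on `n`. -/
theorem mse_eq (hf : IsSimplexDensity f) (hXmeas : ∀ i, Measurable (X i))
    (hXindep : iIndepFun X μ)
    (hXlaw : ∀ i, μ.map (X i) = (volume : Measure (Fin d → ℝ)).withDensity
      fun y => ENNReal.ofReal (f y)) {n : ℕ} (hn : 1 ≤ n) (N : ℕ) (y : Fin d → ℝ) :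
    mse μ X f n (N + 1) y = (n : ℝ)⁻¹ * scaledVar f N y
      + (multinomialMean N y (cellMean (N + 1) f) - f y) ^ 2 := by
  rw [mse_eq_variance_add_bias_sq f hXmeas, variance_estimatorRV hf hXmeas hXindep hXlaw hn, bias,
    integral_estimatorRV hf hXmeas hXlaw hn]

end Estimator

/-! ### The optimal bandwidth -/

/-- The normalised leading term of the mean squared error. -/
noncomputable def riskProfile (q t : ℝ) : ℝ := 4 / q * t ^ (q / 2) + (t ^ 2)⁻¹

theorem riskProfile_one (q : ℝ) : riskProfile q 1 = 4 / q + 1 := by simp [riskProfile]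

/-- In the variable `w = log t`, the first term lies above its tangent, `(4/q) e^{qw/2} ≥ 4/q + 2w`,
and the second is `e^{-2w}`. The excess thus dominates `e^v - 1 - v` at `v = -2w`, which vanishes
only at `v = 0`. -/
theorem exp_sub_le_riskProfile_sub {q t : ℝ} (hq : 0 < q) (ht : 0 < t) :
    Real.exp (-(2 * Real.log t)) - 1 + 2 * Real.log t ≤ riskProfile q t - riskProfile q 1 := by
  have h1 : t ^ (q / 2) = Real.exp (Real.log t * (q / 2)) := Real.rpow_def_of_pos ht _
  have h2 : (t ^ 2)⁻¹ = Real.exp (-(2 * Real.log t)) := by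
    rw [Real.exp_neg, two_mul, Real.exp_add, Real.exp_log ht, sq]
  rw [riskProfile_one, riskProfile, h1, h2]
  have h3 := mul_le_mul_of_nonneg_left (Real.add_one_le_exp (Real.log t * (q / 2)))
    (show 0 ≤ 4 / q by positivity)
  have h4 : 4 / q * (Real.log t * (q / 2) + 1) = 2 * Real.log t + 4 / q := by
    field_simp
    ring
  linarith

theorem riskProfile_one_le {q t : ℝ} (hq : 0 < q) (ht : 0 < t) :
    riskProfile q 1 ≤ riskProfile q t := by
  have h1 := exp_sub_le_riskProfile_sub hq ht
  have h2 := Real.add_one_le_exp (-(2 * Real.log t))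
  linarith

theorem riskProfile_one_pos {q : ℝ} (hq : 0 < q) : 0 < riskProfile q 1 := by
  rw [riskProfile_one]
  positivity

/-- For `v ≥ -2`, squaring `e^{v/2} ≥ 1 + v/2` gives `e^v - 1 - v ≥ v²/4`; for `v < -2` the
expression exceeds one. Hence the threshold `min 1 (ε ^ 2 / 4)`. -/
theorem tendsto_zero_of_tendsto_exp_sub {v : ℕ → ℝ}
    (h : Tendsto (fun n => Real.exp (v n) - 1 - v n) atTop (𝓝 0)) : Tendsto v atTop (𝓝 0) := by
  rw [Metric.tendsto_atTop']
  intro ε hε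
  have hpos : 0 < min 1 (ε ^ 2 / 4) := by positivity
  obtain ⟨n0, hn0⟩ := eventually_atTop.1 (h.eventually_lt_const hpos)
  refine ⟨n0, fun n hn => ?_⟩
  have h1 := hn0 n hn.le
  rw [lt_min_iff] at h1
  have hv : -2 ≤ v n := by
    by_contra hlt
    push Not at hlt
    have := Real.exp_pos (v n)
    linarith
  have h2 : (1 + v n / 2) ^ 2 ≤ Real.exp (v n) := by
    have h3 := Real.add_one_le_exp (v n / 2)
    have h4 : Real.exp (v n) = Real.exp (v n / 2) ^ 2 := by
      rw [← Real.exp_nat_mul]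
      congr 1
      push_cast
      ring
    rw [h4]
    exact pow_le_pow_left₀ (by linarith) (by linarith) 2
  have h5 : v n ^ 2 < ε ^ 2 := by nlinarith
  rw [Real.dist_eq, sub_zero]
  exact abs_lt_of_sq_lt_sq h5 hε.le

theorem tendsto_one_of_tendsto_riskProfile {q : ℝ} (hq : 0 < q) {t : ℕ → ℝ}
    (ht : ∀ᶠ n in atTop, 0 < t n)
    (h : Tendsto (fun n => riskProfile q (t n)) atTop (𝓝 (riskProfile q 1))) :
    Tendsto t atTop (𝓝 1) := by
  have h1 : Tendsto (fun n => Real.exp (-(2 * Real.log (t n))) - 1 - -(2 * Real.log (t n))) atTop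
      (𝓝 0) := by
    have h2 := h.sub_const (riskProfile q 1)
    rw [sub_self] at h2
    refine squeeze_zero' (Eventually.of_forall fun n => ?_) ?_ h2
    · linarith [Real.add_one_le_exp (-(2 * Real.log (t n)))]
    · filter_upwards [ht] with n hn
      linarith [exp_sub_le_riskProfile_sub hq hn]
  have h3 := (tendsto_zero_of_tendsto_exp_sub h1).const_mul (-(1 / 2))
  have h4 := (Real.continuous_exp.tendsto _).comp h3
  rw [mul_zero, Real.exp_zero] at h4
  refine h4.congr' ?_
  filter_upwards [ht] with n hn
  simp only [Function.comp]
  rw [show -(1 / 2) * -(2 * Real.log (t n)) = Real.log (t n) by ring, Real.exp_log hn]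

/-- The value of the derivative is immaterial: a linear bound near `1` is as sharp as the `O(1/m)`
remainders it is combined with. -/
theorem hasDerivAt_riskProfile_one (q : ℝ) : ∃ c, HasDerivAt (riskProfile q) c 1 := by
  have h1 : HasDerivAt (fun t : ℝ => t ^ (q / 2)) (q / 2 * 1 ^ (q / 2 - 1)) 1 :=
    Real.hasDerivAt_rpow_const (Or.inl one_ne_zero)
  have h2 : DifferentiableAt ℝ (fun t : ℝ => (t ^ 2)⁻¹) 1 :=
    (differentiableAt_id.pow 2).inv (by simp)
  exact ⟨_, (h1.const_mul (4 / q)).add h2.hasDerivAt⟩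

/-! ### Optimal bandwidth for an abstract risk expansion -/

/-- The risk `M n m` equals `n⁻¹ m^{q/2} V + m⁻² B²` up to relative errors depending only on `m`. -/
structure RiskExpansion (M : ℕ → ℕ → ℝ) (q B V : ℝ) (α β : ℕ → ℝ) : Prop where
  q_pos : 0 < q
  B_ne : B ≠ 0
  V_pos : 0 < V
  tendsto_var : Tendsto α atTop (𝓝 0)
  tendsto_bias : Tendsto β atTop (𝓝 0)
  expansion : ∀ᶠ m : ℕ in atTop, ∀ n : ℕ, 1 ≤ n →
    M n m = (n : ℝ)⁻¹ * (m : ℝ) ^ (q / 2) * (V + α m) + ((m : ℝ) ^ 2)⁻¹ * (B ^ 2 + β m)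

section Optimal

variable {q B V : ℝ}

/-- The constant factor of the optimal bandwidth. -/
noncomputable def optFactor (q B V : ℝ) : ℝ := (4 * B ^ 2 / (q * V)) ^ (2 / (q + 4))

theorem optFactor_pos (hq : 0 < q) (hB : B ≠ 0) (hV : 0 < V) : 0 < optFactor q B V := by
  have : 0 < B ^ 2 := by positivity
  unfold optFactor
  positivity

theorem mOpt_eq (hq : 0 < q) (hB : B ≠ 0) (hV : 0 < V) (n : ℕ) :
    mOpt q B V n = (n : ℝ) ^ (2 / (q + 4)) * optFactor q B V := by
  have hB' : 0 < |B| := abs_pos.2 hB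
  have h1 : |B| ^ (4 / (q + 4)) = (B ^ 2) ^ (2 / (q + 4)) := by
    rw [← sq_abs, ← Real.rpow_natCast, ← Real.rpow_mul hB'.le]
    congr 1
    push_cast
    ring
  rw [mOpt, optFactor, h1, mul_div_assoc, ← Real.div_rpow (by positivity) (by positivity)]
  congr 2
  field_simp

theorem mOpt_pos (hq : 0 < q) (hB : B ≠ 0) (hV : 0 < V) {n : ℕ} (hn : 1 ≤ n) :
    0 < mOpt q B V n := by
  have hn0 : (0 : ℝ) < n := by exact_mod_cast hn
  rw [mOpt_eq hq hB hV]
  exact mul_pos (Real.rpow_pos_of_pos hn0 _) (optFactor_pos hq hB hV)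

theorem tendsto_mOpt (hq : 0 < q) (hB : B ≠ 0) (hV : 0 < V) :
    Tendsto (mOpt q B V) atTop atTop := by
  have h : Tendsto (fun n : ℕ => (n : ℝ) ^ (2 / (q + 4)) * optFactor q B V) atTop atTop :=
    ((tendsto_rpow_atTop (by positivity)).comp
      (tendsto_natCast_atTop_atTop (R := ℝ))).atTop_mul_const (optFactor_pos hq hB hV)
  exact h.congr fun n => (mOpt_eq hq hB hV n).symm

/-- First-order condition: at the optimum the variance term is `4/q` times the squared bias. It
amounts to `mOpt^{q/2+2} = n * 4B²/(qV)`, where `q/2 + 2` is the reciprocal of `2/(q + 4)`. -/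
theorem mOpt_balance (hq : 0 < q) (hB : B ≠ 0) (hV : 0 < V) {n : ℕ} (hn : 1 ≤ n) :
    (n : ℝ)⁻¹ * mOpt q B V n ^ (q / 2) * V = B ^ 2 / mOpt q B V n ^ 2 * (4 / q) := by
  have hn0 : (0 : ℝ) < n := by exact_mod_cast hn
  have hm := mOpt_pos hq hB hV hn
  have hB2 : 0 < B ^ 2 := by positivity
  have h1 : mOpt q B V n ^ (q / 2) * mOpt q B V n ^ 2 = n * (4 * B ^ 2 / (q * V)) := by
    have h2 : mOpt q B V n = (n * (4 * B ^ 2 / (q * V))) ^ (2 / (q + 4)) := by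
      rw [mOpt_eq hq hB hV, optFactor, Real.mul_rpow hn0.le (by positivity)]
    have h3 : mOpt q B V n ^ (q / 2) * mOpt q B V n ^ 2 = mOpt q B V n ^ (q / 2 + 2) := by
      rw [Real.rpow_add hm, Real.rpow_ofNat]
    rw [h3, h2, ← Real.rpow_mul (by positivity)]
    have h4 : 2 / (q + 4) * (q / 2 + 2) = 1 := by
      field_simp
      norm_num
    rw [h4, Real.rpow_one]
  have h5 : mOpt q B V n ^ (q / 2) = n * (4 * B ^ 2 / (q * V)) / mOpt q B V n ^ 2 := by
    rw [← h1]
    field_simp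
  rw [h5]
  field_simp

theorem sq_div_mOpt_sq (hq : 0 < q) (hB : B ≠ 0) (hV : 0 < V) (n : ℕ) :
    B ^ 2 / mOpt q B V n ^ 2 = (n : ℝ) ^ (-(4 / (q + 4))) * (B ^ 2 / optFactor q B V ^ 2) := by
  rw [mOpt_eq hq hB hV, mul_pow, ← Real.rpow_natCast (_ ^ _), ← Real.rpow_mul (Nat.cast_nonneg n),
    Real.rpow_neg (Nat.cast_nonneg n)]
  have : 2 / (q + 4) * ((2 : ℕ) : ℝ) = 4 / (q + 4) := by push_cast; ring
  rw [this]
  field_simp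

/-- Both sides are the same power of `n` times constants; the exponents of `|B|` match because
`2q/(q+4) + 8/(q+4) = 2`. -/
theorem optMSE_eq (hq : 0 < q) (hB : B ≠ 0) (hV : 0 < V) (n : ℕ) :
    optMSE q B V n = B ^ 2 / mOpt q B V n ^ 2 * riskProfile q 1 := by
  have hB' : 0 < |B| := abs_pos.2 hB
  have hB2 : 0 < B ^ 2 := by positivity
  have hq4 : q + 4 ≠ 0 := by positivity
  have h1 : optFactor q B V ^ 2
      = (4 / q) ^ (4 / (q + 4)) * |B| ^ (8 / (q + 4)) * V ^ (-(4 / (q + 4))) := by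
    have e : 4 * B ^ 2 / (q * V) = 4 / q * |B| ^ 2 / V := by
      rw [sq_abs]
      field_simp
    have e2 : 2 / (q + 4) * ((2 : ℕ) : ℝ) = 4 / (q + 4) := by push_cast; ring
    have e3 : ((2 : ℕ) : ℝ) * (4 / (q + 4)) = 8 / (q + 4) := by push_cast; ring
    rw [optFactor, ← Real.rpow_natCast, ← Real.rpow_mul (by positivity), e, e2,
      Real.div_rpow (by positivity) hV.le, Real.mul_rpow (by positivity) (by positivity),
      Real.rpow_neg hV.le, ← Real.rpow_natCast |B|, ← Real.rpow_mul hB'.le, e3]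
    rfl
  have h2 : |B| ^ (2 * q / (q + 4)) * |B| ^ (8 / (q + 4)) = B ^ 2 := by
    rw [← Real.rpow_add hB', ← sq_abs, ← Real.rpow_natCast]
    congr 1
    push_cast
    field_simp
    ring
  rw [sq_div_mOpt_sq hq hB hV, h1, ← h2, optMSE, riskProfile_one]
  have h3 : 0 < |B| ^ (8 / (q + 4)) := by positivity
  have h4 : 0 < V ^ (-(4 / (q + 4))) := by positivity
  have h5 : 0 < (4 / q) ^ (4 / (q + 4)) := by positivity
  have h6 : 0 < 4 / q + 1 := by positivity
  field_simp

variable {M : ℕ → ℕ → ℝ} {α β : ℕ → ℝ}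

/-- In units of `mOpt` the balance relation pulls out a common factor, so that `n` survives only in
this factor and in the ratio `m / mOpt`. -/
theorem RiskExpansion.eventually_eq (h : RiskExpansion M q B V α β) :
    ∀ᶠ m : ℕ in atTop, ∀ n : ℕ, 1 ≤ n →
      M n m = B ^ 2 / mOpt q B V n ^ 2 * (riskProfile q (m / mOpt q B V n)
        + (4 / q * ((m : ℝ) / mOpt q B V n) ^ (q / 2) * (α m / V)
          + (((m : ℝ) / mOpt q B V n) ^ 2)⁻¹ * (β m / B ^ 2))) := by
  have hq := h.q_pos
  have hB := h.B_ne
  have hV := h.V_pos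
  filter_upwards [h.expansion] with m hm n hn
  have h0 := mOpt_pos hq hB hV hn
  have h1 := mOpt_balance hq hB hV hn
  have hp : 0 < mOpt q B V n ^ (q / 2) := Real.rpow_pos_of_pos h0 _
  rw [hm n hn, riskProfile, Real.div_rpow (Nat.cast_nonneg m) h0.le]
  set p := mOpt q B V n ^ (q / 2) with hpd
  set o := mOpt q B V n with hod
  have h2 : (n : ℝ)⁻¹ = B ^ 2 / o ^ 2 * (4 / q) / (p * V) := by
    rw [← h1]
    field_simp
  rw [h2]
  field_simp
  ring

/-- The relative errors depend on `m` only, so one threshold for `m` serves all `n`. This permits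
comparison with arbitrary competing sequences, however slowly they grow. -/
theorem RiskExpansion.eventually_bounds (h : RiskExpansion M q B V α β) {η : ℝ} (hη : 0 < η) :
    ∀ᶠ m : ℕ in atTop, ∀ n : ℕ, 1 ≤ n →
      B ^ 2 / mOpt q B V n ^ 2 * ((1 - η) * riskProfile q (m / mOpt q B V n)) ≤ M n m ∧
      M n m ≤ B ^ 2 / mOpt q B V n ^ 2 * ((1 + η) * riskProfile q (m / mOpt q B V n)) := by
  have hq := h.q_pos
  have hB := h.B_ne
  have hV := h.V_pos
  have hα : ∀ᶠ m in atTop, |α m / V| ≤ η := by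
    have := (h.tendsto_var.div_const V).abs
    rw [zero_div, abs_zero] at this
    exact this.eventually_le_const hη
  have hβ : ∀ᶠ m in atTop, |β m / B ^ 2| ≤ η := by
    have := (h.tendsto_bias.div_const (B ^ 2)).abs
    rw [zero_div, abs_zero] at this
    exact this.eventually_le_const hη
  filter_upwards [h.eventually_eq, hα, hβ] with m hm h1 h2 n hn
  have h0 := mOpt_pos hq hB hV hn
  rw [hm n hn]
  have ht : 0 ≤ (m : ℝ) / mOpt q B V n := by positivity
  rw [abs_le] at h1 h2
  have hA : 0 ≤ 4 / q * ((m : ℝ) / mOpt q B V n) ^ (q / 2) := by positivity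
  have hC : 0 ≤ (((m : ℝ) / mOpt q B V n) ^ 2)⁻¹ := by positivity
  have hD : 0 ≤ B ^ 2 / mOpt q B V n ^ 2 := by positivity
  constructor
  · refine mul_le_mul_of_nonneg_left ?_ hD
    unfold riskProfile
    nlinarith [mul_le_mul_of_nonneg_left h1.1 hA, mul_le_mul_of_nonneg_left h2.1 hC]
  · refine mul_le_mul_of_nonneg_left ?_ hD
    unfold riskProfile
    nlinarith [mul_le_mul_of_nonneg_left h1.2 hA, mul_le_mul_of_nonneg_left h2.2 hC]

theorem tendsto_atTop_of_ratio (hq : 0 < q) (hB : B ≠ 0) (hV : 0 < V) {m : ℕ → ℕ}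
    (hm : Tendsto (fun n => (m n : ℝ) / mOpt q B V n) atTop (𝓝 1)) : Tendsto m atTop atTop := by
  have h1 := hm.pos_mul_atTop one_pos (tendsto_mOpt hq hB hV)
  refine tendsto_natCast_atTop_iff.1 (h1.congr' ?_)
  filter_upwards [eventually_ge_atTop 1] with n hn
  exact div_mul_cancel₀ _ (mOpt_pos hq hB hV hn).ne'

theorem continuousAt_riskProfile_one (q : ℝ) : ContinuousAt (riskProfile q) 1 :=
  let ⟨_, h⟩ := hasDerivAt_riskProfile_one q
  h.continuousAt

theorem RiskExpansion.asymptoticallyOptimal_of_ratio (h : RiskExpansion M q B V α β) {m : ℕ → ℕ}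
    (hm : Tendsto (fun n => (m n : ℝ) / mOpt q B V n) atTop (𝓝 1)) :
    AsymptoticallyOptimal M m := by
  have hq := h.q_pos
  have hB := h.B_ne
  have hV := h.V_pos
  have hmtop := tendsto_atTop_of_ratio hq hB hV hm
  refine ⟨hmtop, fun m' hm' ε hε => ?_⟩
  -- Chosen so that `(1 + η)² ≤ (1 + ε)(1 - η)`: on the left one factor for the expansion and one
  -- for the continuity of the profile, on the right the expansion for the competitor.
  set η := min (1 / 2) (ε / (4 + 2 * ε)) with hη
  have hη0 : 0 < η := by positivity
  have hη1 : η ≤ 1 / 2 := min_le_left _ _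
  have hη2 : (1 + η) * (1 + η) ≤ (1 + ε) * (1 - η) := by
    have h1 : η * (4 + 2 * ε) ≤ ε := by
      rw [← le_div_iff₀ (by positivity)]
      exact min_le_right _ _
    nlinarith
  have hG := riskProfile_one_pos hq
  have hlim : ∀ᶠ n in atTop, riskProfile q (m n / mOpt q B V n) ≤ (1 + η) * riskProfile q 1 := by
    have := (continuousAt_riskProfile_one q).tendsto.comp hm
    exact this.eventually_le_const (by nlinarith)
  filter_upwards [hlim, hmtop.eventually (h.eventually_bounds hη0),
    hm'.eventually (h.eventually_bounds hη0), hm'.eventually_ge_atTop 1, eventually_ge_atTop 1]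
    with n h1 h2 h3 h4 hn
  have h0 := mOpt_pos hq hB hV hn
  have ht' : 0 < (m' n : ℝ) / mOpt q B V n := by
    have : (0 : ℝ) < m' n := by exact_mod_cast h4
    positivity
  have hD : 0 ≤ B ^ 2 / mOpt q B V n ^ 2 := by positivity
  calc M n (m n) ≤ B ^ 2 / mOpt q B V n ^ 2 * ((1 + η) * riskProfile q (m n / mOpt q B V n)) :=
        (h2 n hn).2
    _ ≤ B ^ 2 / mOpt q B V n ^ 2 * ((1 + η) * ((1 + η) * riskProfile q 1)) := by gcongr
    _ ≤ B ^ 2 / mOpt q B V n ^ 2 * ((1 + ε) * (1 - η) * riskProfile q 1) := by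
        refine mul_le_mul_of_nonneg_left ?_ hD
        rw [← mul_assoc]
        exact mul_le_mul_of_nonneg_right hη2 hG.le
    _ ≤ B ^ 2 / mOpt q B V n ^ 2 * ((1 + ε) * (1 - η) * riskProfile q (m' n / mOpt q B V n)) := by
        refine mul_le_mul_of_nonneg_left (mul_le_mul_of_nonneg_left
          (riskProfile_one_le hq ht') ?_) hD
        exact mul_nonneg (by linarith) (by linarith)
    _ = (1 + ε) * (B ^ 2 / mOpt q B V n ^ 2
          * ((1 - η) * riskProfile q (m' n / mOpt q B V n))) := by ring
    _ ≤ (1 + ε) * M n (m' n) := by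
        gcongr
        exact (h3 n hn).1

theorem tendsto_floor_mOpt_div (hq : 0 < q) (hB : B ≠ 0) (hV : 0 < V) :
    Tendsto (fun n => (⌊mOpt q B V n⌋₊ : ℝ) / mOpt q B V n) atTop (𝓝 1) :=
  (tendsto_nat_floor_div_atTop (R := ℝ)).comp (tendsto_mOpt hq hB hV)

/-- Comparison with the competitor `⌊mOpt⌋₊`, whose profile value tends to the minimum, forces the
profile at `m / mOpt` to the minimum as well; since the minimum is well separated, the ratio tends
to one. -/
theorem RiskExpansion.ratio_of_asymptoticallyOptimal (h : RiskExpansion M q B V α β) {m : ℕ → ℕ}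
    (hm : AsymptoticallyOptimal M m) :
    Tendsto (fun n => (m n : ℝ) / mOpt q B V n) atTop (𝓝 1) := by
  have hq := h.q_pos
  have hB := h.B_ne
  have hV := h.V_pos
  have hfl := tendsto_floor_mOpt_div hq hB hV
  have hfltop := tendsto_atTop_of_ratio hq hB hV hfl
  have hG := riskProfile_one_pos hq
  have hpos : ∀ᶠ n in atTop, 0 < (m n : ℝ) / mOpt q B V n := by
    filter_upwards [hm.1.eventually_ge_atTop 1, eventually_ge_atTop 1] with n h1 hn
    have := mOpt_pos hq hB hV hn
    have h2 : (0 : ℝ) < m n := by exact_mod_cast h1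
    positivity
  refine tendsto_one_of_tendsto_riskProfile hq hpos ?_
  refine tendsto_order.2 ⟨fun a ha => ?_, fun a ha => ?_⟩
  · filter_upwards [hpos] with n hn
    exact ha.trans_le (riskProfile_one_le hq hn)
  -- The three factors `1 + η` stand for near-optimality, the expansion at the competitor and the
  -- continuity of the profile; `1 - η` is the expansion at `m n`.
  · obtain ⟨η, hη0, hη1, hηa⟩ : ∃ η : ℝ, 0 < η ∧ η < 1 ∧
        (1 + η) * ((1 + η) * ((1 + η) * riskProfile q 1)) / (1 - η) < a := by
      have hc : Tendsto (fun η : ℝ => (1 + η) * ((1 + η) * ((1 + η) * riskProfile q 1)) / (1 - η))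
          (𝓝[>] 0) (𝓝 (riskProfile q 1)) := by
        have : ContinuousAt (fun η : ℝ =>
            (1 + η) * ((1 + η) * ((1 + η) * riskProfile q 1)) / (1 - η)) 0 :=
          ContinuousAt.div (by fun_prop) (by fun_prop) (by norm_num)
        have h1 := this.tendsto.mono_left (nhdsWithin_le_nhds (s := Set.Ioi 0))
        simpa using h1
      have h2 := hc.eventually_lt_const ha
      have h3 : ∀ᶠ η : ℝ in 𝓝[>] 0, η < 1 :=
        (eventually_lt_nhds one_pos).filter_mono nhdsWithin_le_nhds
      obtain ⟨η, ⟨h4, h5⟩, h6⟩ := ((h2.and h3).and self_mem_nhdsWithin).exists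
      exact ⟨η, h6, h5, h4⟩
    have hlim : ∀ᶠ n in atTop, riskProfile q (⌊mOpt q B V n⌋₊ / mOpt q B V n)
        ≤ (1 + η) * riskProfile q 1 := by
      have := (continuousAt_riskProfile_one q).tendsto.comp hfl
      exact this.eventually_le_const (by nlinarith)
    filter_upwards [hlim, hm.1.eventually (h.eventually_bounds hη0),
      hfltop.eventually (h.eventually_bounds hη0), hm.2 _ hfltop η hη0, eventually_ge_atTop 1]
      with n h1 h2 h3 h4 hn
    have h0 := mOpt_pos hq hB hV hn
    have hD : 0 < B ^ 2 / mOpt q B V n ^ 2 := by positivity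
    refine lt_of_le_of_lt ?_ hηa
    rw [le_div_iff₀ (by linarith), mul_comm]
    refine le_of_mul_le_mul_left ?_ hD
    calc _ ≤ M n (m n) := (h2 n hn).1
      _ ≤ (1 + η) * M n ⌊mOpt q B V n⌋₊ := h4
      _ ≤ (1 + η) * (B ^ 2 / mOpt q B V n ^ 2
            * ((1 + η) * riskProfile q (⌊mOpt q B V n⌋₊ / mOpt q B V n))) := by
          gcongr
          exact (h3 n hn).2
      _ ≤ (1 + η) * (B ^ 2 / mOpt q B V n ^ 2 * ((1 + η) * ((1 + η) * riskProfile q 1))) := by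
          gcongr
      _ = _ := by ring

/-- The difference between the risk and its optimal leading term, after normalisation. -/
theorem RiskExpansion.eventually_sub_optMSE (h : RiskExpansion M q B V α β) {m : ℕ → ℕ}
    (hm : Tendsto m atTop atTop) :
    ∀ᶠ n in atTop, M n (m n) - optMSE q B V n = B ^ 2 / mOpt q B V n ^ 2
      * ((riskProfile q (m n / mOpt q B V n) - riskProfile q 1)
        + (4 / q * ((m n : ℝ) / mOpt q B V n) ^ (q / 2) * (α (m n) / V)
          + (((m n : ℝ) / mOpt q B V n) ^ 2)⁻¹ * (β (m n) / B ^ 2))) := by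
  filter_upwards [hm.eventually h.eventually_eq, eventually_ge_atTop 1] with n h1 hn
  rw [h1 n hn, optMSE_eq h.q_pos h.B_ne h.V_pos]
  ring

theorem isBigO_ratio_sub_one (hq : 0 < q) (hB : B ≠ 0) (hV : 0 < V) {m : ℕ → ℕ}
    (hm : (fun n => (m n : ℝ) - mOpt q B V n) =O[atTop] (fun _ => (1 : ℝ))) :
    (fun n => (m n : ℝ) / mOpt q B V n - 1) =O[atTop] (fun n => (mOpt q B V n)⁻¹) := by
  refine ((hm.mul (isBigO_refl (fun n => (mOpt q B V n)⁻¹) atTop)).congr' ?_ ?_)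
  · filter_upwards [eventually_ge_atTop 1] with n hn
    have := (mOpt_pos hq hB hV hn).ne'
    field_simp
  · exact Eventually.of_forall fun n => one_mul _

theorem tendsto_ratio_of_isBigO (hq : 0 < q) (hB : B ≠ 0) (hV : 0 < V) {m : ℕ → ℕ}
    (hm : (fun n => (m n : ℝ) - mOpt q B V n) =O[atTop] (fun _ => (1 : ℝ))) :
    Tendsto (fun n => (m n : ℝ) / mOpt q B V n) atTop (𝓝 1) := by
  have h1 := (isBigO_ratio_sub_one hq hB hV hm).trans_tendsto
    (tendsto_inv_atTop_zero.comp (tendsto_mOpt hq hB hV))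
  simpa using h1.add_const 1

theorem isBigO_sq_div_mOpt_sq (hq : 0 < q) (hB : B ≠ 0) (hV : 0 < V) :
    (fun n => B ^ 2 / mOpt q B V n ^ 2) =O[atTop] (fun n : ℕ => (n : ℝ) ^ (-(4 / (q + 4)))) := by
  simp only [sq_div_mOpt_sq hq hB hV]
  simpa only [mul_comm] using
    (isBigO_refl (fun n : ℕ => (n : ℝ) ^ (-(4 / (q + 4)))) atTop).const_mul_left
    (B ^ 2 / optFactor q B V ^ 2)

theorem tendsto_riskProfile_factors (q : ℝ) {t : ℕ → ℝ} (ht : Tendsto t atTop (𝓝 1)) :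
    Tendsto (fun n => 4 / q * t n ^ (q / 2)) atTop (𝓝 (4 / q)) ∧
      Tendsto (fun n => (t n ^ 2)⁻¹) atTop (𝓝 1) := by
  constructor
  · have := (ht.rpow_const (p := q / 2) (Or.inl one_ne_zero)).const_mul (4 / q)
    simpa using this
  · simpa using (ht.pow 2).inv₀ (by norm_num)

theorem RiskExpansion.isLittleO_sub_optMSE (h : RiskExpansion M q B V α β) {m : ℕ → ℕ}
    (hm : (fun n => (m n : ℝ) - mOpt q B V n) =O[atTop] (fun _ => (1 : ℝ))) :
    (fun n => M n (m n) - optMSE q B V n) =o[atTop] (fun n : ℕ => (n : ℝ) ^ (-(4 / (q + 4)))) := by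
  have hq := h.q_pos
  have hB := h.B_ne
  have hV := h.V_pos
  have ht := tendsto_ratio_of_isBigO hq hB hV hm
  have hmtop := tendsto_atTop_of_ratio hq hB hV ht
  obtain ⟨hf1, hf2⟩ := tendsto_riskProfile_factors q ht
  have hr : Tendsto (fun n => (riskProfile q (m n / mOpt q B V n) - riskProfile q 1)
        + (4 / q * ((m n : ℝ) / mOpt q B V n) ^ (q / 2) * (α (m n) / V)
          + (((m n : ℝ) / mOpt q B V n) ^ 2)⁻¹ * (β (m n) / B ^ 2))) atTop (𝓝 0) := by
    have h1 := ((continuousAt_riskProfile_one q).tendsto.comp ht).sub_const (riskProfile q 1)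
    have h2 := hf1.mul ((h.tendsto_var.comp hmtop).div_const V)
    have h3 := hf2.mul ((h.tendsto_bias.comp hmtop).div_const (B ^ 2))
    simpa using h1.add (h2.add h3)
  have := (isBigO_sq_div_mOpt_sq hq hB hV).mul_isLittleO ((isLittleO_one_iff ℝ).2 hr)
  refine this.congr' ?_ (Eventually.of_forall fun n => mul_one _)
  filter_upwards [h.eventually_sub_optMSE hmtop] with n hn
  exact hn.symm

/-- Rounding, `α` and `β` are each of relative order `1/mOpt`, that is `n^{-2/(q+4)}`, which
multiplies the leading order `n^{-4/(q+4)}`. -/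
theorem RiskExpansion.isBigO_sub_optMSE (h : RiskExpansion M q B V α β)
    (hα : α =O[atTop] (fun m : ℕ => (m : ℝ)⁻¹)) (hβ : β =O[atTop] (fun m : ℕ => (m : ℝ)⁻¹))
    {m : ℕ → ℕ}
    (hm : (fun n => (m n : ℝ) - mOpt q B V n) =O[atTop] (fun _ => (1 : ℝ))) :
    (fun n => M n (m n) - optMSE q B V n) =O[atTop] (fun n : ℕ => (n : ℝ) ^ (-(6 / (q + 4)))) := by
  have hq := h.q_pos
  have hB := h.B_ne
  have hV := h.V_pos
  have ht := tendsto_ratio_of_isBigO hq hB hV hm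
  have hmtop := tendsto_atTop_of_ratio hq hB hV ht
  obtain ⟨hf1, hf2⟩ := tendsto_riskProfile_factors q ht
  have hminv : (fun n => (m n : ℝ)⁻¹) =O[atTop] (fun n => (mOpt q B V n)⁻¹) := by
    have h1 := (ht.inv₀ one_ne_zero).isBigO_one ℝ
    refine (h1.mul (isBigO_refl (fun n => (mOpt q B V n)⁻¹) atTop)).congr' ?_
      (Eventually.of_forall fun n => one_mul _)
    filter_upwards [eventually_ge_atTop 1] with n hn
    have := (mOpt_pos hq hB hV hn).ne'
    rw [inv_div]
    field_simp
  have hr : (fun n => (riskProfile q (m n / mOpt q B V n) - riskProfile q 1)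
        + (4 / q * ((m n : ℝ) / mOpt q B V n) ^ (q / 2) * (α (m n) / V)
          + (((m n : ℝ) / mOpt q B V n) ^ 2)⁻¹ * (β (m n) / B ^ 2)))
        =O[atTop] (fun n => (mOpt q B V n)⁻¹) := by
    obtain ⟨c, hc⟩ := hasDerivAt_riskProfile_one q
    have h1 := (hc.isBigO_sub.comp_tendsto ht).trans (isBigO_ratio_sub_one hq hB hV hm)
    have h2 : (fun n => 4 / q * ((m n : ℝ) / mOpt q B V n) ^ (q / 2) * (α (m n) / V))
        =O[atTop] (fun n => (mOpt q B V n)⁻¹) := by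
      have h4 : (fun n => α (m n) / V) =O[atTop] (fun n => (mOpt q B V n)⁻¹) := by
        simp only [div_eq_inv_mul]
        exact ((hα.comp_tendsto hmtop).trans hminv).const_mul_left _
      simpa using (hf1.isBigO_one ℝ).mul h4
    have h3 : (fun n => (((m n : ℝ) / mOpt q B V n) ^ 2)⁻¹ * (β (m n) / B ^ 2))
        =O[atTop] (fun n => (mOpt q B V n)⁻¹) := by
      have h4 : (fun n => β (m n) / B ^ 2) =O[atTop] (fun n => (mOpt q B V n)⁻¹) := by
        simp only [div_eq_inv_mul]
        exact ((hβ.comp_tendsto hmtop).trans hminv).const_mul_left _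
      simpa using (hf2.isBigO_one ℝ).mul h4
    exact h1.add (h2.add h3)
  have hinv : (fun n => (mOpt q B V n)⁻¹) =O[atTop] (fun n : ℕ => (n : ℝ) ^ (-(2 / (q + 4)))) := by
    have e : ∀ n, (mOpt q B V n)⁻¹ = (optFactor q B V)⁻¹ * (n : ℝ) ^ (-(2 / (q + 4))) := fun n => by
      rw [mOpt_eq hq hB hV, mul_inv, Real.rpow_neg (Nat.cast_nonneg n), mul_comm]
    simp only [e]
    exact (isBigO_refl _ _).const_mul_left _
  have := (isBigO_sq_div_mOpt_sq hq hB hV).mul (hr.trans hinv)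
  refine this.congr' ?_ ?_
  · filter_upwards [h.eventually_sub_optMSE hmtop] with n hn
    exact hn.symm
  · filter_upwards [eventually_ge_atTop 1] with n hn
    have hn0 : (0 : ℝ) < n := by exact_mod_cast hn
    rw [← Real.rpow_add hn0]
    congr 1
    ring

end Optimal

/-! ### The expansion of the mean squared error -/

/-- The remainder of the normalised variance. -/
noncomputable def varRemainder {d : ℕ} (f : (Fin d → ℝ) → ℝ) (J : Finset (Fin d))
    (lam : Fin d → ℝ) (m : ℕ) (x : Fin d → ℝ) : ℝ :=
  scaledVar f (m - 1) (nearPoint J lam x m) / (m : ℝ) ^ (((d : ℝ) + J.card) / 2)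
    - varConst f J lam x

/-- The remainder of the squared bias. -/
noncomputable def biasSqRemainder {d : ℕ} (f g : (Fin d → ℝ) → ℝ) (J : Finset (Fin d))
    (lam : Fin d → ℝ) (m : ℕ) (x : Fin d → ℝ) : ℝ :=
  (multinomialMean (m - 1) (nearPoint J lam x m) (cellMean m f) - f (nearPoint J lam x m)) ^ 2
    - ((m : ℝ) ^ 2)⁻¹ * biasConst g J x ^ 2

theorem eventually_atTop_of_succ {p : ℕ → Prop} (h : ∀ᶠ N : ℕ in atTop, p (N + 1)) :
    ∀ᶠ m : ℕ in atTop, p m := by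
  rw [← Filter.map_add_atTop_eq_nat 1]
  exact h

theorem abs_sq_sub_sq_le {u v D K : ℝ} (h : |u - v| ≤ D) (hv : |v| ≤ K) :
    |u ^ 2 - v ^ 2| ≤ D * (2 * K + D) := by
  have e : u ^ 2 - v ^ 2 = (u - v) * (2 * v + (u - v)) := by ring
  rw [e, abs_mul]
  refine mul_le_mul h ((abs_add_le _ _).trans ?_) (abs_nonneg _) ((abs_nonneg _).trans h)
  rw [abs_mul, abs_two]
  linarith

section Expansion

variable {d : ℕ} {f g : (Fin d → ℝ) → ℝ} {M : ℝ} {J : Finset (Fin d)} {lam x : Fin d → ℝ}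

theorem SimplexTaylor.continuousOn_fullBiasConst (h : SimplexTaylor f g M) :
    ContinuousOn (fullBiasConst g) (simplex d) := by
  have h1 : ∀ i : Fin d, ContinuousOn (fun y => pderiv i g y) (simplex d) := fun i =>
    h.continuousOn_fderiv.clm_apply continuousOn_const
  have h2 : ∀ i j : Fin d, ContinuousOn (fun y => pderiv i (pderiv j g) y) (simplex d) :=
    fun i j => ((h.continuousOn_fderiv_fderiv.clm_apply continuousOn_const).clm_apply
      continuousOn_const).congr fun y hy => h.pderiv_pderiv_eq hy i j
  have h3 : ∀ i : Fin d, ContinuousOn (fun y : Fin d → ℝ => y i) (simplex d) := fun i =>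
    (continuous_apply i).continuousOn
  unfold fullBiasConst
  refine (continuousOn_finsetSum _ fun i _ => (continuousOn_const.sub (h3 i)).mul (h1 i)).add
    (continuousOn_const.mul (continuousOn_finsetSum _ fun i _ =>
      continuousOn_finsetSum _ fun j _ => ContinuousOn.mul (ContinuousOn.sub ?_
        ((h3 i).mul (h3 j))) (h2 i j)))
  split_ifs
  · exact h3 i
  · exact continuousOn_const

theorem tendsto_varRemainder (h : SimplexTaylor f g M) (hd : 1 ≤ d)
    (hlam : ∀ i ∈ J, 0 ≤ lam i) (hx : x ∈ admissible J) :
    Tendsto (fun m => varRemainder f J lam m x) atTop (𝓝 0) := by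
  rw [← tendsto_add_atTop_iff_nat 1]
  simpa [varRemainder] using (h.tendsto_scaledVar hd hlam hx).sub_const (varConst f J lam x)

theorem exists_abs_varRemainder_univ_le (h : SimplexTaylor f g M) (hd : 1 ≤ d)
    (hlam : ∀ i, 0 ≤ lam i) : ∃ C : ℝ, ∀ᶠ m : ℕ in atTop, ∀ x : Fin d → ℝ,
    |varRemainder f Finset.univ lam m x| ≤ C * (m : ℝ)⁻¹ := by
  obtain ⟨C, hC⟩ := h.exists_abs_scaledVar_sub_le hd hlam
  exact ⟨C, eventually_atTop_of_succ hC⟩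

/-- The bias expansion produces the constant at the moving point. Uniform continuity on the compact
simplex transfers it to the face point, uniformly in `x`, because the two points differ by at most
`(∑ lam i)/m`. -/
theorem eventually_abs_biasSqRemainder_le (h : SimplexTaylor f g M)
    (hlam : ∀ i ∈ J, 0 ≤ lam i) {δ η : ℝ} (hδ : 0 < δ) (hη : 0 < η) :
    ∀ᶠ m : ℕ in atTop, ∀ x ∈ admissible J, ∑ i ∈ Jᶜ, x i ≤ 1 - δ →
      |biasSqRemainder f g J lam m x| ≤ η * ((m : ℝ) ^ 2)⁻¹ := by
  obtain ⟨K, hK⟩ := (isCompact_simplex d).exists_bound_of_continuousOn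
    (f := fullBiasConst g) h.continuousOn_fullBiasConst
  have hunif := (isCompact_simplex d).uniformContinuousOn_of_continuous
    (f := fullBiasConst g) h.continuousOn_fullBiasConst
  rw [Metric.uniformContinuousOn_iff] at hunif
  -- The bias differs from its leading term by at most `2κ/m`, so its square differs by at most `κ
  -- (4|K| + 4κ)/m²`, and this must not exceed `η/m²`.
  set κ := min 1 (η / (4 * |K| + 4)) with hκ
  have hκ0 : 0 < κ := by positivity
  have hκ1 : κ ≤ 1 := min_le_left _ _
  have hκη : κ * (4 * |K| + 4) ≤ η := by
    have := min_le_right 1 (η / (4 * |K| + 4))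
    rwa [← hκ, le_div_iff₀ (by positivity)] at this
  obtain ⟨ρ, hρ, hunif⟩ := hunif κ hκ0
  refine eventually_atTop_of_succ ?_
  filter_upwards [h.eventually_abs_bias_sub_le (half_pos hδ) hκ0,
    (tendsto_add_atTop_nat 1).eventually (eventually_sum_nearPoint_le J lam (half_pos hδ)),
    (tendsto_add_atTop_nat 1).eventually (eventually_sum_nearPoint_le J lam (half_pos hρ))]
    with N h1 h2 h3 x hx hxδ
  have hm : (0 : ℝ) < ((N + 1 : ℕ) : ℝ) := by positivity
  have hsum := sum_nearPoint J lam x (N + 1)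
  have hy : nearPoint J lam x (N + 1) ∈ simplex d :=
    nearPoint_mem_simplex hlam hx (by linarith)
  have hz := facePoint_mem_simplex hx
  have hb := h1 _ hy (by rw [hsum]; linarith)
  have hd := hunif _ hy _ hz (by
    rw [dist_eq_norm]
    linarith [norm_nearPoint_sub_facePoint_le hlam x (N + 1)])
  rw [Real.dist_eq] at hd
  have hKz : |fullBiasConst g (facePoint J x)| ≤ |K| := (hK _ hz).trans (le_abs_self K)
  have hdist : |multinomialMean N (nearPoint J lam x (N + 1)) (cellMean (N + 1) f)
      - f (nearPoint J lam x (N + 1)) - fullBiasConst g (facePoint J x) / ((N + 1 : ℕ) : ℝ)|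
      ≤ 2 * κ / ((N + 1 : ℕ) : ℝ) := by
    have hd' : |fullBiasConst g (nearPoint J lam x (N + 1)) / ((N + 1 : ℕ) : ℝ)
        - fullBiasConst g (facePoint J x) / ((N + 1 : ℕ) : ℝ)| ≤ κ / ((N + 1 : ℕ) : ℝ) := by
      rw [← sub_div, abs_div, abs_of_pos hm]
      exact div_le_div_of_nonneg_right hd.le hm.le
    refine (abs_sub_le _ _ _).trans ((add_le_add hb hd').trans_eq ?_)
    ring
  have hmain := abs_sq_sub_sq_le hdist (K := |K| / ((N + 1 : ℕ) : ℝ)) (by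
    rw [abs_div, abs_of_pos hm]
    exact div_le_div_of_nonneg_right hKz hm.le)
  rw [biasSqRemainder, biasConst_eq_fullBiasConst, Nat.add_sub_cancel]
  rw [div_pow, div_eq_inv_mul (_ ^ 2)] at hmain
  refine hmain.trans ?_
  have e : 2 * κ / ((N + 1 : ℕ) : ℝ) * (2 * (|K| / ((N + 1 : ℕ) : ℝ)) + 2 * κ / ((N + 1 : ℕ) : ℝ))
      = κ * (4 * |K| + 4 * κ) * (((N + 1 : ℕ) : ℝ) ^ 2)⁻¹ := by
    field_simp
    ring
  rw [e]
  refine mul_le_mul_of_nonneg_right (le_trans ?_ hκη) (by positivity)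
  exact mul_le_mul_of_nonneg_left (by linarith) hκ0.le

/-- At the vertex all second-order coefficients vanish, so the bias constant there is a first-order
sum, and the Lipschitz bound on the gradient makes the error `O(‖y‖)`. -/
theorem SimplexTaylor.abs_sum_pderiv_sub_le (h : SimplexTaylor f g M) {y : Fin d → ℝ}
    (hy : y ∈ simplex d) :
    |(∑ i, (1 / 2 - y i) * pderiv i g y) - fullBiasConst g 0| ≤ 2 * d * M * ‖y‖ := by
  have hM := h.nonneg
  have h0 : (0 : Fin d → ℝ) ∈ simplex d := mem_simplex_iff.2 ⟨fun _ => le_rfl, by simp⟩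
  have e : fullBiasConst g 0 = ∑ i, (1 / 2) * pderiv i g 0 := by simp [fullBiasConst]
  rw [e, ← Finset.sum_sub_distrib]
  refine (Finset.abs_sum_le_sum_abs _ _).trans ?_
  have hterm : ∀ i ∈ Finset.univ,
      |(1 / 2 - y i) * pderiv i g y - 1 / 2 * pderiv i g 0| ≤ 2 * M * ‖y‖ := by
    intro i _
    have h1 : |pderiv i g y - pderiv i g 0| ≤ M * ‖y‖ := by
      have h2 := (fderiv ℝ g y - fderiv ℝ g 0).le_opNorm (Pi.single i 1)
      have h3 := h.lipschitz_fderiv 0 h0 y hy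
      rw [Pi.norm_single, norm_one, mul_one] at h2
      rw [sub_zero] at h3
      exact h2.trans h3
    have h4 : |pderiv i g 0| ≤ M := by
      have := h.abs_fderiv_le h0 (Pi.single i 1)
      rwa [Pi.norm_single, norm_one, mul_one] at this
    have h5 : |y i| ≤ ‖y‖ := norm_le_pi_norm y i
    have h6 : |1 / 2 - y i| ≤ 1 := by
      have := hy.1 i
      rw [abs_le]
      constructor <;> linarith [this.1, this.2]
    have e2 : (1 / 2 - y i) * pderiv i g y - 1 / 2 * pderiv i g 0
        = (1 / 2 - y i) * (pderiv i g y - pderiv i g 0) - y i * pderiv i g 0 := by ring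
    rw [e2]
    refine (abs_sub _ _).trans ?_
    rw [abs_mul, abs_mul]
    have h7 := mul_le_mul h6 h1 (abs_nonneg _) zero_le_one
    have h8 := mul_le_mul h5 h4 (abs_nonneg _) (norm_nonneg y)
    linarith
  refine (Finset.sum_le_card_nsmul _ _ _ hterm).trans_eq ?_
  simp
  ring

/-- At a vertex, the squared bias has an error of order `m⁻³`. -/
theorem exists_abs_biasSqRemainder_univ_le (h : SimplexTaylor f g M)
    (hlam : ∀ i, 0 ≤ lam i) : ∃ C : ℝ, ∀ᶠ m : ℕ in atTop, ∀ x : Fin d → ℝ,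
    |biasSqRemainder f g Finset.univ lam m x| ≤ C * ((m : ℝ) ^ 3)⁻¹ := by
  have hM := h.nonneg
  set Λ := ∑ i, lam i with hΛ
  have hΛ0 : 0 ≤ Λ := Finset.sum_nonneg fun i _ => hlam i
  -- The first two terms come from the first-order Taylor remainder, the `1` from the exponential
  -- tail, the last from moving the constant to the vertex.
  set D := 2 * M * Λ + 2 * M + 1 + 2 * d * M * Λ with hD
  have hD0 : 0 ≤ D := by positivity
  refine ⟨D * (2 * |fullBiasConst g 0| + D), eventually_atTop_of_succ ?_⟩
  filter_upwards [eventually_const_mul_pow_le (r := 3 / 4) (by norm_num) (by norm_num)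
      (4 * M * 2 ^ d) 2 one_pos,
    (tendsto_add_atTop_nat 1).eventually
      (eventually_sum_nearPoint_le Finset.univ lam (one_half_pos (α := ℝ)))] with N hpow hN x
  have hm : (0 : ℝ) < ((N + 1 : ℕ) : ℝ) := by positivity
  -- For `J = [d]` the components of `x` play no role and any point is admissible, so a constant one
  -- stands in for `x`.
  have hx : (fun _ => 1 : Fin d → ℝ) ∈ admissible (Finset.univ : Finset (Fin d)) :=
    ⟨fun i hi => (hi (Finset.mem_univ i)).elim, by simp⟩
  set y := nearPoint Finset.univ lam x (N + 1) with hydef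
  have hyx : y = nearPoint Finset.univ lam (fun _ => 1) (N + 1) := by
    rw [hydef, nearPoint_univ, nearPoint_univ]
  have hy : y ∈ simplex d := by
    rw [hyx]
    refine nearPoint_mem_simplex (fun i _ => hlam i) hx ?_
    simp only [Finset.compl_univ, Finset.sum_empty]
    linarith
  have hsum : ∑ i, y i = Λ / ((N + 1 : ℕ) : ℝ) := by
    rw [hydef, sum_nearPoint]
    simp [hΛ]
  have hnorm : ‖y‖ ≤ Λ / ((N + 1 : ℕ) : ℝ) := by
    have := norm_nearPoint_sub_facePoint_le (fun i _ => hlam i) x (N + 1) (J := Finset.univ)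
    rwa [facePoint_univ, sub_zero] at this
  have h1 := h.abs_mean_cellMean_sub_first_order hy N
  rw [hsum] at h1
  have h2 := h.abs_sum_pderiv_sub_le hy
  have h3 : 4 * M * 2 ^ d * ((1 + Λ / ((N + 1 : ℕ) : ℝ)) / 2) ^ N
      ≤ 1 * (1 / ((N + 1 : ℕ) : ℝ)) ^ 2 := by
    refine le_trans (mul_le_mul_of_nonneg_left (pow_le_pow_left₀ (by positivity) ?_ N)
      (by positivity)) hpow
    linarith
  have hdist : |multinomialMean N y (cellMean (N + 1) f) - f y
      - fullBiasConst g 0 / ((N + 1 : ℕ) : ℝ)| ≤ D / ((N + 1 : ℕ) : ℝ) ^ 2 := by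
    have e : multinomialMean N y (cellMean (N + 1) f) - f y
          - fullBiasConst g 0 / ((N + 1 : ℕ) : ℝ)
        = (multinomialMean N y (cellMean (N + 1) f)
            - (f y + (∑ i, (1 / 2 - y i) * pderiv i g y) / ((N + 1 : ℕ) : ℝ)))
          + ((∑ i, (1 / 2 - y i) * pderiv i g y) - fullBiasConst g 0) / ((N + 1 : ℕ) : ℝ) := by
      ring
    rw [e]
    refine (abs_add_le _ _).trans ?_
    rw [abs_div _ ((N + 1 : ℕ) : ℝ), abs_of_pos hm]
    have h4 : |(∑ i, (1 / 2 - y i) * pderiv i g y) - fullBiasConst g 0| / ((N + 1 : ℕ) : ℝ)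
        ≤ 2 * d * M * (Λ / ((N + 1 : ℕ) : ℝ)) / ((N + 1 : ℕ) : ℝ) :=
      div_le_div_of_nonneg_right
        (h2.trans (mul_le_mul_of_nonneg_left hnorm (by positivity))) hm.le
    have h5 := add_le_add (h1.trans (add_le_add_right h3 _)) h4
    refine h5.trans_eq ?_
    rw [hD]
    field_simp
  have hmain := abs_sq_sub_sq_le hdist (K := |fullBiasConst g 0| / ((N + 1 : ℕ) : ℝ)) (by
    rw [abs_div, abs_of_pos hm])
  rw [biasSqRemainder, biasConst_eq_fullBiasConst, Nat.add_sub_cancel, facePoint_univ, ← hydef]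
  rw [div_pow, div_eq_inv_mul (_ ^ 2)] at hmain
  refine hmain.trans ?_
  have hm1 : (((N + 1 : ℕ) : ℝ) ^ 2)⁻¹ ≤ (((N + 1 : ℕ) : ℝ))⁻¹ := by
    refine inv_anti₀ hm ?_
    have : (1 : ℝ) ≤ ((N + 1 : ℕ) : ℝ) := by exact_mod_cast Nat.le_add_left 1 N
    nlinarith
  have e : D * (2 * |fullBiasConst g 0| + D) * (((N + 1 : ℕ) : ℝ) ^ 3)⁻¹
      = D * (((N + 1 : ℕ) : ℝ) ^ 2)⁻¹ * ((2 * |fullBiasConst g 0| + D)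
        * (((N + 1 : ℕ) : ℝ))⁻¹) := by
    field_simp
  rw [e, div_eq_mul_inv]
  refine mul_le_mul_of_nonneg_left ?_ (by positivity)
  have h6 := mul_le_mul_of_nonneg_left hm1 hD0
  rw [div_eq_mul_inv]
  linarith

end Expansion

/-! ### The mean squared error as an instance of the abstract risk expansion -/

section RiskExpansion

variable {d : ℕ} {f g : (Fin d → ℝ) → ℝ} {M : ℝ} {J : Finset (Fin d)} {lam x : Fin d → ℝ}
  {Ω : Type*} [MeasurableSpace Ω] {μ : Measure Ω} [IsProbabilityMeasure μ] {X : ℕ → Ω → Fin d → ℝ}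

/-- Purely algebraic, since the remainders are the differences from the leading terms; it therefore
holds for all `m ≥ 1`, not only asymptotically. -/
theorem mse_nearPoint_eq (hf : IsSimplexDensity f) (hXmeas : ∀ i, Measurable (X i))
    (hXindep : iIndepFun X μ)
    (hXlaw : ∀ i, μ.map (X i) = (volume : Measure (Fin d → ℝ)).withDensity
      fun y => ENNReal.ofReal (f y)) (g : (Fin d → ℝ) → ℝ) (J : Finset (Fin d))
    (lam x : Fin d → ℝ) {n m : ℕ} (hn : 1 ≤ n) (hm : 1 ≤ m) :
    mse μ X f n m (nearPoint J lam x m)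
      = (n : ℝ)⁻¹ * (m : ℝ) ^ (((d : ℝ) + J.card) / 2) * varConst f J lam x
        + ((m : ℝ) ^ 2)⁻¹ * biasConst g J x ^ 2
        + (n : ℝ)⁻¹ * (m : ℝ) ^ (((d : ℝ) + J.card) / 2) * varRemainder f J lam m x
        + biasSqRemainder f g J lam m x := by
  obtain ⟨N, rfl⟩ := Nat.exists_eq_add_of_le' hm
  have hpos : (0 : ℝ) < ((N + 1 : ℕ) : ℝ) ^ (((d : ℝ) + J.card) / 2) :=
    Real.rpow_pos_of_pos (by positivity) _
  rw [mse_eq hf hXmeas hXindep hXlaw hn, varRemainder, biasSqRemainder, Nat.add_sub_cancel]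
  field_simp
  ring

theorem varConst_pos (hx : x ∈ admissible J) (hfx : 0 < f (facePoint J x)) :
    0 < varConst f J lam x := by
  have hpsi : 0 < psi Jᶜ x := by
    rw [psi_compl_eq hx]
    have h1 : 0 < 1 - ∑ j ∈ Jᶜ, x j := sub_pos.2 hx.2
    refine mul_pos (by positivity) (Finset.prod_pos fun j hj => ?_)
    have := (hx.1 j (Finset.mem_compl.1 hj)).1
    positivity
  exact mul_pos (mul_pos hfx hpsi)
    (Finset.prod_pos fun i _ => mul_pos (Real.exp_pos _) (besselI_zero_pos _))

theorem riskExpansion_mse (h : SimplexTaylor f g M) (hd : 1 ≤ d) (hf : IsSimplexDensity f)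
    (hXmeas : ∀ i, Measurable (X i)) (hXindep : iIndepFun X μ)
    (hXlaw : ∀ i, μ.map (X i) = (volume : Measure (Fin d → ℝ)).withDensity
      fun y => ENNReal.ofReal (f y)) (hlam : ∀ i ∈ J, 0 ≤ lam i) (hx : x ∈ admissible J)
    (hB : biasConst g J x ≠ 0) (hfx : 0 < f (facePoint J x)) :
    RiskExpansion (fun n k => mse μ X f n k (nearPoint J lam x k)) ((d : ℝ) + J.card)
      (biasConst g J x) (varConst f J lam x) (fun m => varRemainder f J lam m x)
      (fun m => (m : ℝ) ^ 2 * biasSqRemainder f g J lam m x) where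
  q_pos := by
    have : (1 : ℝ) ≤ d := by exact_mod_cast hd
    positivity
  B_ne := hB
  V_pos := varConst_pos hx hfx
  tendsto_var := tendsto_varRemainder h hd hlam hx
  tendsto_bias := by
    rw [Metric.tendsto_atTop']
    intro ε hε
    -- For a fixed `x` the margin `δ` is the distance `1 - ∑ x i` itself.
    obtain ⟨m0, hm0⟩ := eventually_atTop.1 (eventually_abs_biasSqRemainder_le h hlam
      (sub_pos.2 hx.2) (half_pos hε))
    refine ⟨m0, fun m hm => ?_⟩
    have hm' : (0 : ℝ) < m := by exact_mod_cast m0.zero_le.trans_lt hm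
    have := hm0 m hm.le x hx (by linarith)
    rw [Real.dist_eq, sub_zero, abs_mul, abs_of_pos (by positivity : (0 : ℝ) < (m : ℝ) ^ 2)]
    calc (m : ℝ) ^ 2 * |biasSqRemainder f g J lam m x|
        ≤ (m : ℝ) ^ 2 * (ε / 2 * ((m : ℝ) ^ 2)⁻¹) := mul_le_mul_of_nonneg_left this (by positivity)
      _ = ε / 2 := by field_simp
      _ < ε := half_lt_self hε
  expansion := by
    filter_upwards [eventually_ge_atTop 1] with m hm n hn
    have hm' : (0 : ℝ) < m := by exact_mod_cast hm
    rw [mse_nearPoint_eq hf hXmeas hXindep hXlaw g J lam x hn hm]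
    field_simp
    ring

end RiskExpansion

end BernsteinSimplex

/-! ### The theorem -/

theorem corollary1
    {d : ℕ} (hd : 1 ≤ d)
    (f fext : (Fin d → ℝ) → ℝ) (U : Set (Fin d → ℝ))
    (hf : BernsteinSimplex.IsSimplexDensity f)
    (hU : IsOpen U) (hSU : BernsteinSimplex.simplex d ⊆ U)
    (hC2 : ContDiffOn ℝ 2 fext U)
    (hext : Set.EqOn fext f (BernsteinSimplex.simplex d))
    {Ω : Type*} [MeasurableSpace Ω] (μ : Measure Ω) [IsProbabilityMeasure μ]
    (X : ℕ → Ω → Fin d → ℝ)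
    (hXmeas : ∀ i, Measurable (X i))
    (hXindep : iIndepFun X μ)
    (hXlaw : ∀ i, μ.map (X i) = (volume : Measure (Fin d → ℝ)).withDensity
      fun y => ENNReal.ofReal (f y))
    (J : Finset (Fin d)) (lam : Fin d → ℝ) (hlam : ∀ i ∈ J, 0 ≤ lam i) :
    -- decomposition of the mean squared error
    (∀ n m : ℕ, 1 ≤ n → 1 ≤ m → ∀ x ∈ BernsteinSimplex.simplex d,
      MemLp (BernsteinSimplex.estimatorRV X n m x) 2 μ ∧
      BernsteinSimplex.mse μ X f n m x
        = variance (BernsteinSimplex.estimatorRV X n m x) μ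
          + BernsteinSimplex.bias μ X f n m x ^ 2) ∧
    -- expansion of the mean squared error; the remainders depend on `m` and not on `n`
    (∃ a b r s : ℕ → (Fin d → ℝ) → ℝ,
      (∃ C : ℝ, ∀ᶠ m : ℕ in atTop, ∀ x ∈ BernsteinSimplex.admissible J,
        |a m x| ≤ C * (m : ℝ)⁻¹) ∧
      (∀ x ∈ BernsteinSimplex.admissible J, Tendsto (fun m => b m x) atTop (𝓝 0)) ∧
      (∀ δ : ℝ, 0 < δ → ∃ C : ℝ, ∀ᶠ m : ℕ in atTop, ∀ x ∈ BernsteinSimplex.admissible J,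
        ∑ i ∈ Jᶜ, x i ≤ 1 - δ → |r m x| ≤ C * ((m : ℝ) ^ 3)⁻¹) ∧
      (∀ δ : ℝ, 0 < δ → ∀ η : ℝ, 0 < η → ∀ᶠ m : ℕ in atTop,
        ∀ x ∈ BernsteinSimplex.admissible J,
          ∑ i ∈ Jᶜ, x i ≤ 1 - δ → |s m x| ≤ η * ((m : ℝ) ^ 2)⁻¹) ∧
      ∀ x ∈ BernsteinSimplex.admissible J, ∀ n m : ℕ, 1 ≤ n → 1 ≤ m →
        BernsteinSimplex.nearPoint J lam x m ∈ BernsteinSimplex.simplex d →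
        BernsteinSimplex.mse μ X f n m (BernsteinSimplex.nearPoint J lam x m)
          = (n : ℝ)⁻¹ * (m : ℝ) ^ (((d : ℝ) + J.card) / 2) * BernsteinSimplex.varConst f J lam x
            + ((m : ℝ) ^ 2)⁻¹ * BernsteinSimplex.biasConst fext J x ^ 2
            + (n : ℝ)⁻¹ * (m : ℝ) ^ (((d : ℝ) + J.card) / 2)
                * (a m x + b m x * BernsteinSimplex.notFull J)
            + r m x + s m x * BernsteinSimplex.notFull J) ∧
    -- optimal bandwidth and optimal mean squared error
    (∀ x ∈ BernsteinSimplex.admissible J,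
      BernsteinSimplex.biasConst fext J x ≠ 0 →
      0 < f (BernsteinSimplex.facePoint J x) →
      (∀ m : ℕ → ℕ,
        BernsteinSimplex.AsymptoticallyOptimal
            (fun n k => BernsteinSimplex.mse μ X f n k (BernsteinSimplex.nearPoint J lam x k)) m ↔
          Tendsto (fun n => (m n : ℝ) / BernsteinSimplex.mOpt ((d : ℝ) + J.card)
            (BernsteinSimplex.biasConst fext J x) (BernsteinSimplex.varConst f J lam x) n)
            atTop (𝓝 1)) ∧
      (∀ m : ℕ → ℕ,
        (fun n => (m n : ℝ) - BernsteinSimplex.mOpt ((d : ℝ) + J.card)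
            (BernsteinSimplex.biasConst fext J x) (BernsteinSimplex.varConst f J lam x) n)
          =O[atTop] (fun _ => (1 : ℝ)) →
        ∃ r s : ℕ → ℝ,
          r =O[atTop] (fun n : ℕ => (n : ℝ) ^ (-(6 / ((d : ℝ) + J.card + 4)))
            + BernsteinSimplex.notFull J * (n : ℝ) ^ (-(5 / ((d : ℝ) + J.card + 4)))) ∧
          s =o[atTop] (fun n : ℕ => (n : ℝ) ^ (-(4 / ((d : ℝ) + J.card + 4)))) ∧
          ∀ᶠ n in atTop,
            BernsteinSimplex.mse μ X f n (m n) (BernsteinSimplex.nearPoint J lam x (m n))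
              = BernsteinSimplex.optMSE ((d : ℝ) + J.card)
                  (BernsteinSimplex.biasConst fext J x) (BernsteinSimplex.varConst f J lam x) n
                + r n + s n * BernsteinSimplex.notFull J)) := by
  obtain ⟨M, h⟩ := BernsteinSimplex.exists_simplexTaylor hf hU hSU hC2 hext
  have hmse := fun x n m hn hm => BernsteinSimplex.mse_nearPoint_eq (n := n) (m := m) hf hXmeas
    hXindep hXlaw fext J lam x hn hm
  refine ⟨?_, ?_, ?_⟩
  · intro n m _ hm x _
    obtain ⟨N, rfl⟩ := Nat.exists_eq_add_of_le' hm
    exact ⟨BernsteinSimplex.memLp_estimatorRV hXmeas n N x,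
      BernsteinSimplex.mse_eq_variance_add_bias_sq f hXmeas n N x⟩
  -- For `J = [d]` the remainders have rates and go into the two `O` slots; otherwise they go
  -- entirely into the two `o` slots, and the `O` slots are zero.
  · by_cases hJ : J = Finset.univ
    · subst hJ
      have hlam' : ∀ i, 0 ≤ lam i := fun i => hlam i (Finset.mem_univ i)
      refine ⟨BernsteinSimplex.varRemainder f Finset.univ lam, fun _ _ => 0,
        BernsteinSimplex.biasSqRemainder f fext Finset.univ lam, fun _ _ => 0, ?_, ?_, ?_, ?_, ?_⟩
      · obtain ⟨C, hC⟩ := BernsteinSimplex.exists_abs_varRemainder_univ_le h hd hlam'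
        exact ⟨C, hC.mono fun m hm x _ => hm x⟩
      · exact fun x _ => tendsto_const_nhds
      · intro δ _
        obtain ⟨C, hC⟩ := BernsteinSimplex.exists_abs_biasSqRemainder_univ_le h hlam'
        exact ⟨C, hC.mono fun m hm x _ _ => hm x⟩
      · intro δ _ η hη
        refine Eventually.of_forall fun m x _ _ => ?_
        rw [abs_zero]
        positivity
      · intro x _ n m hn hm _
        rw [hmse x n m hn hm]
        ring
    · have hnf : BernsteinSimplex.notFull J = 1 := if_neg hJ
      refine ⟨fun _ _ => 0, BernsteinSimplex.varRemainder f J lam, fun _ _ => 0,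
        BernsteinSimplex.biasSqRemainder f fext J lam, ?_, ?_, ?_, ?_, ?_⟩
      · exact ⟨0, Eventually.of_forall fun m x _ => by simp⟩
      · exact fun x hx => BernsteinSimplex.tendsto_varRemainder h hd hlam hx
      · exact fun δ _ => ⟨0, Eventually.of_forall fun m x _ _ => by simp⟩
      · exact fun δ hδ η hη => BernsteinSimplex.eventually_abs_biasSqRemainder_le h hlam hδ hη
      · intro x _ n m hn hm _
        rw [hmse x n m hn hm, hnf]
        ring
  · intro x hx hB hfx
    have hR := BernsteinSimplex.riskExpansion_mse h hd hf hXmeas hXindep hXlaw hlam hx hB hfx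
    refine ⟨fun m => ⟨hR.ratio_of_asymptoticallyOptimal, hR.asymptoticallyOptimal_of_ratio⟩,
      fun m hm => ?_⟩
    by_cases hJ : J = Finset.univ
    · subst hJ
      have hlam' : ∀ i, 0 ≤ lam i := fun i => hlam i (Finset.mem_univ i)
      have hnf : BernsteinSimplex.notFull (Finset.univ : Finset (Fin d)) = 0 := if_pos rfl
      have hα : (fun m => BernsteinSimplex.varRemainder f Finset.univ lam m x)
          =O[atTop] (fun m : ℕ => (m : ℝ)⁻¹) := by
        obtain ⟨C, hC⟩ := BernsteinSimplex.exists_abs_varRemainder_univ_le h hd hlam'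
        refine IsBigO.of_bound C (hC.mono fun m hm => ?_)
        rw [Real.norm_eq_abs, Real.norm_of_nonneg (by positivity)]
        exact hm x
      have hβ : (fun m : ℕ => (m : ℝ) ^ 2
          * BernsteinSimplex.biasSqRemainder f fext Finset.univ lam m x)
          =O[atTop] (fun m : ℕ => (m : ℝ)⁻¹) := by
        obtain ⟨C, hC⟩ := BernsteinSimplex.exists_abs_biasSqRemainder_univ_le h hlam'
        refine IsBigO.of_bound C ?_
        filter_upwards [hC, eventually_ge_atTop 1] with m hm hm1
        have hm' : (0 : ℝ) < m := by exact_mod_cast hm1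
        rw [Real.norm_eq_abs, Real.norm_of_nonneg (by positivity), abs_mul,
          abs_of_pos (by positivity : (0 : ℝ) < (m : ℝ) ^ 2)]
        refine (mul_le_mul_of_nonneg_left (hm x) (by positivity)).trans_eq ?_
        field_simp
      have hO := hR.isBigO_sub_optMSE hα hβ hm
      refine ⟨_, fun _ => 0, hO.congr_right fun n => ?_, isLittleO_zero _ _,
        Eventually.of_forall fun n => ?_⟩
      · rw [hnf, zero_mul, add_zero]
      · rw [zero_mul, add_zero, add_sub_cancel]
    · have hnf : BernsteinSimplex.notFull J = 1 := if_neg hJ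
      -- For `J ≠ [d]` the whole difference is absorbed by the `o` term, so the summand with
      -- exponent `5/(q + 4)` in the `O` slot is not needed.
      refine ⟨fun _ => 0, _, isBigO_zero _ _, hR.isLittleO_sub_optMSE hm,
        Eventually.of_forall fun n => ?_⟩
      rw [hnf, add_zero, mul_one, add_sub_cancel]
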